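/- Let $(M,\lambda)$ be a Liouville sector with corners: a manifold with corners with a one-form $\lambda$ such that $\omega=d\lambda$ is symplectic, with Liouville field $Z$ ($\iota_Z\omega=\lambda$), cylindrical at infinity, whose codimension-one boundary strata $H_1,\dots,H_m$ are tangent to $Z$ at infinity, intersect cleanly with coisotropic pairwise intersections, and admit functions $I_i$ near $\partial M$ with $ZI_i=I_i$ near infinity, $dI_i\neq 0$ on the characteristic foliation of $H_i$, $dI_i=0$ on that of $H_j$ ($j\ne i$) and $\{I_i,I_j\}=0$. Fix a smoothing profile: a radial function $s$ of a symplectization end $S_0\times[0,\infty)$ of $M$ with compact complement; finitely many splittings $U_\delta\cong F_\delta\times\mathbb C^{m_\delta}_{\mathrm{Re}\ge0}$ (onto a neighbourhood of $\{\mathrm{Re}=0\}$), $\omega=\omega_{F_\delta}+\sum_i dR_{\delta,i}\wedge dI_{\delta,i}$, near the corners of $M$, with $R_{\delta,i}\ge 0$ vanishing exactly on the faces; symmetric corner-smoothing functions $\varphi_\delta$ of $[0,\infty)^{m_\delta}$ and $\varphi_{2}$ of $[0,\infty)^2$ (positive inside and zero on the boundary of the orthant, smooth with nonzero differential away from the corners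 of codimension at least $2$, equal to $x_i$ near the face $x_i=0$ away from the other faces, and such that $y\mapsto-\log\varphi(e^{-y_1},e^{-y_2},\dots)$ is convex); and a partition of unity subordinate to the $U_\delta$ and $\operatorname{Int}M$. Let $\mathfrak s_\varphi:\operatorname{Int}M\to\mathbb R$ be the end-profile function, obtained by gluing with the partition of unity the functions $$-\log\varphi_2\big(\varphi_\delta(R_{\delta,1},\dots,R_{\delta,m_\delta}),e^{-s}\big)\ \text{ on } U_\delta,\qquad s \ \text{ away from } \partial M;$$ it tends to $+\infty$ at $\partial M$. Let $J$ be a sectorial almost complex structure: $J$ is smooth and $\omega$-tame; near $\partial M$ it preserves the two factors of the splittings and restricts to an almost complex structure of contact type on $F_\delta$; and $-d(d\mathfrak s_\varphi\circ J)\ge 0$ (i.e. $-d(d\mathfrak s_\varphi\circ J)(v,Jv)\ge0$ for all $v$) on $\operatorname{Int}M$ outside a compact subset of $\operatorname{Int} M$. Let $g_J(v,w)=\frac12(\omega(v,Jw)+\omega(w,Jv))$. Let $L_0,\dots,L_k\subset\operatorname{Int}M$ be gradient-sectorial Lagrangians: exact Lagrangian submanifolds at positive $g_J$-distance from $\partial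 M$ such that, for some $r_i>0$, the normalized gradient $Z_{\mathfrak s_\varphi}=\operatorname{grad}\mathfrak s_\varphi/|\operatorname{grad}\mathfrak s_\varphi|^2$ with respect to $g_J$ is tangent to $L_i$ at all points of $L_i\cap\{\mathfrak s_\varphi\ge r_i\}$. Suppose that there is $\delta>0$ with $\operatorname{dist}(L_i,\partial M)\ge\delta$ for all $i$, and that, outside some compact subset of $\operatorname{Int} M$, $J$ is $\omega$-compatible ($\omega(Jv,Jw)=\omega(v,w)$) at the points of $L_0\cup\dots\cup L_k$. Then there is a constant $r_0>0$ with the following property. Let $p_i\in L_i\cap L_{i+1}$ ($i=0,\dots,k$, indices modulo $k+1$), let $z_0,\dots,z_k$ be points on $\partial D^2$ in counterclockwise order, $\Sigma=D^2\setminus\{z_0,\dots,z_k\}$, and let $u:\Sigma\to M$ be a smooth map (up to the boundary) with $\overline\partial_Ju=0$, $u(\text{open arc from }z_i\text{ to }z_{i+1})\subset L_i$, and $u\to p_i$ at the puncture between the arcs labelled by $L_i$ and $L_{i+1}$. Then $$u(\Sigma)\subset\{x\in\operatorname{Int}M:\ \mathfrak s_\varphi(x)\le r\},\qquad r=\max\big\{r_0,\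 \mathfrak s_\varphi(p_0),\dots,\mathfrak s_\varphi(p_k)\big\}.$$ In particular $u$ avoids $\partial M$, and, for fixed $(M,\mathfrak s_\varphi,J,L_0,\dots,L_k)$, $r$ depends only on the points $p_i$ and not on $u$ or the $z_i$. -/

import Mathlib

open Set Filter Topology Manifold
open scoped ContDiff

noncomputable section

namespace Sectorial

/-! ## Manifolds with corners, one-forms, exterior derivative -/

/-- The model of `d`-dimensional manifolds with boundary and corners: `[0,∞)^d ⊆ ℝ^d`. -/
abbrev QI (d : ℕ) :
    ModelWithCorners ℝ (EuclideanSpace ℝ (Fin d)) (EuclideanQuadrant d) :=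
  modelWithCornersEuclideanQuadrant d

section Basic

variable {d : ℕ} {M : Type*} [TopologicalSpace M] [ChartedSpace (EuclideanQuadrant d) M]

/-- (Not necessarily smooth) one-forms. -/
abbrev OneForm (d : ℕ) (M : Type*) [TopologicalSpace M]
    [ChartedSpace (EuclideanQuadrant d) M] : Type _ :=
  ∀ x : M, TangentSpace (QI d) x →L[ℝ] ℝ

/-- (Not necessarily smooth) fields of endomorphisms of the tangent bundle. -/
abbrev EndField (d : ℕ) (M : Type*) [TopologicalSpace M]
    [ChartedSpace (EuclideanQuadrant d) M] : Type _ :=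
  ∀ x : M, TangentSpace (QI d) x →L[ℝ] TangentSpace (QI d) x

/-- The differential of a real function. -/
def dfun (f : M → ℝ) : OneForm d M := fun x => mfderiv (QI d) 𝓘(ℝ, ℝ) f x

/-- The coordinate expression of a one-form in the chart at `x₀`: its pull-back under the
inverse chart. -/
def OneForm.inChart (a : OneForm d M) (x₀ : M) (y : EuclideanSpace ℝ (Fin d)) :
    EuclideanSpace ℝ (Fin d) →L[ℝ] ℝ :=
  (a ((extChartAt (QI d) x₀).symm y)).comp
    (mfderivWithin 𝓘(ℝ, EuclideanSpace ℝ (Fin d)) (QI d)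
      (extChartAt (QI d) x₀).symm (range (QI d)) y)

def OneForm.IsSmooth (a : OneForm d M) : Prop :=
  ∀ x₀ : M, ContDiffOn ℝ ∞ (a.inChart x₀) (extChartAt (QI d) x₀).target

/-- The exterior derivative `(da)_x(v,w)`, computed in the chart at `x` (tangent vectors at `x`
are identified with their coordinates in that chart, as everywhere in Mathlib). -/
def extD (a : OneForm d M) (x : M) (v w : TangentSpace (QI d) x) : ℝ :=
  fderivWithin ℝ (a.inChart x) (range (QI d)) (extChartAt (QI d) x x) v w
    - fderivWithin ℝ (a.inChart x) (range (QI d)) (extChartAt (QI d) x x) w v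

/-- The coordinate expression of an endomorphism field in the chart at `x₀`. -/
def EndField.inChart (J : EndField d M) (x₀ : M) (y : EuclideanSpace ℝ (Fin d)) :
    EuclideanSpace ℝ (Fin d) →L[ℝ] EuclideanSpace ℝ (Fin d) :=
  ((mfderiv (QI d) 𝓘(ℝ, EuclideanSpace ℝ (Fin d)) (extChartAt (QI d) x₀)
      ((extChartAt (QI d) x₀).symm y)).comp
    (J ((extChartAt (QI d) x₀).symm y))).comp
    (mfderivWithin 𝓘(ℝ, EuclideanSpace ℝ (Fin d)) (QI d)
      (extChartAt (QI d) x₀).symm (range (QI d)) y)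

def EndField.IsSmooth (J : EndField d M) : Prop :=
  ∀ x₀ : M, ContDiffOn ℝ ∞ (J.inChart x₀) (extChartAt (QI d) x₀).target

/-- The tangent space at `x` of an embedded submanifold `S` (possibly with boundary and corners):
the vectors annihilated by the differentials of all smooth functions vanishing on `S`. -/
def tangentTo (S : Set M) (x : M) : Submodule ℝ (TangentSpace (QI d) x) where
  carrier := {v | ∀ f : M → ℝ, ContMDiff (QI d) 𝓘(ℝ, ℝ) ∞ f → (∀ y ∈ S, f y = 0) →
    (dfun f : OneForm d M) x v = 0}
  zero_mem' := fun f _ _ => map_zero _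
  add_mem' := fun {v w} hv hw f hf h0 => by rw [map_add, hv f hf h0, hw f hf h0, add_zero]
  smul_mem' := fun c v hv f hf h0 => by rw [map_smul, hv f hf h0, smul_zero]

end Basic

/-! ## Liouville sectors with corners -/

/-- A Liouville one-form `lam` (so `ω = d lam` is symplectic) with its Liouville vector field `Z`,
`ω(Z, ·) = lam`. -/
structure LiouvilleForm (d : ℕ) (M : Type*) [TopologicalSpace M]
    [ChartedSpace (EuclideanQuadrant d) M] where
  lam : OneForm d M
  smooth : lam.IsSmooth
  nondegenerate : ∀ (x : M) (v : TangentSpace (QI d) x), (∀ w, extD lam x v w = 0) → v = 0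
  Z : ∀ x : M, TangentSpace (QI d) x
  Z_spec : ∀ (x : M) (w : TangentSpace (QI d) x), extD lam x (Z x) w = lam x w

section Sector

variable {d : ℕ} {M : Type*} [TopologicalSpace M] [ChartedSpace (EuclideanQuadrant d) M]

/-- The symplectic form `ω = d lam`. -/
def LiouvilleForm.om (X : LiouvilleForm d M) (x : M) (v w : TangentSpace (QI d) x) : ℝ :=
  extD X.lam x v w

/-- `rad` is the radial function of a symplectization end: `W = {rad ≤ 0}` is compact,
`S₀ = {rad = 0}` is a hypersurface transverse to `Z`, and the flow of `Z` identifies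
`S₀ × [0,∞)` with `{rad ≥ 0}`, `rad` being the second coordinate. (Inside `W`, `rad` is an
arbitrary smooth continuation.) -/
structure IsRadial (X : LiouvilleForm d M) (rad : M → ℝ) : Prop where
  smooth : ContMDiff (QI d) 𝓘(ℝ, ℝ) ∞ rad
  compact : IsCompact {x | rad x ≤ 0}
  derivative : ∀ x, 0 ≤ rad x → (dfun rad : OneForm d M) x (X.Z x) = 1
  flow : ∀ x, 0 ≤ rad x → ∃ γ : ℝ → M,
    IsMIntegralCurveOn (I := QI d) γ X.Z (Ici 0) ∧ rad (γ 0) = 0 ∧ γ (rad x) = x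

/-- The codimension-one boundary strata of the manifold with corners `M` are `H₀, …, H_{m-1}`:
each is closed, and near every point there is a chart in which the boundary hyperplanes
`{y_a = 0}` met by the chart are exactly, and without repetition, the `H_i` through the point. -/
structure IsFaceSystem (d : ℕ) {M : Type*} [TopologicalSpace M]
    [ChartedSpace (EuclideanQuadrant d) M] {m : ℕ} (H : Fin m → Set M) : Prop where
  closed : ∀ i, IsClosed (H i)
  chart : ∀ x : M, ∃ e ∈ IsManifold.maximalAtlas (QI d) ∞ M, x ∈ e.source ∧
    ∃ c : {i : Fin m // x ∈ H i} → Fin d, Function.Injective c ∧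
      (∀ i, ∀ y ∈ e.source, (y ∈ H i.1 ↔ (e y).1 (c i) = 0)) ∧
      (∀ j, x ∉ H j → Disjoint (H j) e.source) ∧
      (∀ y ∈ e.source, ∀ a : Fin d, (e y).1 a = 0 → ∃ i, c i = a)

/-- Functions `F i` defined near the boundary, as required of a sectorial collection `H`: they are
linear near infinity, nonzero on the characteristic foliation of `H i`, zero on that of `H j` for
`j ≠ i`, and Poisson commute. -/
structure AreSectorialFunctions (X : LiouvilleForm d M) {m : ℕ} (H : Fin m → Set M)
    (N : Set M) (F : Fin m → M → ℝ) : Prop where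
  isOpen : IsOpen N
  boundary_subset : (QI d).boundary M ⊆ N
  smooth : ∀ i, ContMDiffOn (QI d) 𝓘(ℝ, ℝ) ∞ (F i) N
  linear : ∃ K : Set M, IsCompact K ∧
    ∀ i, ∀ x ∈ N \ K, (dfun (F i) : OneForm d M) x (X.Z x) = F i x
  ne_zero : ∀ i, ∀ x ∈ H i, ∀ v ∈ tangentTo (d := d) (H i) x,
    (∀ w ∈ tangentTo (d := d) (H i) x, X.om x v w = 0) → v ≠ 0 →
    (dfun (F i) : OneForm d M) x v ≠ 0
  eq_zero : ∀ i j, i ≠ j → ∀ x ∈ H j, ∀ v ∈ tangentTo (d := d) (H j) x,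
    (∀ w ∈ tangentTo (d := d) (H j) x, X.om x v w = 0) → (dfun (F i) : OneForm d M) x v = 0
  commute : ∀ i j, ∀ x ∈ N, ∀ V W : TangentSpace (QI d) x,
    (∀ w, X.om x V w = (dfun (F i) : OneForm d M) x w) →
    (∀ w, X.om x W w = (dfun (F j) : OneForm d M) x w) → X.om x V W = 0

/-- A Liouville sector with corners: a Liouville manifold with corners, cylindrical at infinity,
whose codimension-one boundary strata `H i` form a sectorial collection. -/
structure LiouvilleSector (d : ℕ) (M : Type*) [TopologicalSpace M]
    [ChartedSpace (EuclideanQuadrant d) M] extends LiouvilleForm d M where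
  exists_end : ∃ rad : M → ℝ, IsRadial toLiouvilleForm rad
  m : ℕ
  H : Fin m → Set M
  faces : IsFaceSystem d H
  cylindrical : ∃ K : Set M, IsCompact K ∧
    ∀ i, ∀ x ∈ H i, x ∉ K → Z x ∈ tangentTo (d := d) (H i) x
  coisotropic : ∀ i j, i ≠ j → ∀ x ∈ H i ∩ H j, ∀ v : TangentSpace (QI d) x,
    (∀ w ∈ tangentTo (d := d) (H i ∩ H j) x, toLiouvilleForm.om x v w = 0) →
    v ∈ tangentTo (d := d) (H i ∩ H j) x
  exists_functions : ∃ (N : Set M) (F : Fin m → M → ℝ),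
    AreSectorialFunctions toLiouvilleForm H N F

/-! ## Splitting data -/

/-- Splitting data near the corner `⋂_{i ∈ A} H i`: on an open set `U` that meets no other face,
`(proj, (R_i + √-1 I_i)_{i ∈ A})` is a diffeomorphism of `U` onto a neighbourhood of
`F × (√-1 ℝ)^A` in `F × (ℂ_{Re ≥ 0})^A` with `R_i = 0` exactly on `H i`, where
`F = {x ∈ U | R = I = 0}`, and it takes `ω` to `ω_F + ∑ dR_i ∧ dI_i`. (That the map is a local
diffeomorphism is automatic from the formula for `ω`, so injectivity and the position of the
image are all that is stated.) -/
structure SplittingChart (X : LiouvilleSector d M) where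
  A : Finset (Fin X.m)
  nonempty : A.Nonempty
  U : Set M
  isOpen : IsOpen U
  disjoint : ∀ i, i ∉ A → Disjoint U (X.H i)
  R : A → M → ℝ
  Im : A → M → ℝ
  proj : M → M
  smooth_R : ∀ i, ContMDiffOn (QI d) 𝓘(ℝ, ℝ) ∞ (R i) U
  smooth_Im : ∀ i, ContMDiffOn (QI d) 𝓘(ℝ, ℝ) ∞ (Im i) U
  smooth_proj : ContMDiffOn (QI d) (QI d) ∞ proj U
  R_nonneg : ∀ i, ∀ x ∈ U, 0 ≤ R i x
  R_eq_zero : ∀ i, ∀ x ∈ U, (R i x = 0 ↔ x ∈ X.H i.1)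
  proj_mem : ∀ x ∈ U, proj x ∈ U ∧ ∀ i, R i (proj x) = 0 ∧ Im i (proj x) = 0
  proj_self : ∀ x ∈ U, (∀ i, R i x = 0 ∧ Im i x = 0) → proj x = x
  injective : ∀ x ∈ U, ∀ y ∈ U, proj x = proj y → (∀ i, R i x = R i y) →
    (∀ i, Im i x = Im i y) → x = y
  surjective : ∀ f ∈ U, (∀ i, R i f = 0 ∧ Im i f = 0) → ∀ t : A → ℝ,
    ∃ x ∈ U, proj x = f ∧ ∀ i, R i x = 0 ∧ Im i x = t i
  symplectic : ∀ x ∈ U, ∀ v w : TangentSpace (QI d) x,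
    X.om x v w =
      X.om (proj x) (mfderiv (QI d) (QI d) proj x v) (mfderiv (QI d) (QI d) proj x w)
      + ∑ i : A, ((dfun (R i) : OneForm d M) x v * (dfun (Im i) : OneForm d M) x w
          - (dfun (R i) : OneForm d M) x w * (dfun (Im i) : OneForm d M) x v)

/-- The symplectic leaf `F = {R = I = 0}` of a splitting. -/
def SplittingChart.F {X : LiouvilleSector d M} (C : SplittingChart X) : Set M :=
  {x ∈ C.U | ∀ i, C.R i x = 0 ∧ C.Im i x = 0}

/-- The tangent space at `x` of the leaf `F × {(R, I)}` through `x`. -/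
def SplittingChart.leaf {X : LiouvilleSector d M} (C : SplittingChart X) (x : M) :
    Set (TangentSpace (QI d) x) :=
  {v | ∀ i, (dfun (C.R i) : OneForm d M) x v = 0 ∧ (dfun (C.Im i) : OneForm d M) x v = 0}

/-! ## Smoothing profiles and end-profile functions -/

/-- Convex corner-smoothing functions of `[0,∞)^ι`, with size parameter `ε₀`. They are symmetric,
positive inside and zero on the boundary of the orthant, regular away from the corners of
codimension at least two, equal to the coordinate `x_i` near the face `{x_i = 0}` away from the other
faces, and, in the logarithmic coordinates `y_i = -log x_i`, a convex interpolation
`Φ(y) = -log φ(e^{-y})`. So the level sets of `φ` smooth the boundary of the orthant. -/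
structure IsCornerSmoothing {ι : Type*} [Fintype ι] (ε₀ : ℝ) (φ : (ι → ℝ) → ℝ) : Prop where
  symmetric : ∀ (σ : Equiv.Perm ι) (x : ι → ℝ), φ (x ∘ σ) = φ x
  nonneg : ∀ x : ι → ℝ, (∀ i, 0 ≤ x i) → 0 ≤ φ x
  eq_zero : ∀ x : ι → ℝ, (∀ i, 0 ≤ x i) → (φ x = 0 ↔ ∃ i, x i = 0)
  regular : ∀ x : ι → ℝ, (∀ i, 0 ≤ x i) → (∀ i j, x i = 0 → x j = 0 → i = j) →
    ContDiffWithinAt ℝ ∞ φ {y | ∀ i, 0 ≤ y i} x ∧ fderivWithin ℝ φ {y | ∀ i, 0 ≤ y i} x ≠ 0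
  convex : ConvexOn ℝ univ (fun y : ι → ℝ => -Real.log (φ (fun i => Real.exp (-y i))))
  linear : ∃ ε T : ℝ, 0 < ε ∧ 0 < T ∧ ε₀ < 2 * T * √ε ∧ 2 * T * √ε < 3 / 2 * ε₀ ∧
    ∀ (x : ι → ℝ) (i : ι), 0 ≤ x i → x i ≤ √ε / 4 →
      (∀ j, j ≠ i → 2 * T * √ε ≤ x j) → φ x = x i

/-- A smoothing profile: the size parameter `ε₀`, a symplectization end with radial function
`rad`, splitting data near the corners, corner-smoothing functions, and a partition of unity
subordinate to the corner charts and to the complement of `∂M`. -/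
structure SmoothingProfile (X : LiouvilleSector d M) where
  ε₀ : ℝ
  ε₀_pos : 0 < ε₀
  rad : M → ℝ
  isRadial : IsRadial X.toLiouvilleForm rad
  n : ℕ
  chart : Fin n → SplittingChart X
  φ : ∀ c : Fin n, ((chart c).A → ℝ) → ℝ
  isCornerSmoothing : ∀ c, IsCornerSmoothing ε₀ (φ c)
  φ₂ : Fin n → (Fin 2 → ℝ) → ℝ
  isCornerSmoothing₂ : ∀ c, IsCornerSmoothing ε₀ (φ₂ c)
  χ : Fin n → M → ℝ
  χ₀ : M → ℝ
  smooth_χ : ∀ c, ContMDiff (QI d) 𝓘(ℝ, ℝ) ∞ (χ c)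
  smooth_χ₀ : ContMDiff (QI d) 𝓘(ℝ, ℝ) ∞ χ₀
  χ_nonneg : ∀ c x, 0 ≤ χ c x
  χ₀_nonneg : ∀ x, 0 ≤ χ₀ x
  sum_eq_one : ∀ x, χ₀ x + ∑ c, χ c x = 1
  support_χ : ∀ c, tsupport (χ c) ⊆ (chart c).U
  support_χ₀ : tsupport χ₀ ⊆ (QI d).interior M

/-- The sectorial corner smoothing function `s_m = -log φ(R_1, …, R_m)`. -/
def SmoothingProfile.cornerFun {X : LiouvilleSector d M} (P : SmoothingProfile X)
    (c : Fin P.n) (x : M) : ℝ :=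
  -Real.log (P.φ c (fun i => (P.chart c).R i x))

/-- `s_{m+1} = -log φ₂(e^{-s_m}, e^{-s})` with `s` the radial function. -/
def SmoothingProfile.cornerEndFun {X : LiouvilleSector d M} (P : SmoothingProfile X)
    (c : Fin P.n) (x : M) : ℝ :=
  -Real.log (P.φ₂ c ![Real.exp (-P.cornerFun c x), Real.exp (-P.rad x)])

/-- The end-profile function, glued from the functions `s_{m+1}` at the corners and, away from
`∂M`, the radial function. It is a real function on the interior of `M` and tends to `+∞` at
`∂M`; its values at points of `∂M` have no meaning and are never used. -/
def SmoothingProfile.endProfile {X : LiouvilleSector d M} (P : SmoothingProfile X) (x : M) : ℝ :=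
  P.χ₀ x * P.rad x + ∑ c, P.χ c x * P.cornerEndFun c x

/-! ## Sectorial almost complex structures -/

/-- `J` restricted to the leaf `F` of the splitting is of contact type at infinity (on `N`): there
is a function `ρ > 0` (the exponential of a radial function of the Liouville manifold
`(F, lam|_F)`, so `dρ(Z_F) = ρ`) with `-dρ ∘ J = lam` on `TF`, outside a compact set. -/
def SplittingChart.IsContactTypeOnLeaf {X : LiouvilleSector d M} (C : SplittingChart X)
    (N : Set M) (J : EndField d M) : Prop :=
  ∃ (ρ : M → ℝ) (K : Set M), ContMDiffOn (QI d) 𝓘(ℝ, ℝ) ∞ ρ C.U ∧ IsCompact K ∧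
    ∀ x ∈ (C.F ∩ N) \ K, 0 < ρ x ∧
      (∀ ζ ∈ C.leaf x, (∀ w ∈ C.leaf x, X.om x ζ w = X.lam x w) →
        (dfun ρ : OneForm d M) x ζ = ρ x) ∧
      (∀ v ∈ C.leaf x, X.lam x v = -(dfun ρ : OneForm d M) x (J x v))

/-- Almost complex structures tamed by `ω`. -/
structure IsTameACS (X : LiouvilleForm d M) (J : EndField d M) : Prop where
  smooth : J.IsSmooth
  square : ∀ (x : M) (v : TangentSpace (QI d) x), J x (J x v) = -v
  tame : ∀ (x : M) (v : TangentSpace (QI d) x), v ≠ 0 → 0 < X.om x v (J x v)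

/-- Sectorial almost complex structures for a smoothing profile. A neighbourhood of
`∂_∞M ∪ ∂M` is the complement of a compact subset of the interior of `M`. -/
structure IsSectorial {X : LiouvilleSector d M} (P : SmoothingProfile X)
    (J : EndField d M) : Prop extends IsTameACS X.toLiouvilleForm J where
  /-- Near `∂M`, `J` preserves the splitting and is of contact type on `F`. -/
  leaves : ∃ N : Fin P.n → Set M,
    (∀ c, IsOpen (N c) ∧ N c ⊆ (P.chart c).U) ∧ (QI d).boundary M ⊆ ⋃ c, N c ∧
    ∀ c, (∀ x ∈ N c,
        (∀ v ∈ (P.chart c).leaf x, J x v ∈ (P.chart c).leaf x) ∧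
        (∀ v, mfderiv (QI d) (QI d) (P.chart c).proj x v = 0 →
          mfderiv (QI d) (QI d) (P.chart c).proj x (J x v) = 0)) ∧
      (P.chart c).IsContactTypeOnLeaf (N c) J
  /-- `-d(ds ∘ J) ≥ 0` on a neighbourhood of `∂_∞M ∪ ∂M`. -/
  pseudoconvex : ∃ K : Set M, IsCompact K ∧ K ⊆ (QI d).interior M ∧
    ∀ x ∈ (QI d).interior M \ K, ∀ v : TangentSpace (QI d) x,
      0 ≤ -extD (fun y => ((dfun P.endProfile : OneForm d M) y).comp (J y)) x v (J x v)

/-- The metric `g_J(v,w) = (ω(v,Jw) + ω(w,Jv))/2`. -/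
def metric (X : LiouvilleForm d M) (J : EndField d M) (x : M)
    (v w : TangentSpace (QI d) x) : ℝ :=
  (X.om x v (J x w) + X.om x w (J x v)) / 2

/-- The `g_J`-length of a path `γ : [0,1] → M`. -/
def pathLength (X : LiouvilleForm d M) (J : EndField d M) (γ : ℝ → M) : ℝ :=
  ∫ t in (0 : ℝ)..1, √(metric X J (γ t)
    (mfderivWithin 𝓘(ℝ, ℝ) (QI d) γ (Icc 0 1) t (1 : ℝ))
    (mfderivWithin 𝓘(ℝ, ℝ) (QI d) γ (Icc 0 1) t (1 : ℝ)))

/-- `dist(S, T) ≥ δ` for the Riemannian distance of `g_J`. -/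
def DistGE (X : LiouvilleForm d M) (J : EndField d M) (S T : Set M) (δ : ℝ) : Prop :=
  ∀ γ : ℝ → M, ContMDiffOn 𝓘(ℝ, ℝ) (QI d) 1 γ (Icc 0 1) → γ 0 ∈ S → γ 1 ∈ T →
    δ ≤ pathLength X J γ

/-! ## Gradient-sectorial Lagrangians -/

/-- `G` is the `g_J`-gradient of `s` at `x`. -/
def IsGradientAt (X : LiouvilleForm d M) (J : EndField d M) (s : M → ℝ) (x : M)
    (G : TangentSpace (QI d) x) : Prop :=
  ∀ w, metric X J x G w = (dfun s : OneForm d M) x w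

/-- Exact Lagrangian submanifolds. -/
structure IsExactLagrangian (X : LiouvilleForm d M) (L : Set M) : Prop where
  submanifold : ∃ q : ℕ, 2 * q = d ∧ ∀ x ∈ L, ∃ (V : Set M) (f : M → EuclideanSpace ℝ (Fin q)),
    IsOpen V ∧ x ∈ V ∧ ContMDiffOn (QI d) 𝓘(ℝ, EuclideanSpace ℝ (Fin q)) ∞ f V ∧
    (∀ y ∈ V, y ∈ L ↔ f y = 0) ∧
    ∀ y ∈ L ∩ V, Function.Surjective
      (mfderiv (QI d) 𝓘(ℝ, EuclideanSpace ℝ (Fin q)) f y)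
  isotropic : ∀ x ∈ L, ∀ v ∈ tangentTo (d := d) L x, ∀ w ∈ tangentTo (d := d) L x,
    X.om x v w = 0
  exact : ∃ (V : Set M) (h : M → ℝ), IsOpen V ∧ L ⊆ V ∧
    ContMDiffOn (QI d) 𝓘(ℝ, ℝ) ∞ h V ∧
    ∀ x ∈ L, ∀ v ∈ tangentTo (d := d) L x, X.lam x v = (dfun h : OneForm d M) x v

/-- Gradient-sectorial Lagrangians: in the interior, at positive distance from `∂M`, and with the
normalized gradient `Z_s = grad s / |grad s|²` of the end-profile function tangent to
`L ∩ {s ≥ r₀}`. -/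
structure IsGradientSectorial {X : LiouvilleSector d M} (P : SmoothingProfile X)
    (J : EndField d M) (L : Set M) : Prop extends
    IsExactLagrangian X.toLiouvilleForm L where
  subset_interior : L ⊆ (QI d).interior M
  dist_pos : ∃ δ > 0, DistGE X.toLiouvilleForm J L ((QI d).boundary M) δ
  invariant : ∃ r₀ > 0, ∀ x ∈ L, r₀ ≤ P.endProfile x → ∀ G : TangentSpace (QI d) x,
    IsGradientAt X.toLiouvilleForm J P.endProfile x G →
    (metric X.toLiouvilleForm J x G G)⁻¹ • G ∈ tangentTo (d := d) L x

end Sector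

/-! ## Holomorphic polygons -/

/-- `k+1` points on the unit circle in counterclockwise order, given by their angles. -/
structure IsCyclic {k : ℕ} (θ : Fin (k + 1) → ℝ) : Prop where
  strictMono : StrictMono θ
  lt_two_pi : θ (Fin.last k) < θ 0 + 2 * Real.pi

/-- The marked point `z_i`. -/
def vertex {k : ℕ} (θ : Fin (k + 1) → ℝ) (i : Fin (k + 1)) : ℂ :=
  Complex.exp (θ i * Complex.I)

/-- The angle at which the boundary arc starting at `z_i` ends. -/
def nextAngle {k : ℕ} (θ : Fin (k + 1) → ℝ) (i : Fin (k + 1)) : ℝ :=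
  if i = Fin.last k then θ 0 + 2 * Real.pi else θ (i + 1)

/-- The open boundary arc from `z_i` to `z_{i+1}` (indices modulo `k+1`). -/
def arc {k : ℕ} (θ : Fin (k + 1) → ℝ) (i : Fin (k + 1)) : Set ℂ :=
  {z | ∃ t : ℝ, θ i < t ∧ t < nextAngle θ i ∧ z = Complex.exp (t * Complex.I)}

/-- The domain `Σ = D² \ {z_0, …, z_k}`, `D²` being the closed unit disc. -/
def polygonDomain {k : ℕ} (θ : Fin (k + 1) → ℝ) : Set ℂ :=
  Metric.closedBall 0 1 \ range (vertex θ)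

/-- `u : Σ → M` is a `J`-holomorphic polygon with boundary on `L_0, …, L_k` and asymptotic to
`p_i` at the puncture `z_{i+1}` between the arcs labelled `L_i` and `L_{i+1}`. (Uniform
convergence to a point in strip-like coordinates at a puncture is convergence at the puncture.) -/
structure IsPolygon {d : ℕ} {M : Type*} [TopologicalSpace M]
    [ChartedSpace (EuclideanQuadrant d) M] (J : EndField d M) {k : ℕ}
    (L : Fin (k + 1) → Set M) (p : Fin (k + 1) → M) (θ : Fin (k + 1) → ℝ) (u : ℂ → M) :
    Prop where
  cyclic : IsCyclic θ
  smooth : ContMDiffOn 𝓘(ℝ, ℂ) (QI d) ∞ u (polygonDomain θ)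
  holomorphic : ∀ z ∈ polygonDomain θ, ∀ ξ : ℂ,
    mfderivWithin 𝓘(ℝ, ℂ) (QI d) u (polygonDomain θ) z (Complex.I * ξ : ℂ) =
      J (u z) (mfderivWithin 𝓘(ℝ, ℂ) (QI d) u (polygonDomain θ) z ξ)
  boundary : ∀ i, ∀ z ∈ arc θ i, u z ∈ L i
  asymptotic : ∀ i, Tendsto u (𝓝[polygonDomain θ] (vertex θ (i + 1))) (𝓝 (p i))

end Sectorial

end

/-! Two maximum principles are used in succession: one confines `u` to the interior of `M`, the
other bounds the end-profile function s along it.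

Interior. In a corner chart let w ≥ 0 be a boundary coordinate of `u`, with ℓ the corresponding
linear functional. Holomorphicity gives Δw = ℓ(`leviVec`), evaluated at the point and at the vector
u_x (`laplace_of_holomorphic`). If ℓ(`leviVec`) ≤ 0 on complex-tangent vectors at {ℓ = 0}, Lipschitz
dependence (`leviVec_le`) yields Δw ≤ C(|w_x| + |w_y| + w). By `strong_minimum_principle` a disc
touching the boundary at an interior point of its domain lies locally in the boundary
(`IsSectorial.eventually_boundary`). As the disc is connected and the limits `p i` at the punctures
are interior points of `M`, there is no touching at all.

The sign comes from plurisubharmonicity of s. Near an open face s = -∑ χ_c log ρ_c, where each ρ_c =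
φ₂(φ(R), e^{-rad}) vanishes exactly to first order on the face. Multiply the Levi form of s by the
distance t to the face and let t → 0 along complex-tangent vectors: the second derivatives drop out
and -ℓ(`leviVec`) remains, so it is nonnegative (`leviVec_nonpos`). First-order vanishing of ρ_c
needs dR_i ≠ 0, which follows from a dimension count using the splitting of ω and the coisotropic
intersections (`SplittingChart.dfun_R_ne_zero`). Corner points are reached by continuity.

Bound. Above a suitable level r₀, Δ(s ∘ u) = -d(ds ∘ J)(u_x, J u_x) ≥ 0. There grad s is tangent to
each `L i` and J is compatible with ω, so ds(Jv) = 0 for v tangent to `L i`: the normal derivative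
of s ∘ u vanishes on the arcs (`dfun_apply_eq_zero_of_gradient_mem`). A maximum above r cannot lie
inside, by the strong principle, nor on an arc, by `hopf_lemma`, and it cannot escape into a
puncture, where s ∘ u tends to some s(`p i`) ≤ r (`IsPolygon.le_of_pseudoconvex`). -/

noncomputable section
namespace Sectorial

/-! ## The Hopf lemma in the plane -/

/-- The Laplacian of a function on the plane. -/
def lap (f : ℂ → ℝ) (z : ℂ) : ℝ :=
  fderiv ℝ (fun ζ => fderiv ℝ f ζ 1) z 1 + fderiv ℝ (fun ζ => fderiv ℝ f ζ Complex.I) z Complex.I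

/-- Restrict `f` to the line through `z` in direction `v`. A negative second derivative would make
the minimum a local maximum as well, so the restriction would be locally constant with vanishing
second derivative. -/
theorem secondDeriv_nonneg_of_isLocalMin {E : Type*} [NormedAddCommGroup E] [NormedSpace ℝ E]
    {f : E → ℝ} {z : E} (hf : ContDiffAt ℝ 2 f z) (hm : IsLocalMin f z) (v : E) :
    0 ≤ fderiv ℝ (fun ζ => fderiv ℝ f ζ v) z v := by
  by_contra! hneg
  set l : ℝ → E := fun t => z + t • v with hl
  have hld : ∀ t, HasDerivAt l v t := fun t => by
    have := ((hasDerivAt_id t).smul_const v).const_add z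
    rwa [one_smul] at this
  have hl0 : l 0 = z := by simp [hl]
  have hlc : Tendsto l (𝓝 0) (𝓝 z) := by
    have := (hld 0).continuousAt
    rwa [ContinuousAt, hl0] at this
  have h1 : ∀ᶠ ζ in 𝓝 z, DifferentiableAt ℝ f ζ := by
    filter_upwards [hf.eventually (by simp)] with ζ hζ using hζ.differentiableAt (by simp)
  have h2 : DifferentiableAt ℝ (fun ζ => fderiv ℝ f ζ v) z :=
    ((hf.fderiv_right (m := 1) (by norm_num)).differentiableAt (by simp)).clm_apply
      (differentiableAt_const v)
  have hd1 : deriv (f ∘ l) =ᶠ[𝓝 0] fun t => fderiv ℝ f (l t) v := by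
    filter_upwards [hlc.eventually h1] with t ht
    exact (ht.hasFDerivAt.comp_hasDerivAt t (hld t)).deriv
  have hd2 : deriv (deriv (f ∘ l)) 0 = fderiv ℝ (fun ζ => fderiv ℝ f ζ v) z v := by
    rw [hd1.deriv_eq]
    have h2' : HasFDerivAt (fun ζ => fderiv ℝ f ζ v)
      (fderiv ℝ (fun ζ => fderiv ℝ f ζ v) z) (l 0) := by rw [hl0]; exact h2.hasFDerivAt
    exact (h2'.comp_hasDerivAt 0 (hld 0)).deriv
  have hm' : IsLocalMin (f ∘ l) 0 := by
    have := hlc.eventually hm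
    simpa [IsLocalMin, IsMinFilter, hl0] using this
  have hmax : IsLocalMax (f ∘ l) 0 := by
    apply isLocalMax_of_deriv_deriv_neg (by rw [hd2]; exact hneg) hm'.deriv_eq_zero
    exact ContinuousAt.comp (by rw [hl0]; exact hf.continuousAt) (hld 0).continuousAt
  have hconst : (f ∘ l) =ᶠ[𝓝 0] fun _ => (f ∘ l) 0 := by
    filter_upwards [hm', hmax] with t h1 h2 using le_antisymm h2 h1
  have : deriv (deriv (f ∘ l)) 0 = 0 := by
    rw [hconst.deriv.deriv_eq]; simp
  linarith

/-- The barrier function of the Hopf lemma. -/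
def barrier (κ : ℝ) (c z : ℂ) : ℝ := Real.exp (-κ * ((z.re - c.re) ^ 2 + (z.im - c.im) ^ 2))

theorem contDiff_barrier (κ : ℝ) (c : ℂ) {n : WithTop ℕ∞} : ContDiff ℝ n (barrier κ c) := by
  unfold barrier
  have h1 : ContDiff ℝ n (fun z : ℂ => z.re) := Complex.reCLM.contDiff
  have h2 : ContDiff ℝ n (fun z : ℂ => z.im) := Complex.imCLM.contDiff
  fun_prop

theorem fderiv_barrier (κ : ℝ) (c z v : ℂ) : fderiv ℝ (barrier κ c) z v =
    -2 * κ * ((z.re - c.re) * v.re + (z.im - c.im) * v.im) * barrier κ c z := by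
  have h1 : HasFDerivAt (fun z : ℂ => z.re) Complex.reCLM z := Complex.reCLM.hasFDerivAt
  have h2 : HasFDerivAt (fun z : ℂ => z.im) Complex.imCLM z := Complex.imCLM.hasFDerivAt
  have h := (((((h1.sub_const c.re).pow 2).add ((h2.sub_const c.im).pow 2)).const_mul (-κ))).exp
  have h' : HasFDerivAt (barrier κ c) _ z := h
  rw [h'.fderiv]
  simp [barrier]
  ring

/-- Away from the centre the term in κ² dominates for large κ, while the gradient grows only
linearly in κ. This makes the barrier a strict subsolution on an annulus. -/
theorem lap_barrier (κ : ℝ) (c z : ℂ) : lap (barrier κ c) z =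
    (4 * κ ^ 2 * ((z.re - c.re) ^ 2 + (z.im - c.im) ^ 2) - 4 * κ) * barrier κ c z := by
  have h1 : HasFDerivAt (fun z : ℂ => z.re) Complex.reCLM z := Complex.reCLM.hasFDerivAt
  have h2 : HasFDerivAt (fun z : ℂ => z.im) Complex.imCLM z := Complex.imCLM.hasFDerivAt
  have hb : HasFDerivAt (barrier κ c) (fderiv ℝ (barrier κ c) z) z :=
    ((contDiff_barrier κ c (n := 1)).differentiable (by simp) z).hasFDerivAt
  have e1 := (((h1.sub_const c.re).const_mul (-2 * κ)).mul hb).fderiv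
  have e2 := (((h2.sub_const c.im).const_mul (-2 * κ)).mul hb).fderiv
  have f1 : (fun ζ => fderiv ℝ (barrier κ c) ζ 1)
      = (fun z : ℂ => -2 * κ * (z.re - c.re)) * barrier κ c := by
    ext ζ; rw [fderiv_barrier]; simp
  have f2 : (fun ζ => fderiv ℝ (barrier κ c) ζ Complex.I)
      = (fun z : ℂ => -2 * κ * (z.im - c.im)) * barrier κ c := by
    ext ζ; rw [fderiv_barrier]; simp
  rw [lap, f1, f2, e1, e2]
  simp [fderiv_barrier]
  ring

theorem barrier_of_dist {κ : ℝ} {c z : ℂ} : barrier κ c z = Real.exp (-κ * dist z c ^ 2) := by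
  rw [barrier, Complex.dist_eq, Complex.sq_norm, Complex.normSq_apply]
  congr 2
  simp only [Complex.sub_re, Complex.sub_im]
  ring

/-- The Hopf lemma. -/
theorem hopf_lemma {w : ℂ → ℝ} {c b : ℂ} {r C : ℝ} (hr : 0 < r) (hC : 0 ≤ C) (hb : dist b c = r)
    (hw : ContDiffOn ℝ 2 w (Metric.ball c r)) (hcont : ContinuousOn w (Metric.closedBall c r))
    (hpos : ∀ z ∈ Metric.ball c r, 0 < w z) (hnonneg : ∀ z ∈ Metric.closedBall c r, 0 ≤ w z)
    (hΔ : ∀ z ∈ Metric.ball c r,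
      lap w z ≤ C * (|fderiv ℝ w z 1| + |fderiv ℝ w z Complex.I| + w z)) :
    ∃ ε > 0, ∀ t : ℝ, 0 ≤ t → t ≤ 1 / 2 → ε * t ≤ w (b + t • (c - b)) := by
  -- κ is tuned to give `hκr`: on the annulus |z - c| ≥ r/2 the Laplacian factor is at least κ²r² -
  -- 4κ, and this must exceed C times the bounds 2κr for each of the two partial derivatives and 1
  -- for the value, all relative to the barrier.
  set κ : ℝ := (4 + 4 * C * r + C) / r ^ 2 + 1 with hκ
  have hκ1 : 1 ≤ κ := by rw [hκ]; have : 0 ≤ (4 + 4 * C * r + C) / r ^ 2 := by positivity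
                         linarith
  have hκ0 : 0 < κ := by linarith
  have hκr : 4 * κ + 4 * C * κ * r + C < κ ^ 2 * r ^ 2 := by
    have h1 : κ * r ^ 2 = 4 + 4 * C * r + C + r ^ 2 := by rw [hκ]; field_simp
    have h2 : κ ^ 2 * r ^ 2 = κ * (4 + 4 * C * r + C + r ^ 2) := by rw [← h1]; ring
    rw [h2]
    nlinarith [mul_nonneg hC (sub_nonneg.2 hκ1), mul_pos hκ0 (pow_pos hr 2)]
  obtain ⟨m, hm0, hm⟩ : ∃ m > 0, ∀ z ∈ Metric.closedBall c (r / 2), m ≤ w z := by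
    have hsub : Metric.closedBall c (r / 2) ⊆ Metric.ball c r :=
      Metric.closedBall_subset_ball (by linarith)
    obtain ⟨z, hz, hmin⟩ := (isCompact_closedBall c (r / 2)).exists_isMinOn
      ⟨c, Metric.mem_closedBall_self (by positivity)⟩
      (hcont.mono (hsub.trans Metric.ball_subset_closedBall))
    exact ⟨w z, hpos z (hsub hz), fun y hy => hmin hy⟩
  set h : ℂ → ℝ := fun z => barrier κ c z - Real.exp (-κ * r ^ 2) with hh
  have hhd : ContDiff ℝ 2 h := (contDiff_barrier κ c).sub contDiff_const
  have hhf : ∀ z v, fderiv ℝ h z v = fderiv ℝ (barrier κ c) z v := fun z v => by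
    rw [hh, fderiv_sub_const]
  have hhl : ∀ z, lap h z = lap (barrier κ c) z := fun z => by
    simp only [lap, hhf]
  -- Comparison on the closed annulus r/2 ≤ |z - c| ≤ r. A negative minimum of w - m h is not on the
  -- outer circle, where h = 0 ≤ w, nor on the inner one, where w ≥ m ≥ m h. At a point in between,
  -- the gradients of w and m h agree and m Δh ≤ Δw, which contradicts the choice of κ.
  have key : ∀ z ∈ Metric.closedBall c r \ Metric.ball c (r / 2), m * h z ≤ w z := by
    have hcomp : IsCompact (Metric.closedBall c r \ Metric.ball c (r / 2)) :=
      (isCompact_closedBall c r).diff Metric.isOpen_ball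
    obtain ⟨z, ⟨hz1, hz2⟩, hmin⟩ := hcomp.exists_isMinOn
      (f := fun z => w z - m * h z)
      ⟨b, by simp [hb], by simp [hb]; linarith⟩
      ((hcont.mono sdiff_subset).sub (continuousOn_const.mul hhd.continuous.continuousOn))
    suffices H : 0 ≤ w z - m * h z by
      intro y hy
      have := hmin hy
      simp only [mem_ofPred_eq] at this
      linarith
    by_contra! hneg
    rw [Metric.mem_closedBall] at hz1
    rw [Metric.mem_ball, not_lt] at hz2
    have hz1' : dist z c < r := by
      refine lt_of_le_of_ne hz1 fun e => ?_
      have : h z = 0 := by rw [hh]; simp [barrier_of_dist, e]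
      rw [this] at hneg
      have := hnonneg z (by simp [e])
      linarith
    have hbz : 0 < barrier κ c z := Real.exp_pos _
    have hhz : h z ≤ barrier κ c z := by
      have := Real.exp_pos (-κ * r ^ 2)
      simp only [hh]; linarith
    have hz2' : r / 2 < dist z c := by
      refine lt_of_le_of_ne hz2 fun e => ?_
      have h1 := hm z (by simp [← e])
      have h2 : h z ≤ 1 := by
        refine hhz.trans ?_
        rw [barrier_of_dist, Real.exp_le_one_iff]
        have : 0 ≤ κ * dist z c ^ 2 := by positivity
        linarith
      nlinarith
    have hzb : z ∈ Metric.ball c r := hz1'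
    have hwz : ContDiffAt ℝ 2 w z := hw.contDiffAt (Metric.isOpen_ball.mem_nhds hzb)
    have hloc : IsLocalMin (fun z => w z - m * h z) z := by
      refine hmin.isLocalMin ?_
      have : Metric.ball c r ∩ (Metric.closedBall c (r / 2))ᶜ ∈ 𝓝 z :=
        (Metric.isOpen_ball.inter Metric.isClosed_closedBall.isOpen_compl).mem_nhds
          ⟨hzb, by simpa using hz2'⟩
      refine mem_of_superset this fun y hy => ⟨Metric.ball_subset_closedBall hy.1, fun h' =>
        hy.2 (Metric.ball_subset_closedBall h')⟩
    have hgd : ContDiffAt ℝ 2 (fun z => w z - m * h z) z :=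
      hwz.sub (contDiffAt_const.mul hhd.contDiffAt)
    have hwd : ∀ᶠ ζ in 𝓝 z, DifferentiableAt ℝ w ζ := by
      filter_upwards [hwz.eventually (by simp)] with ζ hζ using hζ.differentiableAt (by simp)
    have hhdd : ∀ ζ, DifferentiableAt ℝ h ζ := fun ζ => hhd.contDiffAt.differentiableAt (by simp)
    have hfd : ∀ v, (fun ζ => fderiv ℝ (fun z => w z - m * h z) ζ v) =ᶠ[𝓝 z]
        fun ζ => fderiv ℝ w ζ v - m * fderiv ℝ h ζ v := fun v => by
      filter_upwards [hwd] with ζ hζ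
      rw [fderiv_fun_sub hζ ((hhdd ζ).const_mul m), fderiv_const_mul (hhdd ζ)]
      simp
    have hsd : ∀ v, fderiv ℝ (fun ζ => fderiv ℝ (fun z => w z - m * h z) ζ v) z v =
        fderiv ℝ (fun ζ => fderiv ℝ w ζ v) z v - m * fderiv ℝ (fun ζ => fderiv ℝ h ζ v) z v := by
      intro v
      rw [(hfd v).fderiv_eq]
      have d1 : DifferentiableAt ℝ (fun ζ => fderiv ℝ w ζ v) z :=
        ((hwz.fderiv_right (m := 1) (by norm_num)).differentiableAt (by simp)).clm_apply
          (differentiableAt_const v)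
      have d2 : DifferentiableAt ℝ (fun ζ => fderiv ℝ h ζ v) z :=
        ((hhd.contDiffAt.fderiv_right (m := 1) (by norm_num)).differentiableAt (by simp)).clm_apply
          (differentiableAt_const v)
      rw [fderiv_fun_sub d1 (d2.const_mul m), fderiv_const_mul d2]
      simp
    have hgrad : ∀ v, fderiv ℝ w z v = m * fderiv ℝ h z v := fun v => by
      have := (hfd v).eq_of_nhds
      simp only [hloc.fderiv_eq_zero] at this
      simp at this
      linarith
    have hlap : m * lap h z ≤ lap w z := by
      have a1 := secondDeriv_nonneg_of_isLocalMin hgd hloc 1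
      have a2 := secondDeriv_nonneg_of_isLocalMin hgd hloc Complex.I
      rw [hsd] at a1 a2
      simp only [lap]; linarith
    have hup := hΔ z hzb
    set ρ := dist z c with hρ
    have hρ2 : ρ ^ 2 = (z.re - c.re) ^ 2 + (z.im - c.im) ^ 2 := by
      rw [hρ, Complex.dist_eq, Complex.sq_norm, Complex.normSq_apply]; simp; ring
    have hρ0 : 0 ≤ ρ := dist_nonneg
    have x1 : |z.re - c.re| ≤ ρ := by
      apply abs_le_of_sq_le_sq _ hρ0
      nlinarith [sq_nonneg (z.im - c.im)]
    have x2 : |z.im - c.im| ≤ ρ := by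
      apply abs_le_of_sq_le_sq _ hρ0
      nlinarith [sq_nonneg (z.re - c.re)]
    rw [hhl, lap_barrier, ← hρ2] at hlap
    have g1 : |fderiv ℝ w z 1| ≤ m * (2 * κ * ρ * barrier κ c z) := by
      rw [hgrad, hhf, fderiv_barrier]
      simp only [Complex.one_re, Complex.one_im, mul_one, mul_zero, add_zero]
      rw [abs_mul, abs_of_pos hm0, abs_mul, abs_of_pos hbz, abs_mul]
      rw [show |-2 * κ| = 2 * κ by rw [abs_mul, abs_of_pos hκ0]; norm_num]
      gcongr
    have g2 : |fderiv ℝ w z Complex.I| ≤ m * (2 * κ * ρ * barrier κ c z) := by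
      rw [hgrad, hhf, fderiv_barrier]
      simp only [Complex.I_re, Complex.I_im, mul_one, mul_zero, zero_add]
      rw [abs_mul, abs_of_pos hm0, abs_mul, abs_of_pos hbz, abs_mul]
      rw [show |-2 * κ| = 2 * κ by rw [abs_mul, abs_of_pos hκ0]; norm_num]
      gcongr
    have g3 : w z ≤ m * barrier κ c z := by
      have : m * h z ≤ m * barrier κ c z := by gcongr
      linarith
    have g4 : lap w z ≤ C * (m * (4 * κ * r + 1) * barrier κ c z) := by
      refine hup.trans (mul_le_mul_of_nonneg_left ?_ hC)
      have : m * (2 * κ * ρ * barrier κ c z) ≤ m * (2 * κ * r * barrier κ c z) := by gcongr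
      linarith
    have g5 : (κ ^ 2 * r ^ 2 - 4 * κ) * barrier κ c z ≤
        (4 * κ ^ 2 * ρ ^ 2 - 4 * κ) * barrier κ c z := by
      apply mul_le_mul_of_nonneg_right _ hbz.le
      have : r ^ 2 ≤ 4 * ρ ^ 2 := by nlinarith
      nlinarith [mul_le_mul_of_nonneg_left this (sq_nonneg κ)]
    have g6 : m * ((κ ^ 2 * r ^ 2 - 4 * κ) * barrier κ c z) ≤
        m * ((4 * κ ^ 2 * ρ ^ 2 - 4 * κ) * barrier κ c z) := by gcongr
    have g7 : 0 < (m * barrier κ c z) * (κ ^ 2 * r ^ 2 - 4 * κ - C * (4 * κ * r + 1)) :=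
      mul_pos (mul_pos hm0 hbz) (by linarith)
    linarith
  -- At distance (1 - t)r from c the barrier exceeds its value on the outer circle by
  -- e^{-κr²}(e^{κr²(2t - t²)} - 1), which is at least e^{-κr²}κr²t by 1 + x ≤ eˣ. The restriction t
  -- ≤ 1/2 keeps the point in the annulus.
  refine ⟨m * (Real.exp (-κ * r ^ 2) * (κ * r ^ 2)), by positivity, fun t ht0 ht1 => ?_⟩
  have hd : dist (b + t • (c - b)) c = (1 - t) * r := by
    rw [← hb, dist_eq_norm, dist_eq_norm, show b + t • (c - b) - c = (1 - t) • (b - c) by module,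
      norm_smul, Real.norm_of_nonneg (by linarith)]
  refine le_trans ?_ (key _ ⟨by rw [Metric.mem_closedBall, hd]; nlinarith,
    by rw [Metric.mem_ball, hd]; nlinarith⟩)
  rw [mul_assoc]
  refine mul_le_mul_of_nonneg_left ?_ hm0.le
  rw [hh]
  simp only [barrier_of_dist, hd]
  have e1 : Real.exp (-κ * ((1 - t) * r) ^ 2) =
      Real.exp (-κ * r ^ 2) * Real.exp (κ * r ^ 2 * (2 * t - t ^ 2)) := by
    rw [← Real.exp_add]; ring_nf
  have e2 := Real.add_one_le_exp (κ * r ^ 2 * (2 * t - t ^ 2))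
  have e3 : κ * r ^ 2 * t ≤ κ * r ^ 2 * (2 * t - t ^ 2) := by
    apply mul_le_mul_of_nonneg_left _ (by positivity); nlinarith
  have e4 := Real.exp_pos (-κ * r ^ 2)
  rw [e1]
  nlinarith

/-- The strong minimum principle. -/
theorem strong_minimum_principle {w : ℂ → ℝ} {c : ℂ} {r C : ℝ} (hr : 0 < r) (hC : 0 ≤ C)
    (hw : ContDiffOn ℝ 2 w (Metric.ball c r)) (hnonneg : ∀ z ∈ Metric.ball c r, 0 ≤ w z)
    (hΔ : ∀ z ∈ Metric.ball c r,
      lap w z ≤ C * (|fderiv ℝ w z 1| + |fderiv ℝ w z Complex.I| + w z)) (h0 : w c = 0) :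
    ∀ᶠ z in 𝓝 c, w z = 0 := by
  filter_upwards [Metric.ball_mem_nhds c (half_pos hr)] with z hz
  by_contra hne
  have hzr : dist z c < r / 2 := hz
  have hwc : ContinuousOn w (Metric.ball c r) := hw.continuousOn
  -- If w(z) ≠ 0, let b be the zero of w nearest to z. Then w > 0 on the open disc about z through
  -- b, so the Hopf lemma gives linear growth at b; but b is an interior minimum, where dw = 0. The
  -- radius r/2 keeps these discs inside the given ball.
  set K : Set ℂ := Metric.closedBall z (r / 2) ∩ w ⁻¹' {0} with hK
  have hsub : Metric.closedBall z (r / 2) ⊆ Metric.ball c r := fun y hy => by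
    rw [Metric.mem_closedBall] at hy; rw [Metric.mem_ball]
    linarith [dist_triangle y z c]
  have hKc : IsCompact K := by
    have : IsClosed K :=
      (hwc.mono hsub).preimage_isClosed_of_isClosed Metric.isClosed_closedBall isClosed_singleton
    exact (isCompact_closedBall z (r / 2)).of_isClosed_subset this inter_subset_left
  have hcK : c ∈ K := ⟨by rw [Metric.mem_closedBall, dist_comm]; exact hzr.le, h0⟩
  obtain ⟨b, hbK, hbmin⟩ := hKc.exists_isMinOn ⟨c, hcK⟩
    (f := fun y => dist y z) (by fun_prop)
  have hbz : 0 < dist b z := dist_pos.2 fun e => hne (by rw [← e]; exact hbK.2)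
  have hbc : dist b z ≤ dist c z := hbmin hcK
  have hcz : dist c z < r / 2 := by rwa [dist_comm]
  have hB : Metric.closedBall z (dist b z) ⊆ Metric.ball c r := fun y hy =>
    hsub (Metric.closedBall_subset_closedBall (by linarith) hy)
  have hB' : Metric.ball z (dist b z) ⊆ Metric.ball c r := Metric.ball_subset_closedBall.trans hB
  have hbb : b ∈ Metric.ball c r := hB (by simp)
  obtain ⟨ε, hε, hgrow⟩ := hopf_lemma hbz hC rfl (hw.mono hB') (hwc.mono hB)
    (fun y hy => by
      refine lt_of_le_of_ne (hnonneg y (hB' hy)) fun e => ?_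
      have : dist b z ≤ dist y z := hbmin
        ⟨by rw [Metric.mem_closedBall]; rw [Metric.mem_ball] at hy; linarith, e.symm⟩
      rw [Metric.mem_ball] at hy; linarith)
    (fun y hy => hnonneg y (hB hy)) (fun y hy => hΔ y (hB' hy))
  have hmin : IsLocalMin w b := by
    filter_upwards [Metric.isOpen_ball.mem_nhds hbb] with y hy
    rw [show w b = 0 from hbK.2]; exact hnonneg y hy
  have hdw : HasFDerivAt w (0 : ℂ →L[ℝ] ℝ) b := by
    have := ((hw.contDiffAt (Metric.isOpen_ball.mem_nhds hbb)).differentiableAt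
      (by simp)).hasFDerivAt
    rwa [hmin.fderiv_eq_zero] at this
  have hld : HasDerivAt (fun t : ℝ => b + t • (z - b)) (z - b) 0 := by
    simpa using ((hasDerivAt_id (0 : ℝ)).smul_const (z - b)).const_add b
  have hdl : HasDerivAt (fun t : ℝ => w (b + t • (z - b))) 0 0 := by
    have := HasFDerivAt.comp_hasDerivAt (f := fun t : ℝ => b + t • (z - b)) (l := w) 0
      (by simpa using hdw) hld
    simpa using! this
  have hnot := not_le.2 hε
  apply hnot
  have hslope := hdl.tendsto_slope_zero_right
  refine ge_of_tendsto hslope ?_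
  filter_upwards [Ioo_mem_nhdsGT (show (0 : ℝ) < 1 / 2 by norm_num)] with t ht
  have := hgrow t ht.1.le ht.2.le
  simp only [zero_add, zero_smul, add_zero, smul_eq_mul]
  rw [show w b = 0 from hbK.2, sub_zero]
  rw [inv_mul_eq_div, le_div_iff₀ ht.1]; exact this

end Sectorial
end

noncomputable section
namespace Sectorial

/-! ## Levi forms in coordinates -/

section Levi

variable {E : Type*} [NormedAddCommGroup E] [NormedSpace ℝ E]

/-- The pull-back formula for the exterior derivative of a one-form under a map of the plane. -/
theorem fderiv_pullback_sub {A : E → E →L[ℝ] ℝ} {F : ℂ → E} {z : ℂ}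
    (hA : DifferentiableAt ℝ A (F z)) (hF : ContDiffAt ℝ 2 F z) :
    fderiv ℝ (fun ζ => A (F ζ) (fderiv ℝ F ζ Complex.I)) z 1
      - fderiv ℝ (fun ζ => A (F ζ) (fderiv ℝ F ζ 1)) z Complex.I
    = fderiv ℝ A (F z) (fderiv ℝ F z 1) (fderiv ℝ F z Complex.I)
      - fderiv ℝ A (F z) (fderiv ℝ F z Complex.I) (fderiv ℝ F z 1) := by
  have hF1 : HasFDerivAt F (fderiv ℝ F z) z := (hF.differentiableAt (by simp)).hasFDerivAt
  have hF2 : HasFDerivAt (fderiv ℝ F) (fderiv ℝ (fderiv ℝ F) z) z :=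
    ((hF.fderiv_right (m := 1) (by norm_num)).differentiableAt (by simp)).hasFDerivAt
  have hAF : HasFDerivAt (fun ζ => A (F ζ)) ((fderiv ℝ A (F z)).comp (fderiv ℝ F z)) z :=
    hA.hasFDerivAt.comp z hF1
  have key : ∀ ξ η : ℂ, fderiv ℝ (fun ζ => A (F ζ) (fderiv ℝ F ζ ξ)) z η =
      fderiv ℝ A (F z) (fderiv ℝ F z η) (fderiv ℝ F z ξ)
        + A (F z) (fderiv ℝ (fderiv ℝ F) z η ξ) := fun ξ η => by
    rw [(hAF.clm_apply (hF2.clm_apply (hasFDerivAt_const ξ z))).fderiv]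
    simp [add_comm]
  have hsymm : fderiv ℝ (fderiv ℝ F) z 1 Complex.I = fderiv ℝ (fderiv ℝ F) z Complex.I 1 :=
    (hF.isSymmSndFDerivAt (by simp)) 1 Complex.I
  rw [key, key, hsymm]
  ring

/-- The first-order part of the Levi form of the almost complex structure `J` on `S`. -/
def leviVec (J : E → E →L[ℝ] E) (S : Set E) (y v : E) : E :=
  fderivWithin ℝ J S y (J y v) v - fderivWithin ℝ J S y v (J y v)

/-- The Laplace equation satisfied by `J`-holomorphic maps. -/
theorem laplace_of_holomorphic {J : E → E →L[ℝ] E} {S : Set E} {F : ℂ → E} {z : ℂ}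
    (hJ : DifferentiableWithinAt ℝ J S (F z)) (hF : ContDiffAt ℝ 2 F z)
    (hS : ∀ᶠ ζ in 𝓝 z, F ζ ∈ S)
    (h1 : ∀ᶠ ζ in 𝓝 z, fderiv ℝ F ζ Complex.I = J (F ζ) (fderiv ℝ F ζ 1))
    (h2 : ∀ᶠ ζ in 𝓝 z, fderiv ℝ F ζ 1 = - J (F ζ) (fderiv ℝ F ζ Complex.I)) :
    fderiv ℝ (fun ζ => fderiv ℝ F ζ 1) z 1
      + fderiv ℝ (fun ζ => fderiv ℝ F ζ Complex.I) z Complex.I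
    = leviVec J S (F z) (fderiv ℝ F z 1) := by
  have hF1 : HasFDerivAt F (fderiv ℝ F z) z := (hF.differentiableAt (by simp)).hasFDerivAt
  have hF2 : HasFDerivAt (fderiv ℝ F) (fderiv ℝ (fderiv ℝ F) z) z :=
    ((hF.fderiv_right (m := 1) (by norm_num)).differentiableAt (by simp)).hasFDerivAt
  -- J is differentiable only within `S`. The composite is differentiable in the full sense because
  -- F maps a neighbourhood of z into `S`, even when F z lies on the boundary of `S`.
  have hJF : HasFDerivAt (fun ζ => J (F ζ)) ((fderivWithin ℝ J S (F z)).comp (fderiv ℝ F z)) z := by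
    have : HasFDerivWithinAt (fun ζ => J (F ζ)) _ (F ⁻¹' S) z :=
      hJ.hasFDerivWithinAt.comp z hF1.hasFDerivWithinAt (mapsTo_preimage F S)
    exact this.hasFDerivAt hS
  have key : ∀ ξ η : ℂ, fderiv ℝ (fun ζ => J (F ζ) (fderiv ℝ F ζ ξ)) z η =
      fderivWithin ℝ J S (F z) (fderiv ℝ F z η) (fderiv ℝ F z ξ)
        + J (F z) (fderiv ℝ (fderiv ℝ F) z η ξ) := fun ξ η => by
    rw [(hJF.clm_apply (hF2.clm_apply (hasFDerivAt_const ξ z))).fderiv]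
    simp [add_comm]
  have hsymm : fderiv ℝ (fderiv ℝ F) z 1 Complex.I = fderiv ℝ (fderiv ℝ F) z Complex.I 1 :=
    (hF.isSymmSndFDerivAt (by simp)) 1 Complex.I
  -- F_x = -J F_y is differentiated in x and F_y = J F_x in y. In the sum the terms with mixed
  -- second derivatives cancel by symmetry, leaving only derivatives of J.
  have e1 : fderiv ℝ (fun ζ => fderiv ℝ F ζ 1) z 1 =
      -(fderivWithin ℝ J S (F z) (fderiv ℝ F z 1) (fderiv ℝ F z Complex.I)
        + J (F z) (fderiv ℝ (fderiv ℝ F) z 1 Complex.I)) := by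
    rw [← key, Filter.EventuallyEq.fderiv_eq h2, fderiv_fun_neg]; rfl
  have e2 : fderiv ℝ (fun ζ => fderiv ℝ F ζ Complex.I) z Complex.I =
      fderivWithin ℝ J S (F z) (fderiv ℝ F z Complex.I) (fderiv ℝ F z 1)
        + J (F z) (fderiv ℝ (fderiv ℝ F) z Complex.I 1) := by
    rw [← key, Filter.EventuallyEq.fderiv_eq h1]
  rw [e1, e2, hsymm, leviVec, ← h1.self_of_nhds]
  abel

/-- The Levi form of `f` with respect to `J` in coordinates. -/
def leviForm (J : E → E →L[ℝ] E) (S : Set E) (f : E → ℝ) (y v : E) : ℝ :=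
  fderiv ℝ (fderiv ℝ f) y v v + fderiv ℝ (fderiv ℝ f) y (J y v) (J y v)
    + fderiv ℝ f y (leviVec J S y v)

/-- The product rule for Df ∘ J, with J² = -1 in the term where f is differentiated twice. The left
side is -d(df ∘ J)(v, Jv) in coordinates. -/
theorem leviForm_eq {J : E → E →L[ℝ] E} {S : Set E} {f : E → ℝ} {y : E} (hS : S ∈ 𝓝 y)
    (hJ : DifferentiableAt ℝ J y) (hf : ContDiffAt ℝ 2 f y) (hJJ : ∀ v, J y (J y v) = -v) (v : E) :
    -(fderiv ℝ (fun η => (fderiv ℝ f η).comp (J η)) y v (J y v)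
      - fderiv ℝ (fun η => (fderiv ℝ f η).comp (J η)) y (J y v) v) = leviForm J S f y v := by
  have hf2 : HasFDerivAt (fderiv ℝ f) (fderiv ℝ (fderiv ℝ f) y) y :=
    ((hf.fderiv_right (m := 1) (by norm_num)).differentiableAt (by simp)).hasFDerivAt
  rw [(hf2.clm_comp hJ.hasFDerivAt).fderiv, leviForm, leviVec, fderivWithin_of_mem_nhds hS]
  simp [hJJ]
  ring

end Levi

/-! ## Charts -/

section Charts

variable {d : ℕ} {M : Type*} [TopologicalSpace M] [ChartedSpace (EuclideanQuadrant d) M]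

theorem range_QI : range (QI d) = {y : EuclideanSpace ℝ (Fin d) | ∀ i, 0 ≤ y i} :=
  range_euclideanQuadrant d

theorem interior_range_QI :
    interior (range (QI d)) = {y : EuclideanSpace ℝ (Fin d) | ∀ i, 0 < y i} := by
  rw [range_QI, interior_euclideanQuadrant]

variable [IsManifold (QI d) ∞ M]

instance isManifold_one : IsManifold (QI d) 1 M :=
  IsManifold.of_le (n := ∞) (by simp)

theorem mem_interior_iff_extChartAt {x₀ x : M} (hx : x ∈ (extChartAt (QI d) x₀).source) :
    x ∈ (QI d).interior M ↔ extChartAt (QI d) x₀ x ∈ interior (range (QI d)) := by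
  rw [extChartAt_source] at hx
  change (QI d).IsInteriorPoint x ↔ _
  rw [(QI d).isInteriorPoint_iff_of_mem_atlas (n := 1) (by simp) (chart_mem_atlas _ x₀) hx]
  exact ⟨fun h => interior_mono (extChartAt_target_subset_range x₀) h,
    fun h => OpenPartialHomeomorph.mem_interior_extend_target _ ((chartAt _ x₀).map_source hx) h⟩

end Charts
end Sectorial
end

noncomputable section
namespace Sectorial

/-! ### Pull-backs and Levi forms on the manifold, computed in charts. -/

section Charts

variable {d : ℕ} {M : Type*} [TopologicalSpace M] [ChartedSpace (EuclideanQuadrant d) M]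
  [IsManifold (QI d) ∞ M]

theorem mfderivWithin_symm_extChartAt {x₀ x : M} (hx : x ∈ (extChartAt (QI d) x₀).source)
    (v : TangentSpace (QI d) x) :
    mfderivWithin 𝓘(ℝ, EuclideanSpace ℝ (Fin d)) (QI d) (extChartAt (QI d) x₀).symm
      (range (QI d)) (extChartAt (QI d) x₀ x)
      (mfderiv (QI d) 𝓘(ℝ, EuclideanSpace ℝ (Fin d)) (extChartAt (QI d) x₀) x v) = v :=
  DFunLike.congr_fun (mfderivWithin_extChartAt_symm_comp_mfderiv_extChartAt' (I := QI d) hx) v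

theorem mfderiv_extChartAt_symm {x₀ : M} {y : EuclideanSpace ℝ (Fin d)}
    (hy : y ∈ (extChartAt (QI d) x₀).target) (v : EuclideanSpace ℝ (Fin d)) :
    mfderiv (QI d) 𝓘(ℝ, EuclideanSpace ℝ (Fin d)) (extChartAt (QI d) x₀)
      ((extChartAt (QI d) x₀).symm y)
      (mfderivWithin 𝓘(ℝ, EuclideanSpace ℝ (Fin d)) (QI d) (extChartAt (QI d) x₀).symm
      (range (QI d)) y v) = v :=
  DFunLike.congr_fun (mfderiv_extChartAt_comp_mfderivWithin_extChartAt_symm (I := QI d) hy) v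

theorem two_le_infty : (2 : WithTop ℕ∞) ≤ ∞ := by
  exact ENat.LEInfty.out

theorem OneForm.inChart_mfderiv (a : OneForm d M) {x₀ x : M}
    (hx : x ∈ (extChartAt (QI d) x₀).source) (v : TangentSpace (QI d) x) :
    a.inChart x₀ (extChartAt (QI d) x₀ x)
      (mfderiv (QI d) 𝓘(ℝ, EuclideanSpace ℝ (Fin d)) (extChartAt (QI d) x₀) x v) = a x v := by
  -- The form sits at the image of x under the chart and its inverse, which equals x only
  -- propositionally. Generalizing the point and the vector allows both to be substituted together.
  have key : ∀ x', x' = x → ∀ w : EuclideanSpace ℝ (Fin d), w = v → a x' w = a x v := by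
    rintro _ rfl _ rfl; rfl
  exact key _ ((extChartAt (QI d) x₀).left_inv hx) _ (mfderivWithin_symm_extChartAt hx v)

theorem EndField.inChart_mfderiv (J : EndField d M) {x₀ x : M}
    (hx : x ∈ (extChartAt (QI d) x₀).source) (v : TangentSpace (QI d) x) :
    J.inChart x₀ (extChartAt (QI d) x₀ x)
      (mfderiv (QI d) 𝓘(ℝ, EuclideanSpace ℝ (Fin d)) (extChartAt (QI d) x₀) x v) =
    mfderiv (QI d) 𝓘(ℝ, EuclideanSpace ℝ (Fin d)) (extChartAt (QI d) x₀) x (J x v) := by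
  have key : ∀ x', x' = x → ∀ w : EuclideanSpace ℝ (Fin d), w = v →
      mfderiv (QI d) 𝓘(ℝ, EuclideanSpace ℝ (Fin d)) (extChartAt (QI d) x₀) x' (J x' w) =
      mfderiv (QI d) 𝓘(ℝ, EuclideanSpace ℝ (Fin d)) (extChartAt (QI d) x₀) x (J x v) := by
    rintro _ rfl _ rfl; rfl
  exact key _ ((extChartAt (QI d) x₀).left_inv hx) _ (mfderivWithin_symm_extChartAt hx v)

theorem EndField.mfderivWithin_inChart (J : EndField d M) {x₀ : M}
    {y : EuclideanSpace ℝ (Fin d)} (hy : y ∈ (extChartAt (QI d) x₀).target)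
    (v : EuclideanSpace ℝ (Fin d)) :
    mfderivWithin 𝓘(ℝ, EuclideanSpace ℝ (Fin d)) (QI d) (extChartAt (QI d) x₀).symm
      (range (QI d)) y (J.inChart x₀ y v) =
    J ((extChartAt (QI d) x₀).symm y)
      (mfderivWithin 𝓘(ℝ, EuclideanSpace ℝ (Fin d)) (QI d) (extChartAt (QI d) x₀).symm
      (range (QI d)) y v) := by
  have h := mfderivWithin_symm_extChartAt ((extChartAt (QI d) x₀).map_target hy)
    (J ((extChartAt (QI d) x₀).symm y)
      (mfderivWithin 𝓘(ℝ, EuclideanSpace ℝ (Fin d)) (QI d) (extChartAt (QI d) x₀).symm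
      (range (QI d)) y v))
  rwa [(extChartAt (QI d) x₀).right_inv hy] at h

theorem EndField.inChart_square {J : EndField d M}
    (hJ : ∀ (x : M) (v : TangentSpace (QI d) x), J x (J x v) = -v)
    {x₀ : M} {y : EuclideanSpace ℝ (Fin d)} (hy : y ∈ (extChartAt (QI d) x₀).target)
    (v : EuclideanSpace ℝ (Fin d)) : J.inChart x₀ y (J.inChart x₀ y v) = -v := by
  change mfderiv (QI d) 𝓘(ℝ, EuclideanSpace ℝ (Fin d)) (extChartAt (QI d) x₀)
      ((extChartAt (QI d) x₀).symm y) (J ((extChartAt (QI d) x₀).symm y) (mfderivWithin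
        𝓘(ℝ, EuclideanSpace ℝ (Fin d)) (QI d) (extChartAt (QI d) x₀).symm (range (QI d)) y
        (J.inChart x₀ y v))) = -v
  rw [J.mfderivWithin_inChart hy, hJ, map_neg, mfderiv_extChartAt_symm hy]
  rfl

/-- The differential of a map of the plane in a chart. -/
theorem fderiv_extChartAt_comp {G : ℂ → M} {z : ℂ} {x₀ : M}
    (hG : MDifferentiableAt 𝓘(ℝ, ℂ) (QI d) G z) (hx : G z ∈ (extChartAt (QI d) x₀).source) (ξ : ℂ) :
    fderiv ℝ (fun ζ => extChartAt (QI d) x₀ (G ζ)) z ξ =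
      mfderiv (QI d) 𝓘(ℝ, EuclideanSpace ℝ (Fin d)) (extChartAt (QI d) x₀) (G z)
        (mfderiv 𝓘(ℝ, ℂ) (QI d) G z ξ) := by
  have h1 : MDifferentiableAt (QI d) 𝓘(ℝ, EuclideanSpace ℝ (Fin d)) (extChartAt (QI d) x₀) (G z) :=
    mdifferentiableAt_extChartAt (by rwa [extChartAt_source] at hx)
  rw [← mfderiv_eq_fderiv]
  exact DFunLike.congr_fun (mfderiv_comp z h1 hG) ξ

theorem contDiffAt_extChartAt_comp {n : WithTop ℕ∞} (hn : n ≤ ∞) {G : ℂ → M} {z : ℂ} {x₀ : M}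
    (hG : ContMDiffAt 𝓘(ℝ, ℂ) (QI d) n G z) (hx : G z ∈ (extChartAt (QI d) x₀).source) :
    ContDiffAt ℝ n (fun ζ => extChartAt (QI d) x₀ (G ζ)) z := by
  rw [← contMDiffAt_iff_contDiffAt]
  have h1 : ContMDiffAt (QI d) 𝓘(ℝ, EuclideanSpace ℝ (Fin d)) n (extChartAt (QI d) x₀) (G z) :=
    (contMDiffAt_extChartAt' (n := ∞) (by rwa [extChartAt_source] at hx)).of_le hn
  exact h1.comp z hG

theorem OneForm.inChart_apply_fderiv (a : OneForm d M) {G : ℂ → M} {z : ℂ} {x₀ : M}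
    (hG : MDifferentiableAt 𝓘(ℝ, ℂ) (QI d) G z) (hx : G z ∈ (extChartAt (QI d) x₀).source) (ξ : ℂ) :
    a.inChart x₀ (extChartAt (QI d) x₀ (G z))
      (fderiv ℝ (fun ζ => extChartAt (QI d) x₀ (G ζ)) z ξ) =
    a (G z) (mfderiv 𝓘(ℝ, ℂ) (QI d) G z ξ) := by
  rw [fderiv_extChartAt_comp hG hx]
  exact a.inChart_mfderiv hx _

theorem EndField.inChart_apply_fderiv (J : EndField d M) {G : ℂ → M} {z : ℂ} {x₀ : M}
    (hG : MDifferentiableAt 𝓘(ℝ, ℂ) (QI d) G z) (hx : G z ∈ (extChartAt (QI d) x₀).source) (ξ : ℂ) :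
    J.inChart x₀ (extChartAt (QI d) x₀ (G z))
      (fderiv ℝ (fun ζ => extChartAt (QI d) x₀ (G ζ)) z ξ) =
    mfderiv (QI d) 𝓘(ℝ, EuclideanSpace ℝ (Fin d)) (extChartAt (QI d) x₀) (G z)
      (J (G z) (mfderiv 𝓘(ℝ, ℂ) (QI d) G z ξ)) := by
  rw [fderiv_extChartAt_comp hG hx]
  exact J.inChart_mfderiv hx _

/-- The pull-back formula in an arbitrary chart, at interior points. -/
theorem fderiv_pullback_sub_chart (a : OneForm d M) {G : ℂ → M} {z : ℂ} {x₀ : M}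
    (hG : ContMDiffAt 𝓘(ℝ, ℂ) (QI d) 2 G z) (hx : G z ∈ (extChartAt (QI d) x₀).source)
    (ha : DifferentiableAt ℝ (a.inChart x₀) (extChartAt (QI d) x₀ (G z))) :
    fderiv ℝ (fun ζ => a (G ζ) (mfderiv 𝓘(ℝ, ℂ) (QI d) G ζ Complex.I)) z 1
      - fderiv ℝ (fun ζ => a (G ζ) (mfderiv 𝓘(ℝ, ℂ) (QI d) G ζ (1 : ℂ))) z Complex.I =
    fderiv ℝ (a.inChart x₀) (extChartAt (QI d) x₀ (G z))
        (fderiv ℝ (fun ζ => extChartAt (QI d) x₀ (G ζ)) z 1)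
        (fderiv ℝ (fun ζ => extChartAt (QI d) x₀ (G ζ)) z Complex.I)
      - fderiv ℝ (a.inChart x₀) (extChartAt (QI d) x₀ (G z))
        (fderiv ℝ (fun ζ => extChartAt (QI d) x₀ (G ζ)) z Complex.I)
        (fderiv ℝ (fun ζ => extChartAt (QI d) x₀ (G ζ)) z 1) := by
  have hev : ∀ ξ : ℂ, (fun ζ => a (G ζ) (mfderiv 𝓘(ℝ, ℂ) (QI d) G ζ ξ)) =ᶠ[𝓝 z]
      fun ζ => a.inChart x₀ (extChartAt (QI d) x₀ (G ζ))
        (fderiv ℝ (fun ζ => extChartAt (QI d) x₀ (G ζ)) ζ ξ) := fun ξ => by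
    filter_upwards [(contMDiffAt_iff_contMDiffAt_nhds (by simp)).1 hG,
      hG.continuousAt.preimage_mem_nhds ((isOpen_extChartAt_source x₀).mem_nhds hx)] with ζ h1 h2
    exact (a.inChart_apply_fderiv (h1.mdifferentiableAt (by simp)) h2 ξ).symm
  rw [(hev 1).fderiv_eq, (hev Complex.I).fderiv_eq]
  exact fderiv_pullback_sub ha (contDiffAt_extChartAt_comp two_le_infty hG hx)

/-- `extD` is defined in the chart centred at the point, whose differential there is the identity.
Since `fderiv_pullback_sub_chart` holds in every chart, comparing the two moves `extD` to any other
chart. -/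
theorem extD_eq_fderiv_pullback_sub (a : OneForm d M) {G : ℂ → M} {z : ℂ}
    (hG : ContMDiffAt 𝓘(ℝ, ℂ) (QI d) 2 G z) (hx : G z ∈ (QI d).interior M)
    (ha : DifferentiableAt ℝ (a.inChart (G z)) (extChartAt (QI d) (G z) (G z))) :
    extD a (G z) (mfderiv 𝓘(ℝ, ℂ) (QI d) G z (1 : ℂ)) (mfderiv 𝓘(ℝ, ℂ) (QI d) G z Complex.I) =
    fderiv ℝ (fun ζ => a (G ζ) (mfderiv 𝓘(ℝ, ℂ) (QI d) G ζ Complex.I)) z 1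
      - fderiv ℝ (fun ζ => a (G ζ) (mfderiv 𝓘(ℝ, ℂ) (QI d) G ζ (1 : ℂ))) z Complex.I := by
  have hs := mem_extChartAt_source (I := QI d) (G z)
  rw [fderiv_pullback_sub_chart a hG hs ha]
  have hn : range (QI d) ∈ 𝓝 (extChartAt (QI d) (G z) (G z)) := mem_interior_iff_mem_nhds.1 hx
  have hd := hG.mdifferentiableAt (by simp)
  have hid : ∀ ξ : ℂ, fderiv ℝ (fun ζ => extChartAt (QI d) (G z) (G ζ)) z ξ =
      mfderiv 𝓘(ℝ, ℂ) (QI d) G z ξ := fun ξ => by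
    rw [fderiv_extChartAt_comp hd hs, mfderiv_extChartAt_self]; rfl
  rw [hid, hid, extD, fderivWithin_of_mem_nhds hn]

/-- The form `ds ∘ J`. -/
abbrev dc (J : EndField d M) (s : M → ℝ) : OneForm d M :=
  fun y => ((dfun s : OneForm d M) y).comp (J y)

theorem contDiffAt_comp_extChartAt_symm {n : WithTop ℕ∞} (hn : n ≤ ∞) {s : M → ℝ} {x₀ : M}
    {y : EuclideanSpace ℝ (Fin d)}
    (hy : y ∈ (extChartAt (QI d) x₀).target) (hi : y ∈ interior (range (QI d)))
    (hs : ContMDiffAt (QI d) 𝓘(ℝ, ℝ) n s ((extChartAt (QI d) x₀).symm y)) :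
    ContDiffAt ℝ n (fun η => s ((extChartAt (QI d) x₀).symm η)) y := by
  rw [← contMDiffAt_iff_contDiffAt]
  have h1 : ContMDiffAt 𝓘(ℝ, EuclideanSpace ℝ (Fin d)) (QI d) n (extChartAt (QI d) x₀).symm y :=
    ((contMDiffWithinAt_extChartAt_symm_range (n := ∞) x₀ hy).contMDiffAt
      (mem_interior_iff_mem_nhds.1 hi)).of_le hn
  exact hs.comp y h1

theorem fderiv_comp_extChartAt_symm {s : M → ℝ} {x₀ : M} {y : EuclideanSpace ℝ (Fin d)}
    (hy : y ∈ (extChartAt (QI d) x₀).target) (hi : y ∈ interior (range (QI d)))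
    (hs : MDifferentiableAt (QI d) 𝓘(ℝ, ℝ) s ((extChartAt (QI d) x₀).symm y))
    (v : EuclideanSpace ℝ (Fin d)) :
    fderiv ℝ (fun η => s ((extChartAt (QI d) x₀).symm η)) y v =
      (dfun s : OneForm d M) ((extChartAt (QI d) x₀).symm y)
        (mfderivWithin 𝓘(ℝ, EuclideanSpace ℝ (Fin d)) (QI d) (extChartAt (QI d) x₀).symm
          (range (QI d)) y v) := by
  have hn := mem_interior_iff_mem_nhds.1 hi
  have h1 := (mdifferentiableWithinAt_extChartAt_symm (I := QI d) hy).mdifferentiableAt hn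
  rw [mfderivWithin_of_mem_nhds hn, ← mfderiv_eq_fderiv]
  exact DFunLike.congr_fun (mfderiv_comp y hs h1) v

theorem dc_inChart_eventuallyEq {J : EndField d M} {s : M → ℝ} {x₀ : M}
    {y : EuclideanSpace ℝ (Fin d)}
    (hy : y ∈ (extChartAt (QI d) x₀).target) (hi : y ∈ interior (range (QI d)))
    (hs : ContMDiffOn (QI d) 𝓘(ℝ, ℝ) ∞ s ((QI d).interior M)) :
    (dc J s).inChart x₀ =ᶠ[𝓝 y] fun η =>
      (fderiv ℝ (fun η => s ((extChartAt (QI d) x₀).symm η)) η).comp (J.inChart x₀ η) := by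
  have hopen : IsOpen ((QI d).interior M) := (QI d).isOpen_interior (n := 1) (by simp)
  have htn : (extChartAt (QI d) x₀).target ∈ 𝓝 y := by
    have := extChartAt_target_mem_nhdsWithin_of_mem hy
    rwa [nhdsWithin_eq_nhds.2 (mem_interior_iff_mem_nhds.1 hi)] at this
  filter_upwards [htn, isOpen_interior.mem_nhds hi] with η h1 h2
  have hm : (extChartAt (QI d) x₀).symm η ∈ (QI d).interior M := by
    rw [mem_interior_iff_extChartAt ((extChartAt (QI d) x₀).map_target h1),
      (extChartAt (QI d) x₀).right_inv h1]
    exact h2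
  have hsd := (hs.contMDiffAt (hopen.mem_nhds hm)).mdifferentiableAt (by simp)
  ext v
  rw [ContinuousLinearMap.comp_apply, fderiv_comp_extChartAt_symm h1 h2 hsd]
  rw [J.mfderivWithin_inChart h1]
  rfl

theorem dc_inChart_differentiableAt {J : EndField d M} (hJ : J.IsSmooth) {s : M → ℝ} {x₀ : M}
    {y : EuclideanSpace ℝ (Fin d)}
    (hy : y ∈ (extChartAt (QI d) x₀).target) (hi : y ∈ interior (range (QI d)))
    (hs : ContMDiffOn (QI d) 𝓘(ℝ, ℝ) ∞ s ((QI d).interior M)) :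
    ContDiffAt ℝ 2 (fun η => s ((extChartAt (QI d) x₀).symm η)) y ∧
    DifferentiableAt ℝ (J.inChart x₀) y ∧
    DifferentiableAt ℝ ((dc J s).inChart x₀) y := by
  have hopen : IsOpen ((QI d).interior M) := (QI d).isOpen_interior (n := 1) (by simp)
  have htn : (extChartAt (QI d) x₀).target ∈ 𝓝 y := by
    have := extChartAt_target_mem_nhdsWithin_of_mem hy
    rwa [nhdsWithin_eq_nhds.2 (mem_interior_iff_mem_nhds.1 hi)] at this
  have hm : (extChartAt (QI d) x₀).symm y ∈ (QI d).interior M := by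
    rw [mem_interior_iff_extChartAt ((extChartAt (QI d) x₀).map_target hy),
      (extChartAt (QI d) x₀).right_inv hy]
    exact hi
  have h1 : ContDiffAt ℝ 2 (fun η => s ((extChartAt (QI d) x₀).symm η)) y :=
    contDiffAt_comp_extChartAt_symm two_le_infty hy hi
      ((hs.contMDiffAt (hopen.mem_nhds hm)).of_le two_le_infty)
  have h2 : DifferentiableAt ℝ (J.inChart x₀) y :=
    ((hJ x₀).contDiffAt htn).differentiableAt (by simp)
  refine ⟨h1, h2, (dc_inChart_eventuallyEq hy hi hs).differentiableAt_iff.2 ?_⟩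
  exact ((h1.fderiv_right (m := 1) (by norm_num)).differentiableAt (by simp)).clm_comp h2

/-- The Levi form of `s` in coordinates. -/
theorem extD_dc_eq_leviForm {X : LiouvilleForm d M} {J : EndField d M} (hJ : IsTameACS X J)
    {s : M → ℝ} {x₀ : M} {y : EuclideanSpace ℝ (Fin d)}
    (hy : y ∈ (extChartAt (QI d) x₀).target) (hi : y ∈ interior (range (QI d)))
    (hs : ContMDiffOn (QI d) 𝓘(ℝ, ℝ) ∞ s ((QI d).interior M)) (v : EuclideanSpace ℝ (Fin d)) :
    ∃ V : TangentSpace (QI d) ((extChartAt (QI d) x₀).symm y),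
    -extD (dc J s) ((extChartAt (QI d) x₀).symm y) V (J _ V) =
      leviForm (J.inChart x₀) (range (QI d)) (fun η => s ((extChartAt (QI d) x₀).symm η)) y v := by
  have hn : range (QI d) ∈ 𝓝 y := mem_interior_iff_mem_nhds.1 hi
  obtain ⟨h1, h2, h3⟩ := dc_inChart_differentiableAt hJ.smooth (s := s) hy hi hs
  set w := J.inChart x₀ y v with hw
  -- A test surface: the affine plane through y spanned by v and Jv. Its pull-back of ds ∘ J is
  -- computed once in the chart at x₀, giving the Levi form, and once in the chart at the point
  -- itself, giving `extD`.
  set l : ℂ → EuclideanSpace ℝ (Fin d) := fun ζ => y + (ζ.re • v + ζ.im • w) with hl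
  have hld : ∀ ζ, HasFDerivAt l (Complex.reCLM.smulRight v + Complex.imCLM.smulRight w) ζ :=
    fun ζ => by
      have := (Complex.reCLM.smulRight v + Complex.imCLM.smulRight w).hasFDerivAt (x := ζ)
      exact this.const_add y
  have hlc : ContDiff ℝ 2 l :=
    contDiff_const.add (Complex.reCLM.smulRight v + Complex.imCLM.smulRight w).contDiff
  have hl0 : l 0 = y := by simp [hl]
  have hsy : ContMDiffAt 𝓘(ℝ, EuclideanSpace ℝ (Fin d)) (QI d) 2 (extChartAt (QI d) x₀).symm y :=
    ((contMDiffWithinAt_extChartAt_symm_range (n := ∞) x₀ hy).contMDiffAt hn).of_le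
      two_le_infty
  set G : ℂ → M := fun ζ => (extChartAt (QI d) x₀).symm (l ζ) with hG
  have hG0 : G 0 = (extChartAt (QI d) x₀).symm y := by rw [hG]; simp only [hl0]
  have hGc : ContMDiffAt 𝓘(ℝ, ℂ) (QI d) 2 G 0 :=
    ContMDiffAt.comp (g := (extChartAt (QI d) x₀).symm) (f := l) 0 (by rwa [hl0])
      hlc.contMDiff.contMDiffAt
  have hGs : G 0 ∈ (extChartAt (QI d) x₀).source := by
    rw [hG0]; exact (extChartAt (QI d) x₀).map_target hy
  have hψG0 : extChartAt (QI d) x₀ (G 0) = y := by rw [hG0, (extChartAt (QI d) x₀).right_inv hy]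
  have hGi : G 0 ∈ (QI d).interior M := by
    rw [mem_interior_iff_extChartAt hGs, hψG0]; exact hi
  have hψG : (fun ζ => extChartAt (QI d) x₀ (G ζ)) =ᶠ[𝓝 0] l := by
    have htn : (extChartAt (QI d) x₀).target ∈ 𝓝 (l 0) := by
      have := extChartAt_target_mem_nhdsWithin_of_mem hy
      rwa [nhdsWithin_eq_nhds.2 hn, ← hl0] at this
    filter_upwards [hlc.continuous.continuousAt.preimage_mem_nhds htn] with ζ hζ
    exact (extChartAt (QI d) x₀).right_inv hζ
  have hfd : ∀ ξ : ℂ, fderiv ℝ (fun ζ => extChartAt (QI d) x₀ (G ζ)) 0 ξ = ξ.re • v + ξ.im • w := by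
    intro ξ; rw [hψG.fderiv_eq, (hld 0).fderiv]; simp
  have e1 := fderiv_pullback_sub_chart (dc J s) hGc hGs (by rwa [hψG0])
  have h3' : DifferentiableAt ℝ ((dc J s).inChart (G 0)) (extChartAt (QI d) (G 0) (G 0)) :=
    (dc_inChart_differentiableAt hJ.smooth (mem_extChartAt_target _)
      ((mem_interior_iff_extChartAt (mem_extChartAt_source _)).1 hGi) hs).2.2
  have e2 := extD_eq_fderiv_pullback_sub (dc J s) hGc hGi h3'
  rw [e1, hfd, hfd, hψG0] at e2
  simp only [Complex.one_re, Complex.one_im, Complex.I_re, Complex.I_im, one_smul, zero_smul,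
    add_zero, zero_add] at e2
  rw [← leviForm_eq hn h2 h1 (EndField.inChart_square hJ.square hy),
    ← (dc_inChart_eventuallyEq hy hi hs).fderiv_eq, ← hw]
  rw [← hG0]
  refine ⟨mfderiv 𝓘(ℝ, ℂ) (QI d) G 0 (1 : ℂ), ?_⟩
  rw [← e2]
  congr 2
  have e3 := J.inChart_apply_fderiv (hGc.mdifferentiableAt (by simp)) hGs 1
  rw [hfd, hψG0] at e3
  simp only [Complex.one_re, Complex.one_im, one_smul, zero_smul, add_zero] at e3
  have e4 := fderiv_extChartAt_comp (hGc.mdifferentiableAt (by simp)) hGs Complex.I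
  rw [hfd] at e4
  simp only [Complex.I_re, Complex.I_im, one_smul, zero_smul, zero_add] at e4
  exact (mfderivWithin_symm_extChartAt hGs (J (G 0) _)).symm.trans
    ((congrArg _ (e3.symm.trans (hw.symm.trans e4))).trans (mfderivWithin_symm_extChartAt hGs _))

/-- `Δ(s ∘ u)` for `J`-holomorphic `u`. -/
theorem lap_comp_holomorphic {X : LiouvilleForm d M} {J : EndField d M} (hJ : IsTameACS X J)
    {s : M → ℝ} (hs : ContMDiffOn (QI d) 𝓘(ℝ, ℝ) ∞ s ((QI d).interior M)) {u : ℂ → M} {z : ℂ}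
    (hu : ContMDiffAt 𝓘(ℝ, ℂ) (QI d) 2 u z) (hz : u z ∈ (QI d).interior M)
    (hol : ∀ᶠ ζ in 𝓝 z, ∀ ξ : ℂ, mfderiv 𝓘(ℝ, ℂ) (QI d) u ζ (Complex.I * ξ : ℂ) =
      J (u ζ) (mfderiv 𝓘(ℝ, ℂ) (QI d) u ζ ξ)) :
    lap (fun ζ => s (u ζ)) z =
      -extD (dc J s) (u z) (mfderiv 𝓘(ℝ, ℂ) (QI d) u z (1 : ℂ)) (J _ (mfderiv 𝓘(ℝ, ℂ) (QI d) u z (1 : ℂ))) := by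
  have hopen : IsOpen ((QI d).interior M) := (QI d).isOpen_interior (n := 1) (by simp)
  have h3 : DifferentiableAt ℝ ((dc J s).inChart (u z)) (extChartAt (QI d) (u z) (u z)) :=
    (dc_inChart_differentiableAt hJ.smooth (mem_extChartAt_target _)
      ((mem_interior_iff_extChartAt (mem_extChartAt_source _)).1 hz) hs).2.2
  have e := extD_eq_fderiv_pullback_sub (dc J s) hu hz h3
  have hd : ∀ᶠ ζ in 𝓝 z, ∀ ξ : ℂ, fderiv ℝ (fun ζ => s (u ζ)) ζ ξ =
      (dfun s : OneForm d M) (u ζ) (mfderiv 𝓘(ℝ, ℂ) (QI d) u ζ ξ) := by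
    filter_upwards [(contMDiffAt_iff_contMDiffAt_nhds (by simp)).1 hu,
      hu.continuousAt.preimage_mem_nhds (hopen.mem_nhds hz)] with ζ h1 h2 ξ
    rw [← mfderiv_eq_fderiv]
    exact DFunLike.congr_fun (mfderiv_comp ζ
      ((hs.contMDiffAt (hopen.mem_nhds h2)).mdifferentiableAt (by simp))
      (h1.mdifferentiableAt (by simp))) ξ
  -- As u_y = J u_x, the form ds ∘ J takes the value -∂_x(s ∘ u) on u_y and ∂_y(s ∘ u) on u_x, so
  -- its exterior derivative pulls back to -Δ(s ∘ u) dx ∧ dy.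
  have hI : (fun ζ => dc J s (u ζ) (mfderiv 𝓘(ℝ, ℂ) (QI d) u ζ Complex.I)) =ᶠ[𝓝 z]
      fun ζ => -fderiv ℝ (fun ζ => s (u ζ)) ζ 1 := by
    filter_upwards [hol, hd] with ζ h1 h2
    have := h1 1
    rw [mul_one] at this
    rw [h2, this]
    simp only [dc, ContinuousLinearMap.comp_apply]
    rw [hJ.square, map_neg]
  have h1 : (fun ζ => dc J s (u ζ) (mfderiv 𝓘(ℝ, ℂ) (QI d) u ζ (1 : ℂ))) =ᶠ[𝓝 z]
      fun ζ => fderiv ℝ (fun ζ => s (u ζ)) ζ Complex.I := by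
    filter_upwards [hol, hd] with ζ h1 h2
    have := h1 1
    rw [mul_one] at this
    rw [h2, this]
    simp only [dc, ContinuousLinearMap.comp_apply]
  have hI1 := hol.self_of_nhds 1
  rw [mul_one] at hI1
  rw [← hI1, e, hI.fderiv_eq, h1.fderiv_eq, lap, fderiv_fun_neg]
  simp
  ring

end Charts
end Sectorial
end

noncomputable section
namespace Sectorial

/-! ## Logarithmic singularities along a hyperplane -/

section HalfSpace

variable {E : Type*} [NormedAddCommGroup E] [NormedSpace ℝ E]

/-- The closed half-space `{0 ≤ ℓ}`. -/
def halfSpace (ℓ : E →L[ℝ] ℝ) : Set E := {y | 0 ≤ ℓ y}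

theorem halfSpace_mem_nhds {ℓ : E →L[ℝ] ℝ} {y : E} (hy : 0 < ℓ y) : halfSpace ℓ ∈ 𝓝 y := by
  filter_upwards [ℓ.continuous.continuousAt.eventually (lt_mem_nhds hy)] with z hz using le_of_lt hz

theorem uniqueDiffOn_halfSpace {ℓ : E →L[ℝ] ℝ} {e : E} (he : ℓ e = 1) :
    UniqueDiffOn ℝ (halfSpace ℓ) := by
  refine uniqueDiffOn_convex (fun x hx y hy a b ha hb _ => ?_)
    ⟨e, mem_interior_iff_mem_nhds.2 (halfSpace_mem_nhds (by simp [he]))⟩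
  change 0 ≤ ℓ (a • x + b • y)
  rw [map_add, map_smul, map_smul]
  exact add_nonneg (mul_nonneg ha hx) (mul_nonneg hb hy)

theorem tendsto_clm_apply {F α : Type*} [NormedAddCommGroup F] [NormedSpace ℝ F] {l : Filter α}
    {A : α → E →L[ℝ] F} {A₀ : E →L[ℝ] F} {v : α → E} {v₀ : E} (hA : Tendsto A l (𝓝 A₀))
    (hv : Tendsto v l (𝓝 v₀)) : Tendsto (fun t => A t (v t)) l (𝓝 (A₀ v₀)) :=
  (isBoundedBilinearMap_apply.continuous.tendsto (A₀, v₀)).comp (hA.prodMk_nhds hv)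

variable {ℓ : E →L[ℝ] ℝ} {e q : E} {ρ χ : E → ℝ}

theorem tendsto_ray (hq : ℓ q = 0) (he : ℓ e = 1) :
    Tendsto (fun t : ℝ => q + t • e) (𝓝[>] 0) (𝓝[halfSpace ℓ] q) := by
  refine tendsto_nhdsWithin_iff.2 ⟨?_, ?_⟩
  · have : Tendsto (fun t : ℝ => q + t • e) (𝓝 0) (𝓝 (q + (0 : ℝ) • e)) :=
      (by fun_prop : Continuous fun t : ℝ => q + t • e).tendsto 0
    rw [zero_smul, add_zero] at this
    exact this.mono_left nhdsWithin_le_nhds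
  · filter_upwards [self_mem_nhdsWithin] with t ht
    have : 0 < t := ht
    simp [halfSpace, hq, he, this.le]

theorem fderiv_eventuallyEq_fderivWithin (f : E → ℝ) {y : E} (hy : 0 < ℓ y) :
    fderiv ℝ f =ᶠ[𝓝 y] fderivWithin ℝ f (halfSpace ℓ) := by
  filter_upwards [ℓ.continuous.continuousAt.eventually (lt_mem_nhds hy)] with z hz
  exact (fderivWithin_of_mem_nhds (halfSpace_mem_nhds hz)).symm

theorem fderiv_fderiv_eq (f : E → ℝ) {y : E} (hy : 0 < ℓ y) :
    fderiv ℝ (fderiv ℝ f) y =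
      fderivWithin ℝ (fderivWithin ℝ f (halfSpace ℓ)) (halfSpace ℓ) y := by
  rw [(fderiv_eventuallyEq_fderivWithin f hy).fderiv_eq,
    fderivWithin_of_mem_nhds (halfSpace_mem_nhds hy)]

theorem ray_pos (hq : ℓ q = 0) (he : ℓ e = 1) {t : ℝ} (ht : 0 < t) : 0 < ℓ (q + t • e) := by
  simp [hq, he, ht]

/-- The derivatives up to order two extend continuously to the boundary. -/
theorem tendsto_derivs_ray (hq : ℓ q = 0) (he : ℓ e = 1)
    (hχ : ContDiffWithinAt ℝ 2 χ (halfSpace ℓ) q) :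
    Tendsto (fun t : ℝ => χ (q + t • e)) (𝓝[>] 0) (𝓝 (χ q)) ∧
    Tendsto (fun t : ℝ => fderiv ℝ χ (q + t • e)) (𝓝[>] 0)
      (𝓝 (fderivWithin ℝ χ (halfSpace ℓ) q)) ∧
    Tendsto (fun t : ℝ => fderiv ℝ (fderiv ℝ χ) (q + t • e)) (𝓝[>] 0)
      (𝓝 (fderivWithin ℝ (fderivWithin ℝ χ (halfSpace ℓ)) (halfSpace ℓ) q)) ∧
    ∀ᶠ t : ℝ in 𝓝[>] 0, ContDiffAt ℝ 2 χ (q + t • e) := by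
  have hqH : q ∈ halfSpace ℓ := by simp [halfSpace, hq]
  have hU := uniqueDiffOn_halfSpace he
  have h1 : ContDiffWithinAt ℝ 1 (fderivWithin ℝ χ (halfSpace ℓ)) (halfSpace ℓ) q :=
    hχ.fderivWithin_right hU (by norm_num) hqH
  have h2 : ContDiffWithinAt ℝ 0 (fderivWithin ℝ (fderivWithin ℝ χ (halfSpace ℓ)) (halfSpace ℓ))
      (halfSpace ℓ) q := h1.fderivWithin_right hU (by norm_num) hqH
  have hr := tendsto_ray hq he
  refine ⟨hχ.continuousWithinAt.tendsto.comp hr, ?_, ?_, ?_⟩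
  · refine (h1.continuousWithinAt.tendsto.comp hr).congr' ?_
    filter_upwards [self_mem_nhdsWithin] with t ht
    exact ((fderiv_eventuallyEq_fderivWithin χ (ray_pos hq he ht)).eq_of_nhds).symm
  · refine (h2.continuousWithinAt.tendsto.comp hr).congr' ?_
    filter_upwards [self_mem_nhdsWithin] with t ht
    exact (fderiv_fderiv_eq χ (ray_pos hq he ht)).symm
  · have h3 : ∀ᶠ y in 𝓝[halfSpace ℓ] q, ContDiffWithinAt ℝ 2 χ (halfSpace ℓ) y := by
      have := hχ.eventually (by simp)
      rwa [insert_eq_of_mem hqH] at this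
    filter_upwards [hr.eventually h3, self_mem_nhdsWithin] with t ht ht0
    exact ht.contDiffAt (halfSpace_mem_nhds (ray_pos hq he ht0))

/-- A defining function of the hyperplane `{ℓ = 0}` near `q`. -/
structure IsDefiningFunction (ℓ : E →L[ℝ] ℝ) (q : E) (κ : ℝ) (ρ : E → ℝ) : Prop where
  contDiff : ContDiffWithinAt ℝ 2 ρ (halfSpace ℓ) q
  pos : 0 < κ
  fderiv_eq : fderivWithin ℝ ρ (halfSpace ℓ) q = κ • ℓ
  eq_zero : ∀ᶠ y in 𝓝 q, ℓ y = 0 → ρ y = 0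

variable {κ : ℝ}

/-- ρ vanishes along the line q + tv inside the hyperplane, so its derivative in direction v
vanishes along that line, and so does the derivative of this derivative. -/
theorem IsDefiningFunction.snd_eq_zero (hρ : IsDefiningFunction ℓ q κ ρ) (hq : ℓ q = 0)
    (he : ℓ e = 1) {v : E} (hv : ℓ v = 0) :
    fderivWithin ℝ (fderivWithin ℝ ρ (halfSpace ℓ)) (halfSpace ℓ) q v v = 0 := by
  have hqH : q ∈ halfSpace ℓ := by simp [halfSpace, hq]
  have hU := uniqueDiffOn_halfSpace he
  set l : ℝ → E := fun t => q + t • v with hl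
  have hld : ∀ t, HasDerivAt l v t := fun t => by
    have := ((hasDerivAt_id t).smul_const v).const_add q
    rwa [one_smul] at this
  have hl0 : l 0 = q := by simp [hl]
  have hlz : ∀ t, ℓ (l t) = 0 := fun t => by simp [hl, hq, hv]
  have hlH : ∀ t, l t ∈ halfSpace ℓ := fun t => (hlz t).ge
  have hlc : Tendsto l (𝓝 0) (𝓝 q) := by
    have := (hld 0).continuousAt
    rwa [ContinuousAt, hl0] at this
  have hlw : Tendsto l (𝓝 0) (𝓝[halfSpace ℓ] q) :=
    tendsto_nhdsWithin_iff.2 ⟨hlc, Eventually.of_forall hlH⟩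
  have hev : ∀ᶠ y in 𝓝[halfSpace ℓ] q, ContDiffWithinAt ℝ 2 ρ (halfSpace ℓ) y := by
    have := hρ.contDiff.eventually (by simp)
    rwa [insert_eq_of_mem hqH] at this
  have h0 : ∀ᶠ t in 𝓝 (0 : ℝ), ρ (l t) = 0 := by
    filter_upwards [hlc.eventually hρ.eq_zero] with t ht using ht (hlz t)
  have h1 : ∀ᶠ t in 𝓝 (0 : ℝ), fderivWithin ℝ ρ (halfSpace ℓ) (l t) v = 0 := by
    filter_upwards [h0.eventually_nhds, hlw.eventually hev] with t ht hd
    have hd1 : HasDerivAt (ρ ∘ l) (fderivWithin ℝ ρ (halfSpace ℓ) (l t) v) t := by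
      have := (hd.differentiableWithinAt (by simp)).hasFDerivWithinAt.comp_hasDerivWithinAt t
        ((hld t).hasDerivWithinAt (s := univ)) (fun t _ => hlH t)
      rwa [hasDerivWithinAt_univ] at this
    have hd0 : HasDerivAt (ρ ∘ l) 0 t := by
      refine (hasDerivAt_const t (0 : ℝ)).congr_of_eventuallyEq ?_
      filter_upwards [ht] with t ht using ht
    exact hd1.unique hd0
  have hD : DifferentiableWithinAt ℝ (fderivWithin ℝ ρ (halfSpace ℓ)) (halfSpace ℓ) (l 0) := by
    rw [hl0]
    exact (hρ.contDiff.fderivWithin_right (m := 1) hU (by norm_num) hqH).differentiableWithinAt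
      (by simp)
  have hd1 : HasDerivAt (fun t => fderivWithin ℝ ρ (halfSpace ℓ) (l t) v)
      (fderivWithin ℝ (fderivWithin ℝ ρ (halfSpace ℓ)) (halfSpace ℓ) q v v) 0 := by
    have := hD.hasFDerivWithinAt.comp_hasDerivWithinAt 0
        ((hld 0).hasDerivWithinAt (s := univ)) (fun t _ => hlH t)
    rw [hasDerivWithinAt_univ, hl0] at this
    exact ((ContinuousLinearMap.apply ℝ ℝ v).hasFDerivAt.comp_hasDerivAt 0 this)
  have hd0 : HasDerivAt (fun t => fderivWithin ℝ ρ (halfSpace ℓ) (l t) v) 0 0 :=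
    (hasDerivAt_const 0 (0 : ℝ)).congr_of_eventuallyEq h1
  exact hd1.unique hd0

theorem fderiv_mul_log {y : E} (hχ : ContDiffAt ℝ 2 χ y) (hρ : ContDiffAt ℝ 2 ρ y)
    (hpos : 0 < ρ y) (b : E) :
    fderiv ℝ (fun η => χ η * Real.log (ρ η)) y b =
      Real.log (ρ y) * fderiv ℝ χ y b + χ y * ((ρ y)⁻¹ * fderiv ℝ ρ y b) := by
  have d1 := (hχ.differentiableAt (by simp)).hasFDerivAt
  have d2 := (hρ.differentiableAt (by simp)).hasFDerivAt
  have h : HasFDerivAt (fun η => χ η * Real.log (ρ η)) _ y := d1.mul (d2.log hpos.ne')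
  rw [h.fderiv]
  simp
  ring

theorem snd_fderiv_mul_log {y : E} (hχ : ContDiffAt ℝ 2 χ y) (hρ : ContDiffAt ℝ 2 ρ y)
    (hpos : 0 < ρ y) (v : E) :
    fderiv ℝ (fderiv ℝ (fun η => χ η * Real.log (ρ η))) y v v =
      Real.log (ρ y) * fderiv ℝ (fderiv ℝ χ) y v v
        + 2 * ((ρ y)⁻¹ * (fderiv ℝ χ y v * fderiv ℝ ρ y v))
        + χ y * ((ρ y)⁻¹ * fderiv ℝ (fderiv ℝ ρ) y v v
          - (ρ y)⁻¹ * (ρ y)⁻¹ * (fderiv ℝ ρ y v * fderiv ℝ ρ y v)) := by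
  have d1 := (hχ.differentiableAt (by simp)).hasFDerivAt
  have d2 := (hρ.differentiableAt (by simp)).hasFDerivAt
  have dd1 := ((hχ.fderiv_right (m := 1) (by norm_num)).differentiableAt (by simp)).hasFDerivAt
  have dd2 := ((hρ.fderiv_right (m := 1) (by norm_num)).differentiableAt (by simp)).hasFDerivAt
  have hev : fderiv ℝ (fun η => χ η * Real.log (ρ η)) =ᶠ[𝓝 y]
      fun η => Real.log (ρ η) • fderiv ℝ χ η + (χ η * (ρ η)⁻¹) • fderiv ℝ ρ η := by
    filter_upwards [hχ.eventually (by simp), hρ.eventually (by simp),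
      hρ.continuousAt.eventually (lt_mem_nhds hpos)] with η h1 h2 h3
    ext b
    rw [fderiv_mul_log h1 h2 h3]
    simp
    ring
  have hinv : HasFDerivAt (fun η => (ρ η)⁻¹) (-((ρ y)⁻¹ * (ρ y)⁻¹) • fderiv ℝ ρ y) y := by
    have := (hasDerivAt_inv hpos.ne').comp_hasFDerivAt y d2
    rwa [sq, mul_inv] at this
  have h : HasFDerivAt (fun η => Real.log (ρ η) • fderiv ℝ χ η + (χ η * (ρ η)⁻¹) • fderiv ℝ ρ η)
      _ y := ((d2.log hpos.ne').smul dd1).add ((d1.mul hinv).smul dd2)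
  rw [hev.fderiv_eq, h.fderiv]
  simp
  ring

theorem IsDefiningFunction.tendsto_div (hρ : IsDefiningFunction ℓ q κ ρ) (hq : ℓ q = 0)
    (he : ℓ e = 1) : Tendsto (fun t : ℝ => t⁻¹ * ρ (q + t • e)) (𝓝[>] 0) (𝓝 κ) := by
  have hqH : q ∈ halfSpace ℓ := by simp [halfSpace, hq]
  have hρq : ρ q = 0 := hρ.eq_zero.self_of_nhds hq
  have hf := (hρ.contDiff.differentiableWithinAt (by simp)).hasFDerivWithinAt
  have hld : HasDerivWithinAt (fun t : ℝ => q + t • e) e (Ioi 0) 0 := by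
    have := ((hasDerivAt_id (0 : ℝ)).smul_const e).const_add q
    rw [one_smul] at this
    exact this.hasDerivWithinAt
  have hc := HasFDerivWithinAt.comp_hasDerivWithinAt (f := fun t : ℝ => q + t • e) (l := ρ) 0
    (by simpa using hf) hld (fun t ht => (ray_pos hq he ht).le)
  rw [hasDerivWithinAt_iff_tendsto_slope' (by simp)] at hc
  refine (hc.congr fun t => ?_).trans (by simp [hρ.fderiv_eq, he])
  simp [slope, hρq]

/-- The differential of ρ at q annihilates the vectors v(t), so dρ(v(t)) at q + te is of order t.
This controls the worst term (dρ(v)/ρ)² of the second derivative of log ρ. -/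
theorem IsDefiningFunction.tendsto_fderiv_div (hρ : IsDefiningFunction ℓ q κ ρ) (hq : ℓ q = 0)
    (he : ℓ e = 1) {v : ℝ → E} {v₀ : E} (hv : Tendsto v (𝓝[>] 0) (𝓝 v₀))
    (hv0 : ∀ᶠ t in 𝓝[>] 0, ℓ (v t) = 0) :
    Tendsto (fun t : ℝ => t⁻¹ * fderiv ℝ ρ (q + t • e) (v t)) (𝓝[>] 0)
      (𝓝 (fderivWithin ℝ (fderivWithin ℝ ρ (halfSpace ℓ)) (halfSpace ℓ) q e v₀)) := by
  have hqH : q ∈ halfSpace ℓ := by simp [halfSpace, hq]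
  have hf := ((hρ.contDiff.fderivWithin_right (m := 1) (uniqueDiffOn_halfSpace he) (by norm_num)
    hqH).differentiableWithinAt (by simp)).hasFDerivWithinAt
  have hld : HasDerivWithinAt (fun t : ℝ => q + t • e) e (Ioi 0) 0 := by
    have := ((hasDerivAt_id (0 : ℝ)).smul_const e).const_add q
    rw [one_smul] at this
    exact this.hasDerivWithinAt
  have hc := HasFDerivWithinAt.comp_hasDerivWithinAt (f := fun t : ℝ => q + t • e)
    (l := fderivWithin ℝ ρ (halfSpace ℓ)) 0
    (by simpa using hf) hld (fun t ht => (ray_pos hq he ht).le)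
  rw [hasDerivWithinAt_iff_tendsto_slope' (by simp)] at hc
  refine (tendsto_clm_apply hc hv).congr' ?_
  filter_upwards [self_mem_nhdsWithin, hv0] with t ht hvt
  simp only [slope, Function.comp_apply, sub_zero, vsub_eq_sub, zero_smul, add_zero,
    smul_apply, sub_apply, hρ.fderiv_eq, hvt, smul_eq_mul,
    mul_zero]
  rw [(fderiv_eventuallyEq_fderivWithin ρ (ray_pos hq he ht)).eq_of_nhds]

/-- The normalized second derivatives of `χ log ρ` in directions tangent to the hyperplane tend to
zero, and the normalized first derivative tends to `χ ℓ`. -/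
theorem IsDefiningFunction.tendsto_mul_log (hρ : IsDefiningFunction ℓ q κ ρ) (hq : ℓ q = 0)
    (he : ℓ e = 1) (hχ : ContDiffWithinAt ℝ 2 χ (halfSpace ℓ) q) {v b : ℝ → E} {v₀ b₀ : E}
    (hv : Tendsto v (𝓝[>] 0) (𝓝 v₀)) (hv0 : ∀ᶠ t in 𝓝[>] 0, ℓ (v t) = 0)
    (hb : Tendsto b (𝓝[>] 0) (𝓝 b₀)) :
    (∀ᶠ t : ℝ in 𝓝[>] 0, ContDiffAt ℝ 2 (fun η => χ η * Real.log (ρ η)) (q + t • e)) ∧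
    Tendsto (fun t : ℝ => t * fderiv ℝ (fderiv ℝ (fun η => χ η * Real.log (ρ η))) (q + t • e)
      (v t) (v t)) (𝓝[>] 0) (𝓝 0) ∧
    Tendsto (fun t : ℝ => t * fderiv ℝ (fun η => χ η * Real.log (ρ η)) (q + t • e) (b t))
      (𝓝[>] 0) (𝓝 (χ q * ℓ b₀)) := by
  obtain ⟨c0, c1, c2, c3⟩ := tendsto_derivs_ray hq he hχ
  obtain ⟨r0, r1, r2, r3⟩ := tendsto_derivs_ray hq he hρ.contDiff
  have hdiv := hρ.tendsto_div hq he
  have hdv := hρ.tendsto_fderiv_div hq he hv hv0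
  have ht0 : Tendsto (fun t : ℝ => t) (𝓝[>] 0) (𝓝 0) := tendsto_nhdsWithin_of_tendsto_nhds tendsto_id
  have hv₀ : ℓ v₀ = 0 := by
    have h1 := (ℓ.continuous.tendsto v₀).comp hv
    exact tendsto_nhds_unique (h1.congr' hv0) tendsto_const_nhds
  have hposd : ∀ᶠ t : ℝ in 𝓝[>] 0, 0 < t⁻¹ * ρ (q + t • e) := hdiv.eventually (lt_mem_nhds hρ.pos)
  have hpos : ∀ᶠ t : ℝ in 𝓝[>] 0, 0 < ρ (q + t • e) := by
    filter_upwards [hposd, self_mem_nhdsWithin] with t h1 h2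
    exact (pos_iff_pos_of_mul_pos h1).1 (inv_pos.2 h2)
  have hinv : Tendsto (fun t : ℝ => t * (ρ (q + t • e))⁻¹) (𝓝[>] 0) (𝓝 κ⁻¹) := by
    refine (hdiv.inv₀ hρ.pos.ne').congr fun t => ?_
    rw [mul_inv, inv_inv]
  have hlog : Tendsto (fun t : ℝ => t * Real.log (ρ (q + t • e))) (𝓝[>] 0) (𝓝 0) := by
    -- t log ρ = t log(ρ/t) + t log t, where ρ/t tends to κ > 0.
    have h1 : Tendsto (fun t : ℝ => t * Real.log (t⁻¹ * ρ (q + t • e)) + Real.log t * t)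
        (𝓝[>] 0) (𝓝 (0 * Real.log κ + 0)) :=
      (ht0.mul (hdiv.log hρ.pos.ne')).add (by simpa [mul_comm] using (Real.continuous_mul_log.tendsto 0).mono_left nhdsWithin_le_nhds)
    rw [zero_mul, add_zero] at h1
    refine h1.congr' ?_
    filter_upwards [hpos, self_mem_nhdsWithin] with t h1 h2
    have h2' : 0 < t := h2
    rw [Real.log_mul (inv_ne_zero h2'.ne') h1.ne', Real.log_inv]
    ring
  refine ⟨?_, ?_, ?_⟩
  · filter_upwards [c3, r3, hpos] with t h1 h2 h3
    exact h1.mul (h2.log h3.ne')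
  -- Termwise: t log ρ → 0; t/ρ → 1/κ multiplies dχ(v) dρ(v) and D²ρ(v,v), both tending to 0 because
  -- v₀ is tangent to the hyperplane; and t(dρ(v)/ρ)² = t (t/ρ)² (dρ(v)/t)² → 0.
  · have T := ((hlog.mul (tendsto_clm_apply (tendsto_clm_apply c2 hv) hv)).add
      ((((hinv.mul ((tendsto_clm_apply c1 hv).mul (tendsto_clm_apply r1 hv)))).const_mul 2))).add
      (c0.mul ((hinv.mul (tendsto_clm_apply (tendsto_clm_apply r2 hv) hv)).sub
        (((hinv.mul hinv).mul (hdv.mul hdv)).mul ht0)))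
    rw [hρ.snd_eq_zero hq he hv₀, hρ.fderiv_eq] at T
    simp only [smul_apply, hv₀, smul_zero, mul_zero, zero_mul, sub_zero,
      add_zero] at T
    refine T.congr' ?_
    filter_upwards [c3, r3, hpos, self_mem_nhdsWithin] with t h1 h2 h3 h4
    have h4' : t ≠ 0 := (show 0 < t from h4).ne'
    rw [snd_fderiv_mul_log h1 h2 h3]
    field_simp
  · have T := (hlog.mul (tendsto_clm_apply c1 hb)).add (c0.mul (hinv.mul (tendsto_clm_apply r1 hb)))
    rw [hρ.fderiv_eq] at T
    have hκ := hρ.pos.ne'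
    have e1 : 0 * (fderivWithin ℝ χ (halfSpace ℓ) q) b₀ + χ q * (κ⁻¹ * (κ • ℓ) b₀) = χ q * ℓ b₀ := by
      simp [hκ]
    rw [e1] at T
    refine T.congr' ?_
    filter_upwards [c3, r3, hpos] with t h1 h2 h3
    rw [fderiv_mul_log h1 h2 h3]
    ring

/-- The boundary hyperplane is Levi-flat or pseudoconvex if a function with a logarithmic
singularity along it is plurisubharmonic. -/
theorem leviVec_nonpos {ι : Type*} {s : Finset ι} {ρ χ : ι → E → ℝ} {κ : ι → ℝ} {f : E → ℝ}
    {J : E → E →L[ℝ] E} {S : Set E} (hq : ℓ q = 0) (he : ℓ e = 1)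
    (hρ : ∀ c ∈ s, IsDefiningFunction ℓ q (κ c) (ρ c))
    (hχ : ∀ c ∈ s, ContDiffWithinAt ℝ 2 (χ c) (halfSpace ℓ) q)
    (hsum : ∑ c ∈ s, χ c q = 1)
    (hf : ∀ᶠ y in 𝓝 q, 0 < ℓ y → f y = -∑ c ∈ s, χ c y * Real.log (ρ c y))
    {v w : ℝ → E} {v₀ w₀ b₀ : E}
    (hv : Tendsto v (𝓝[>] 0) (𝓝 v₀)) (hv0 : ∀ᶠ t in 𝓝[>] 0, ℓ (v t) = 0)
    (hw : Tendsto w (𝓝[>] 0) (𝓝 w₀)) (hw0 : ∀ᶠ t in 𝓝[>] 0, ℓ (w t) = 0)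
    (hJ : ∀ᶠ t : ℝ in 𝓝[>] 0, J (q + t • e) (v t) = w t)
    (hb : Tendsto (fun t : ℝ => leviVec J S (q + t • e) (v t)) (𝓝[>] 0) (𝓝 b₀))
    (hlevi : ∀ᶠ t : ℝ in 𝓝[>] 0, 0 ≤ leviForm J S f (q + t • e) (v t)) :
    ℓ b₀ ≤ 0 := by
  set F : ι → E → ℝ := fun c η => χ c η * Real.log (ρ c η) with hF
  have hr0 : Tendsto (fun t : ℝ => q + t • e) (𝓝[>] 0) (𝓝 q) :=
    tendsto_nhds_of_tendsto_nhdsWithin (tendsto_ray hq he)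
  have Hv := fun c hc => (hρ c hc).tendsto_mul_log hq he (hχ c hc) hv hv0 hb
  have Hw := fun c hc => (hρ c hc).tendsto_mul_log hq he (hχ c hc) hw hw0 hb
  -- This is t times the Levi form of -f at q + te on v(t), with w = Jv. The Hessian terms tend to
  -- 0, and as the χ sum to 1 at q, the first-order terms tend to ℓ(b₀). Since f is plurisubharmonic
  -- along the ray, the limit is nonpositive.
  have T : Tendsto (fun t : ℝ => ∑ c ∈ s,
      (t * fderiv ℝ (fderiv ℝ (F c)) (q + t • e) (v t) (v t)
      + t * fderiv ℝ (fderiv ℝ (F c)) (q + t • e) (w t) (w t)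
      + t * fderiv ℝ (F c) (q + t • e) (leviVec J S (q + t • e) (v t)))) (𝓝[>] 0)
      (𝓝 (∑ c ∈ s, (0 + 0 + χ c q * ℓ b₀))) :=
    tendsto_finsetSum _ fun c hc =>
      ((Hv c hc).2.1.add (Hw c hc).2.1).add (Hv c hc).2.2
  simp only [zero_add, ← Finset.sum_mul, hsum, one_mul] at T
  refine le_of_tendsto T ?_
  have hcd : ∀ᶠ t : ℝ in 𝓝[>] 0, ∀ c ∈ s, ContDiffAt ℝ 2 (F c) (q + t • e) :=
    (Finset.eventually_all s).2 fun c hc => (Hv c hc).1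
  filter_upwards [hcd, hlevi, hJ, hr0.eventually hf.eventually_nhds, self_mem_nhdsWithin]
    with t h1 h2 h3 h4 h5
  have ht : 0 < t := h5
  have hfF : f =ᶠ[𝓝 (q + t • e)] fun y => -∑ c ∈ s, F c y := by
    filter_upwards [h4, ℓ.continuous.continuousAt.eventually (lt_mem_nhds (ray_pos hq he ht))]
      with y hy1 hy2 using hy1 hy2
  have hd1 : ∀ᶠ y in 𝓝 (q + t • e), fderiv ℝ f y = -∑ c ∈ s, fderiv ℝ (F c) y := by
    have : ∀ᶠ y in 𝓝 (q + t • e), ∀ c ∈ s, ContDiffAt ℝ 2 (F c) y :=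
      (Finset.eventually_all s).2 fun c hc => (h1 c hc).eventually (by simp)
    filter_upwards [hfF.eventuallyEq_nhds, this] with y hy1 hy2
    rw [hy1.fderiv_eq, fderiv_fun_neg, fderiv_fun_sum]
    exact fun c hc => (hy2 c hc).differentiableAt (by simp)
  have hd2 : fderiv ℝ (fderiv ℝ f) (q + t • e) =
      -∑ c ∈ s, fderiv ℝ (fderiv ℝ (F c)) (q + t • e) := by
    rw [Filter.EventuallyEq.fderiv_eq hd1, fderiv_fun_neg, fderiv_fun_sum]
    exact fun c hc => ((h1 c hc).fderiv_right (m := 1) (by norm_num)).differentiableAt (by simp)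
  rw [leviForm, h3, hd2, hd1.self_of_nhds] at h2
  simp only [neg_apply, sum_apply] at h2
  rw [Finset.sum_add_distrib, Finset.sum_add_distrib, ← Finset.mul_sum, ← Finset.mul_sum,
    ← Finset.mul_sum, ← mul_add, ← mul_add]
  exact mul_nonpos_of_nonneg_of_nonpos ht.le (by linarith)

end HalfSpace
end Sectorial
end

noncomputable section
namespace Sectorial

/-! ## Linear algebra of symplectic splittings -/

/-- In a symplectic splitting the differentials of the `R_i` do not vanish. -/
theorem splitting_ne_zero {E A : Type*} [AddCommGroup E] [Module ℝ E] [FiniteDimensional ℝ E]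
    [Fintype A] [DecidableEq A] {σ σ' : E →ₗ[ℝ] E →ₗ[ℝ] ℝ} {P Q : E →ₗ[ℝ] E}
    {D R I : A → E →ₗ[ℝ] ℝ} {X Y : A → E} (hσ' : ∀ v, (∀ w, σ' v w = 0) → v = 0)
    (hX : ∀ j w, σ (X j) w = D j w) (hY : ∀ i j, D i (Y j) = if i = j then 1 else 0)
    (hXX : ∀ i j, σ (X i) (X j) = 0) (hPX : ∀ j, P (X j) = 0) (hDP : ∀ j v, D j (P v) = 0)
    (hPP : ∀ v, P (P v) = P v) (hPQ : ∀ v, P (Q v) = Q v)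
    (hs : ∀ v w, σ' v w = σ (Q v) (Q w) + ∑ i, (R i v * I i w - R i w * I i v)) (i : A) :
    R i ≠ 0 := by
  intro hRi
  -- θ = (Q, R, I) is injective: a vector in its kernel is σ'-orthogonal to everything by the
  -- splitting formula.
  let θ : E →ₗ[ℝ] LinearMap.range P × (A → ℝ) × (A → ℝ) :=
    (Q.codRestrict (LinearMap.range P) fun v => ⟨Q v, hPQ v⟩).prod
      ((LinearMap.pi R).prod (LinearMap.pi I))
  have hθ : Function.Injective θ := by
    refine (injective_iff_map_eq_zero θ).2 fun v hv => hσ' v fun w => ?_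
    have h1 : Q v = 0 := congrArg (fun p => (p.1 : E)) hv
    have h2 : ∀ j, R j v = 0 := fun j => congrFun (congrArg (fun p => p.2.1) hv) j
    have h3 : ∀ j, I j v = 0 := fun j => congrFun (congrArg (fun p => p.2.2) hv) j
    rw [hs, h1]
    simp [h2, h3]
  -- A map back from the same space. It is injective because D_k detects the coefficients of the Y,
  -- then P detects the component in its range, and finally σ(·, Y_k) detects the coefficients of
  -- the X. Hence the dimensions agree, θ is onto, and R i takes the value 1.
  let η : LinearMap.range P × (A → ℝ) × (A → ℝ) →ₗ[ℝ] E :=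
    (LinearMap.range P).subtype.coprod
      ((Fintype.linearCombination ℝ X).coprod (Fintype.linearCombination ℝ Y))
  have hη : Function.Injective η := by
    refine (injective_iff_map_eq_zero η).2 ?_
    rintro ⟨⟨p, hp⟩, t, r⟩ h
    have hpe : P p = p := by obtain ⟨v, rfl⟩ := hp; exact hPP v
    have hDp : ∀ j, D j p = 0 := fun j => by rw [← hpe]; exact hDP j p
    have h' : p + (∑ j, t j • X j + ∑ j, r j • Y j) = 0 := h
    have hDX : ∀ i j, D i (X j) = 0 := fun i j => by rw [← hX]; exact hXX i j
    have hr : r = 0 := by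
      funext k
      have := congrArg (D k) h'
      simpa [map_add, map_sum, hDp, hDX, hY] using this
    subst hr
    have hp0 : p = 0 := by
      have := congrArg P h'
      simpa [map_add, map_sum, hpe, hPX] using this
    subst hp0
    have ht : t = 0 := by
      funext k
      have := congrArg (fun v => σ v (Y k)) h'
      simpa [map_add, map_sum, hX, hY] using this
    subst ht
    rfl
  have hfin := le_antisymm (LinearMap.finrank_le_finrank_of_injective hθ)
    (LinearMap.finrank_le_finrank_of_injective hη)
  obtain ⟨v, hv⟩ := (LinearMap.injective_iff_surjective_of_finrank_eq_finrank hfin).1 hθ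
    (0, fun _ => 1, 0)
  have : R i v = 1 := congrFun (congrArg (fun p => p.2.1) hv) i
  simp [hRi] at this

/-! ## Functions with a minimum on a face -/

section Face

variable {E : Type*} [NormedAddCommGroup E] [NormedSpace ℝ E] {ℓ : E →L[ℝ] ℝ} {e q : E}

/-- At a minimum over the half-space the differential is nonnegative on {0 ≤ ℓ}. On the kernel of ℓ
this applies to both v and -v, so the differential vanishes there and is a multiple of ℓ. -/
theorem fderivWithin_halfSpace_of_nonneg {g : E → ℝ} (hq : ℓ q = 0) (he : ℓ e = 1)
    (hg : DifferentiableWithinAt ℝ g (halfSpace ℓ) q) (h0 : g q = 0)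
    (hn : ∀ᶠ y in 𝓝[halfSpace ℓ] q, 0 ≤ g y) :
    ∃ k : ℝ, 0 ≤ k ∧ fderivWithin ℝ g (halfSpace ℓ) q = k • ℓ := by
  have hmin : IsLocalMinOn g (halfSpace ℓ) q := by
    filter_upwards [hn] with y hy; rwa [h0]
  have hcone : ∀ v : E, 0 ≤ ℓ v → 0 ≤ fderivWithin ℝ g (halfSpace ℓ) q v := fun v hv => by
    refine hmin.hasFDerivWithinAt_nonneg hg.hasFDerivWithinAt ?_
    refine mem_posTangentConeAt_of_segment_subset ?_
    rintro _ ⟨a, b, ha, hb, hab, rfl⟩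
    have e1 : a • q + b • (q + v) = (a + b) • q + b • v := by module
    change 0 ≤ ℓ (a • q + b • (q + v))
    rw [e1, map_add, map_smul, map_smul, hq]
    simpa using mul_nonneg hb hv
  refine ⟨fderivWithin ℝ g (halfSpace ℓ) q e, hcone e (by simp [he]), ?_⟩
  ext v
  have hv0 : ℓ (v - ℓ v • e) = 0 := by simp [he]
  have h1 := hcone _ hv0.ge
  have h2 := hcone (-(v - ℓ v • e)) (by rw [map_neg, hv0, neg_zero])
  rw [map_neg] at h2
  have h3 : fderivWithin ℝ g (halfSpace ℓ) q (v - ℓ v • e) = 0 := by linarith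
  rw [map_sub, map_smul, sub_eq_zero] at h3
  rw [h3]
  simp [mul_comm]

end Face

theorem IsCornerSmoothing.pos {ι : Type*} [Fintype ι] {ε₀ : ℝ} {φ : (ι → ℝ) → ℝ}
    (h : IsCornerSmoothing ε₀ φ) {x : ι → ℝ} (hx : ∀ i, 0 < x i) : 0 < φ x := by
  refine lt_of_le_of_ne (h.nonneg x fun i => (hx i).le) fun e => ?_
  obtain ⟨i, hi⟩ := (h.eq_zero x fun i => (hx i).le).1 e.symm
  exact (hx i).ne' hi

theorem orthant_mem_nhds {ι : Type*} [Fintype ι] {x : ι → ℝ} (hx : ∀ i, 0 < x i) :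
    {y : ι → ℝ | ∀ i, 0 ≤ y i} ∈ 𝓝 x := by
  have : ∀ᶠ y in 𝓝 x, ∀ i, 0 < y i := eventually_all.2 fun i =>
    (continuous_apply i).continuousAt.eventually (lt_mem_nhds (hx i))
  filter_upwards [this] with y hy i using (hy i).le

theorem IsCornerSmoothing.contDiffAt {ι : Type*} [Fintype ι] {ε₀ : ℝ} {φ : (ι → ℝ) → ℝ}
    (h : IsCornerSmoothing ε₀ φ) {x : ι → ℝ} (hx : ∀ i, 0 < x i) : ContDiffAt ℝ ∞ φ x :=
  (h.regular x (fun i => (hx i).le) fun i _ hi => absurd hi (hx i).ne').1.contDiffAt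
    (orthant_mem_nhds hx)

/-- The differential of a corner-smoothing function at a point of a single face. -/
theorem IsCornerSmoothing.fderivWithin_eq {ι : Type*} [Fintype ι] {ε₀ : ℝ} {φ : (ι → ℝ) → ℝ}
    (h : IsCornerSmoothing ε₀ φ) {x : ι → ℝ} {i : ι} (hi : x i = 0) (hx : ∀ j, j ≠ i → 0 < x j) :
    ContDiffWithinAt ℝ ∞ φ {y | ∀ i, 0 ≤ y i} x ∧
    ∃ k : ℝ, 0 < k ∧ fderivWithin ℝ φ {y | ∀ i, 0 ≤ y i} x =
      k • (ContinuousLinearMap.proj i : (ι → ℝ) →L[ℝ] ℝ) := by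
  classical
  set ℓ : (ι → ℝ) →L[ℝ] ℝ := ContinuousLinearMap.proj i with hℓ
  have hx0 : ∀ j, 0 ≤ x j := fun j => by
    by_cases hj : j = i
    · rw [hj, hi]
    · exact (hx j hj).le
  obtain ⟨hc, hne⟩ := h.regular x hx0 fun j k hj hk => by
    by_contra hjk
    by_cases hji : j = i
    · exact (hx k fun e => hjk (by rw [hji, e])).ne' hk
    · exact (hx j hji).ne' hj
  have hset : ({y : ι → ℝ | ∀ i, 0 ≤ y i} : Set (ι → ℝ)) =ᶠ[𝓝 x] halfSpace ℓ := by
    have : ∀ᶠ y in 𝓝 x, ∀ j, j ≠ i → 0 < y j := eventually_all.2 fun j => by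
      by_cases hj : j = i
      · simp [hj]
      · filter_upwards [(continuous_apply j).continuousAt.eventually (lt_mem_nhds (hx j hj))]
          with y hy _ using hy
    filter_upwards [this] with y hy
    refine propext ⟨fun h' => h' i, fun h' j => ?_⟩
    by_cases hj : j = i
    · rw [hj]; exact h'
    · exact (hy j hj).le
  refine ⟨hc, ?_⟩
  have hcH : ContDiffWithinAt ℝ ∞ φ (halfSpace ℓ) x := (contDiffWithinAt_congr_set hset).1 hc
  have he : ℓ (Pi.single i 1) = 1 := by simp [hℓ]
  obtain ⟨k, hk, hk'⟩ := fderivWithin_halfSpace_of_nonneg (ℓ := ℓ) (q := x) (g := φ) hi he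
    (hcH.differentiableWithinAt (by simp)) ((h.eq_zero x hx0).2 ⟨i, hi⟩) (by
      filter_upwards [mem_nhdsWithin_of_mem_nhds hset.mem_iff, self_mem_nhdsWithin] with y h1 h2
      exact h.nonneg y (h1.2 h2))
  rw [fderivWithin_congr_set hset] at hne ⊢
  refine ⟨k, lt_of_le_of_ne hk fun e => hne ?_, hk'⟩
  rw [hk', ← e, zero_smul]

/-! ## Smoothness of the end-profile function -/

section Profile

variable {d : ℕ} {M : Type*} [TopologicalSpace M] [ChartedSpace (EuclideanQuadrant d) M]

/-- The function `φ₂(φ(R), e^{-s})`. -/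
def SmoothingProfile.cornerEndExp {X : LiouvilleSector d M} (P : SmoothingProfile X)
    (c : Fin P.n) (x : M) : ℝ :=
  P.φ₂ c ![P.φ c (fun i => (P.chart c).R i x), Real.exp (-P.rad x)]

theorem SmoothingProfile.cornerEndFun_eq {X : LiouvilleSector d M} (P : SmoothingProfile X)
    (c : Fin P.n) {x : M} (hx : ∀ i, 0 < (P.chart c).R i x) :
    P.cornerEndFun c x = -Real.log (P.cornerEndExp c x) := by
  rw [cornerEndFun, cornerEndExp, cornerFun, neg_neg,
    Real.exp_log ((P.isCornerSmoothing c).pos hx)]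

theorem SmoothingProfile.cornerEndExp_pos {X : LiouvilleSector d M} (P : SmoothingProfile X)
    (c : Fin P.n) {x : M} (hx : ∀ i, 0 < (P.chart c).R i x) : 0 < P.cornerEndExp c x := by
  refine (P.isCornerSmoothing₂ c).pos fun i => ?_
  fin_cases i
  · exact (P.isCornerSmoothing c).pos hx
  · exact Real.exp_pos _

theorem maximalAtlas_mdifferentiable {e : OpenPartialHomeomorph M (EuclideanQuadrant d)}
    (he : e ∈ IsManifold.maximalAtlas (QI d) ∞ M) : e.MDifferentiable (QI d) (QI d) :=
  ⟨(contMDiffOn_of_mem_maximalAtlas he).mdifferentiableOn (by simp),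
    (contMDiffOn_symm_of_mem_maximalAtlas he).mdifferentiableOn (by simp)⟩

theorem SplittingChart.R_pos {X : LiouvilleSector d M} (C : SplittingChart X) {x : M}
    (hx : x ∈ C.U) {i : C.A} (hi : x ∉ X.H i.1) : 0 < C.R i x :=
  lt_of_le_of_ne (C.R_nonneg i x hx) fun e => hi ((C.R_eq_zero i x hx).1 e.symm)

/-- Differentiable maps with surjective differential preserve interior points; this applies to the
chart and to its inverse. It is needed because face systems are given by charts of the maximal
atlas. -/
theorem mem_interior_iff_maximalAtlas {e : OpenPartialHomeomorph M (EuclideanQuadrant d)}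
    (he : e ∈ IsManifold.maximalAtlas (QI d) ∞ M) {x : M} (hx : x ∈ e.source) :
    x ∈ (QI d).interior M ↔ ∀ a, 0 < (e x).1 a := by
  have hd := maximalAtlas_mdifferentiable he
  have hm : ∀ y : EuclideanQuadrant d, (QI d).IsInteriorPoint y ↔ ∀ a, 0 < y.1 a := fun y => by
    have : (QI d).IsInteriorPoint y ↔ y.1 ∈ interior (range (QI d)) := by
      change extChartAt (QI d) y y ∈ interior (range (QI d)) ↔ _
      simp only [mfld_simps]
      rfl
    rw [this, interior_range_QI]; rfl
  rw [← hm]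
  constructor
  · exact (hd.mdifferentiableAt hx).isInteriorPoint_of_surjective_mfderiv (hd.mfderiv_surjective hx)
  · intro h
    have := (hd.symm.mdifferentiableAt (e.map_source hx)).isInteriorPoint_of_surjective_mfderiv
      (hd.symm.mfderiv_surjective (e.map_source hx)) h
    rwa [e.left_inv hx] at this

theorem IsFaceSystem.mem_boundary_iff {m : ℕ} {H : Fin m → Set M} (hH : IsFaceSystem d H) (x : M) :
    x ∉ (QI d).interior M ↔ ∃ i, x ∈ H i := by
  obtain ⟨e, he, hx, c, -, h1, -, h3⟩ := hH.chart x
  rw [mem_interior_iff_maximalAtlas he hx]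
  push Not
  constructor
  · rintro ⟨a, ha⟩
    obtain ⟨i, -⟩ := h3 x hx a (le_antisymm ha ((e x).2 a))
    exact ⟨i.1, i.2⟩
  · rintro ⟨i, hi⟩
    exact ⟨c ⟨i, hi⟩, ((h1 ⟨i, hi⟩ x hx).1 hi).le⟩

theorem SplittingChart.R_pos_of_mem_interior {X : LiouvilleSector d M} (C : SplittingChart X)
    {x : M} (hx : x ∈ C.U) (hi : x ∈ (QI d).interior M) (i : C.A) : 0 < C.R i x :=
  C.R_pos hx fun h => ((X.faces.mem_boundary_iff x).2 ⟨_, h⟩) hi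

variable [IsManifold (QI d) ∞ M]

/-- On the interior all R_i are positive, so φ, φ₂ and log are only evaluated where they are smooth.
Off the support of χ_c the summand is locally zero, whatever the value of `cornerEndFun` there. -/
theorem SmoothingProfile.contMDiffOn_endProfile {X : LiouvilleSector d M}
    (P : SmoothingProfile X) :
    ContMDiffOn (QI d) 𝓘(ℝ, ℝ) ∞ P.endProfile ((QI d).interior M) := by
  have hopen : IsOpen ((QI d).interior M) := (QI d).isOpen_interior (n := 1) (by simp)
  intro x hx
  refine ContMDiffAt.contMDiffWithinAt ?_
  refine ((P.smooth_χ₀.contMDiffAt).mul P.isRadial.smooth.contMDiffAt).add ?_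
  refine ContMDiffAt.sum fun c _ => ?_
  by_cases hc : x ∈ tsupport (P.χ c)
  · have hU := P.support_χ c hc
    refine P.smooth_χ c |>.contMDiffAt.mul ?_
    have hev : P.cornerEndFun c =ᶠ[𝓝 x] fun y => -Real.log (P.cornerEndExp c y) := by
      filter_upwards [hopen.mem_nhds hx, (P.chart c).isOpen.mem_nhds hU] with y h1 h2
      exact P.cornerEndFun_eq c ((P.chart c).R_pos_of_mem_interior h2 h1)
    refine ContMDiffAt.congr_of_eventuallyEq ?_ hev
    have hR := (P.chart c).R_pos_of_mem_interior hU hx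
    have h1 : ContMDiffAt (QI d) 𝓘(ℝ, (P.chart c).A → ℝ) ∞ (fun y i => (P.chart c).R i y) x :=
      contMDiffAt_pi_space.2 fun i =>
        ((P.chart c).smooth_R i).contMDiffAt ((P.chart c).isOpen.mem_nhds hU)
    have h2 : ContMDiffAt (QI d) 𝓘(ℝ, ℝ) ∞ (fun y => P.φ c (fun i => (P.chart c).R i y)) x :=
      ContMDiffAt.comp (g := P.φ c) (f := fun y i => (P.chart c).R i y) x
        ((P.isCornerSmoothing c).contDiffAt hR).contMDiffAt h1
    have h3 : ContMDiffAt (QI d) 𝓘(ℝ, ℝ) ∞ (fun y => Real.exp (-P.rad y)) x :=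
      ContMDiffAt.comp (g := fun t : ℝ => Real.exp (-t)) (f := P.rad) x
        (by fun_prop : ContDiff ℝ ∞ fun t : ℝ => Real.exp (-t)).contMDiff.contMDiffAt
        P.isRadial.smooth.contMDiffAt
    have h4 : ContMDiffAt (QI d) 𝓘(ℝ, Fin 2 → ℝ) ∞
        (fun y => ![P.φ c (fun i => (P.chart c).R i y), Real.exp (-P.rad y)]) x := by
      refine contMDiffAt_pi_space.2 fun i => ?_
      fin_cases i
      · exact h2
      · exact h3
    have h5 : ContMDiffAt (QI d) 𝓘(ℝ, ℝ) ∞ (P.cornerEndExp c) x := by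
      refine ContMDiffAt.comp (g := P.φ₂ c)
        (f := fun y => ![P.φ c (fun i => (P.chart c).R i y), Real.exp (-P.rad y)]) x
        (ContDiffAt.contMDiffAt ((P.isCornerSmoothing₂ c).contDiffAt fun i => ?_)) h4
      fin_cases i
      · exact (P.isCornerSmoothing c).pos hR
      · exact Real.exp_pos _
    have h6 : ContDiffAt ℝ ∞ (fun t : ℝ => -Real.log t) (P.cornerEndExp c x) :=
      (Real.contDiffAt_log.2 (P.cornerEndExp_pos c hR).ne').neg
    exact ContMDiffAt.comp (g := fun t : ℝ => -Real.log t) (f := P.cornerEndExp c) x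
      h6.contMDiffAt h5
  · have : (fun y => P.χ c y * P.cornerEndFun c y) =ᶠ[𝓝 x] fun _ => 0 := by
      filter_upwards [(isClosed_tsupport (P.χ c)).isOpen_compl.mem_nhds hc] with y hy
      rw [image_eq_zero_of_notMem_tsupport hy, zero_mul]
    exact contMDiffAt_const.congr_of_eventuallyEq this

end Profile
end Sectorial
end

noncomputable section
namespace Sectorial

/-! ### Duality for the symplectic form and nonvanishing of the differentials dR_i. -/

section Forms

variable {d : ℕ} {M : Type*} [TopologicalSpace M] [ChartedSpace (EuclideanQuadrant d) M]

/-- The symplectic form as a bilinear map. -/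
def LiouvilleForm.omLin (X : LiouvilleForm d M) (x : M) :
    EuclideanSpace ℝ (Fin d) →ₗ[ℝ] EuclideanSpace ℝ (Fin d) →ₗ[ℝ] ℝ :=
  LinearMap.mk₂ ℝ (fun v w => X.om x v w)
    (fun v v' w => by simp only [LiouvilleForm.om, extD]; erw [map_add, map_add]; simp; ring)
    (fun c v w => by simp only [LiouvilleForm.om, extD]; erw [map_smul, map_smul]; simp; ring)
    (fun v w w' => by simp only [LiouvilleForm.om, extD]; erw [map_add, map_add]; simp; ring)
    (fun c v w => by simp only [LiouvilleForm.om, extD]; erw [map_smul, map_smul]; simp; ring)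

theorem LiouvilleForm.exists_dual (X : LiouvilleForm d M) (x : M)
    (D : EuclideanSpace ℝ (Fin d) →ₗ[ℝ] ℝ) : ∃ v, ∀ w, X.omLin x v w = D w := by
  have hinj : Function.Injective (X.omLin x) := by
    refine (injective_iff_map_eq_zero _).2 fun v hv => X.nondegenerate x v fun w => ?_
    exact DFunLike.congr_fun hv w
  have hsurj := (LinearMap.injective_iff_surjective_of_finrank_eq_finrank
    (Subspace.dual_finrank_eq (K := ℝ) (V := EuclideanSpace ℝ (Fin d))).symm).1 hinj
  obtain ⟨v, hv⟩ := hsurj D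
  exact ⟨v, fun w => by rw [hv]⟩

end Forms

section Splitting

variable {d : ℕ} {M : Type*} [TopologicalSpace M] [T2Space M] [ChartedSpace (EuclideanQuadrant d) M]
  [IsManifold (QI d) ∞ M]

/-- Globally defined boundary coordinates at a point. -/
theorem IsFaceSystem.exists_functions {m : ℕ} {H : Fin m → Set M} (hH : IsFaceSystem d H) (x : M) :
    ∃ (g : Fin m → M → ℝ) (Y : Fin m → EuclideanSpace ℝ (Fin d)), ∀ i, x ∈ H i →
      ContMDiff (QI d) 𝓘(ℝ, ℝ) ∞ (g i) ∧ (∀ y ∈ H i, g i y = 0) ∧ (∀ y, 0 ≤ g i y) ∧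
      ∀ j, x ∈ H j → (dfun (g i) : OneForm d M) x (Y j) = if i = j then 1 else 0 := by
  classical
  obtain ⟨e, he, hx, c, hc, h1, -, -⟩ := hH.chart x
  -- The boundary coordinates of the chart are cut off by a bump function, since `tangentTo` tests
  -- only with globally smooth functions. The Y are dual to their differentials at x; indices of
  -- faces missing x get the value 0.
  obtain ⟨ψ, -, hψ⟩ := (SmoothBumpFunction.nhds_basis_tsupport (I := QI d) x).mem_iff.1
    (e.open_source.mem_nhds hx)
  have hd := maximalAtlas_mdifferentiable he
  have hco : ∀ a : Fin d, ContMDiffOn (QI d) 𝓘(ℝ, ℝ) ∞ (fun y => (e y).1 a) e.source := fun a => by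
    have h2 : ContMDiffOn (QI d) 𝓘(ℝ, EuclideanSpace ℝ (Fin d)) ∞ (fun y => QI d (e y)) e.source :=
      (QI d).contMDiff.comp_contMDiffOn (contMDiffOn_of_mem_maximalAtlas he)
    exact ((EuclideanSpace.proj a : EuclideanSpace ℝ (Fin d) →L[ℝ] ℝ).contMDiff (n := ∞)).comp_contMDiffOn h2
  have hY : ∀ j : Fin m, ∃ Y : EuclideanSpace ℝ (Fin d), ∀ hj : x ∈ H j,
      mfderiv (QI d) (QI d) e x Y = (EuclideanSpace.single (c ⟨j, hj⟩) (1 : ℝ)) := fun j => by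
    by_cases hj : x ∈ H j
    · obtain ⟨Y, hY⟩ := hd.mfderiv_surjective hx (EuclideanSpace.single (c ⟨j, hj⟩) (1 : ℝ))
      exact ⟨Y, fun _ => hY⟩
    · exact ⟨0, fun h => absurd h hj⟩
  choose Y hY using hY
  refine ⟨fun i y => if h : x ∈ H i then ψ y * (e y).1 (c ⟨i, h⟩) else 0, Y, fun i hi => ?_⟩
  simp only [hi, dif_pos]
  refine ⟨?_, ?_, ?_, ?_⟩
  · refine contMDiff_of_tsupport fun y hy => ?_
    have hys : y ∈ e.source := hψ (closure_mono (Function.support_mul_subset_left _ _) hy)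
    exact ψ.contMDiff.contMDiffAt.mul ((hco _).contMDiffAt (e.open_source.mem_nhds hys))
  · intro y hy
    by_cases hys : y ∈ e.source
    · rw [(h1 ⟨i, hi⟩ y hys).1 hy, mul_zero]
    · rw [image_eq_zero_of_notMem_tsupport fun h => hys (hψ h), zero_mul]
  · intro y
    exact mul_nonneg ψ.nonneg ((e y).2 _)
  · intro j hj
    have hev : (fun y => ψ y * (e y).1 (c ⟨i, hi⟩)) =ᶠ[𝓝 x] fun y => (e y).1 (c ⟨i, hi⟩) := by
      filter_upwards [ψ.eventuallyEq_one] with y hy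
      rw [hy]; simp
    have hm : HasMFDerivAt (QI d) 𝓘(ℝ, ℝ) (fun y => (e y).1 (c ⟨i, hi⟩)) x
        ((EuclideanSpace.proj (c ⟨i, hi⟩) : EuclideanSpace ℝ (Fin d) →L[ℝ] ℝ).comp
          (mfderiv (QI d) (QI d) e x)) := by
      have a1 : HasMFDerivAt (QI d) 𝓘(ℝ, EuclideanSpace ℝ (Fin d)) (fun y => QI d (e y)) x
          (mfderiv (QI d) (QI d) e x) := by
        have := (QI d).hasMFDerivAt.comp x (hd.mdifferentiableAt hx).hasMFDerivAt
        exact this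
      exact (EuclideanSpace.proj (c ⟨i, hi⟩) : EuclideanSpace ℝ (Fin d) →L[ℝ] ℝ).hasMFDerivAt.comp x a1
    rw [dfun, hev.mfderiv_eq, hm.mfderiv]
    have : (EuclideanSpace.proj (c ⟨i, hi⟩) : EuclideanSpace ℝ (Fin d) →L[ℝ] ℝ)
        (mfderiv (QI d) (QI d) e x (Y j)) = if i = j then 1 else 0 := by
      rw [hY j hj]
      by_cases hij : i = j
      · subst hij; simp
      · have : c ⟨i, hi⟩ ≠ c ⟨j, hj⟩ := fun h => hij (congrArg Subtype.val (hc h))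
        simp [hij, this]
    exact this

/-- The differentials of the functions `R_i` of a splitting do not vanish. -/
theorem SplittingChart.dfun_R_ne_zero {X : LiouvilleSector d M} (C : SplittingChart X) (i : C.A)
    {x : M} (hx : x ∈ C.U) : (dfun (C.R i) : OneForm d M) x ≠ 0 := by
  classical
  let E := EuclideanSpace ℝ (Fin d)
  let dp : M → E →L[ℝ] E := fun y => mfderiv (QI d) (QI d) C.proj y
  let dR : C.A → M → E →L[ℝ] ℝ := fun j y => (dfun (C.R j) : OneForm d M) y
  let dI : C.A → M → E →L[ℝ] ℝ := fun j y => (dfun (C.Im j) : OneForm d M) y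
  have hnhds : ∀ y ∈ C.U, C.U ∈ 𝓝 y := fun y hy => C.isOpen.mem_nhds hy
  have hpd : ∀ y ∈ C.U, MDifferentiableAt (QI d) (QI d) C.proj y := fun y hy =>
    (C.smooth_proj.contMDiffAt (hnhds y hy)).mdifferentiableAt (by simp)
  have hRd : ∀ j, ∀ y ∈ C.U, MDifferentiableAt (QI d) 𝓘(ℝ, ℝ) (C.R j) y := fun j y hy =>
    ((C.smooth_R j).contMDiffAt (hnhds y hy)).mdifferentiableAt (by simp)
  have hId : ∀ j, ∀ y ∈ C.U, MDifferentiableAt (QI d) 𝓘(ℝ, ℝ) (C.Im j) y := fun j y hy =>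
    ((C.smooth_Im j).contMDiffAt (hnhds y hy)).mdifferentiableAt (by simp)
  have hU : ∀ y ∈ C.U, C.proj y ∈ C.U := fun y hy => (C.proj_mem y hy).1
  have hsymp : ∀ y ∈ C.U, ∀ v w : E, X.omLin y v w = X.omLin (C.proj y) (dp y v) (dp y w)
      + ∑ j : C.A, (dR j y v * dI j y w - dR j y w * dI j y v) := fun y hy v w =>
    C.symplectic y hy v w
  have hpp : ∀ y ∈ C.U, C.proj (C.proj y) = C.proj y := fun y hy =>
    C.proj_self _ (hU y hy) (C.proj_mem y hy).2
  have hcp : ∀ y ∈ C.U, ∀ v, dp (C.proj y) (dp y v) = dp y v := fun y hy v => by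
    have h1 := mfderiv_comp y (hpd _ (hU y hy)) (hpd y hy)
    have h2 : C.proj ∘ C.proj =ᶠ[𝓝 y] C.proj := by
      filter_upwards [hnhds y hy] with z hz using hpp z hz
    have h3 : mfderiv (QI d) (QI d) (C.proj ∘ C.proj) y = (dp y : E →L[ℝ] E) := h2.mfderiv_eq
    exact (DFunLike.congr_fun (h1.symm.trans h3) v : _)
  have hcf : ∀ g : M → ℝ, ∀ y ∈ C.U, MDifferentiableAt (QI d) 𝓘(ℝ, ℝ) g (C.proj y) →
      (∀ z ∈ C.U, g (C.proj z) = 0) → ∀ v : E,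
      ((dfun g : OneForm d M) (C.proj y) : E →L[ℝ] ℝ) (dp y v) = 0 := fun g y hy hg h0 v => by
    have h1 := mfderiv_comp y hg (hpd y hy)
    have h2 : g ∘ C.proj =ᶠ[𝓝 y] fun _ => 0 := by
      filter_upwards [hnhds y hy] with z hz using h0 z hz
    have h3 : mfderiv (QI d) 𝓘(ℝ, ℝ) (g ∘ C.proj) y = (0 : E →L[ℝ] ℝ) := by
      rw [h2.mfderiv_eq, mfderiv_const]; rfl
    exact (DFunLike.congr_fun (h1.symm.trans h3) v : _)
  -- The comparison point on the leaf lies on every face in `A`, so boundary coordinates g_j exist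
  -- there. V j is the vector dual to D j = dg_j under ω.
  set f := C.proj x with hf
  have hfU : f ∈ C.U := hU x hx
  have hff : C.proj f = f := hpp x hx
  have hfH : ∀ j : C.A, f ∈ X.H j.1 := fun j => (C.R_eq_zero j f hfU).1 ((C.proj_mem x hx).2 j).1
  have hpH : ∀ j : C.A, ∀ z ∈ C.U, C.proj z ∈ X.H j.1 := fun j z hz =>
    (C.R_eq_zero j _ (hU z hz)).1 ((C.proj_mem z hz).2 j).1
  obtain ⟨g, Y, hg⟩ := X.faces.exists_functions f
  let D : C.A → M → E →L[ℝ] ℝ := fun j y => (dfun (g j.1) : OneForm d M) y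
  choose V hV using fun j : C.A => X.exists_dual f (D j f : E →ₗ[ℝ] ℝ)
  have hRP : ∀ j v, dR j f (dp f v) = 0 := fun j v => by
    have h := hcf (C.R j) f hfU (by rw [hff]; exact hRd j f hfU)
      (fun z hz => ((C.proj_mem z hz).2 j).1) v
    change dR j (C.proj f) (dp f v) = 0 at h
    rwa [hff] at h
  have hIP : ∀ j v, dI j f (dp f v) = 0 := fun j v => by
    have h := hcf (C.Im j) f hfU (by rw [hff]; exact hId j f hfU)
      (fun z hz => ((C.proj_mem z hz).2 j).2) v
    change dI j (C.proj f) (dp f v) = 0 at h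
    rwa [hff] at h
  have hDP : ∀ j v, D j f (dp f v) = 0 := fun j v => by
    have h := hcf (g j.1) f hfU
      ((hg _ (hfH j)).1.contMDiffAt.mdifferentiableAt (by simp))
      (fun z hz => (hg _ (hfH j)).2.1 _ (hpH j z hz)) v
    change D j (C.proj f) (dp f v) = 0 at h
    rwa [hff] at h
  have hPP : ∀ v, dp f (dp f v) = dp f v := fun v => by
    have h := hcp f hfU v
    rwa [hff] at h
  have hsf : ∀ v w : E, X.omLin f v w = X.omLin f (dp f v) (dp f w)
      + ∑ j : C.A, (dR j f v * dI j f w - dR j f w * dI j f v) := fun v w => by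
    have h := hsymp f hfU v w
    rwa [hff] at h
  -- With p the projection, ω(dp V, w) = ω(dp V, dp w) = ω(V, dp w) = D(dp w) = 0, the first two
  -- equalities by the splitting formula at f, the last because p maps into the face.
  have hPV : ∀ j, dp f (V j) = 0 := fun j => by
    have hnd : ∀ v : E, (∀ w : E, X.omLin f v w = 0) → v = 0 := X.nondegenerate f
    refine hnd _ fun w => ?_
    have h1 := hsf (dp f (V j)) w
    have h2 := hsf (V j) (dp f w)
    replace h2 := (hV j (dp f w)).symm.trans h2
    simp only [ContinuousLinearMap.coe_coe, hRP, hIP, hDP, hPP, zero_mul, mul_zero, sub_zero,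
      Finset.sum_const_zero, add_zero] at h1 h2
    rw [h1, ← h2]
  have hVV : ∀ j k, X.omLin f (V j) (V k) = 0 := fun j k => by
    by_cases hjk : j = k
    · subst hjk
      change X.om f (V j) (V j) = 0
      simp [LiouvilleForm.om, extD]
    · have hjk' : k.1 ≠ j.1 := fun h => hjk (Subtype.ext h.symm)
      -- V k is ω-orthogonal to the tangent space of H_k ∩ H_j, as g_k vanishes there. By coisotropy
      -- it is tangent to H_k ∩ H_j, hence annihilated by dg_j.
      have ht := X.coisotropic k.1 j.1 hjk' f ⟨hfH k, hfH j⟩ (V k) fun w hw =>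
        (hV k w).trans (hw _ (hg _ (hfH k)).1 fun y hy => (hg _ (hfH k)).2.1 y hy.1)
      exact (hV j (V k)).trans
        (ht _ (hg _ (hfH j)).1 fun y hy => (hg _ (hfH j)).2.1 y hy.2)
  intro h0
  refine splitting_ne_zero (σ := X.omLin f) (σ' := X.omLin x) (P := dp f) (Q := dp x)
    (D := fun j => (D j f : E →ₗ[ℝ] ℝ)) (R := fun j => (dR j x : E →ₗ[ℝ] ℝ))
    (I := fun j => (dI j x : E →ₗ[ℝ] ℝ)) (X := V) (Y := fun j => Y j.1)
    (fun v hv => X.nondegenerate x v hv) hV ?_ hVV hPV hDP hPP (hcp x hx) (hsymp x hx) i ?_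
  · intro j k
    have := (hg _ (hfH j)).2.2.2 _ (hfH k)
    simp only [Subtype.ext_iff]
    exact this
  · ext1 v
    exact DFunLike.congr_fun h0 v

end Splitting
end Sectorial
end

noncomputable section
namespace Sectorial

/-! ### Points of open faces, and defining functions of the faces. -/

section FacePoints

variable {d : ℕ}

/-- The `a`-th coordinate. -/
abbrev coord (a : Fin d) : EuclideanSpace ℝ (Fin d) →L[ℝ] ℝ := EuclideanSpace.proj a

/-- The `a`-th basis vector. -/
abbrev basisVec (a : Fin d) : EuclideanSpace ℝ (Fin d) := EuclideanSpace.single a 1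

theorem coord_basisVec (a : Fin d) : coord a (basisVec a) = 1 := by simp

/-- The points of the open face `{y_a = 0}` of the quadrant. -/
structure IsFacePoint (a : Fin d) (q : EuclideanSpace ℝ (Fin d)) : Prop where
  zero : q a = 0
  pos : ∀ b, b ≠ a → 0 < q b

theorem IsFacePoint.range_eventuallyEq {a : Fin d} {q : EuclideanSpace ℝ (Fin d)}
    (hq : IsFacePoint a q) : (range (QI d) : Set _) =ᶠ[𝓝 q] halfSpace (coord a) := by
  have : ∀ᶠ y : EuclideanSpace ℝ (Fin d) in 𝓝 q, ∀ b, b ≠ a → 0 < y b := eventually_all.2 fun b => by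
    by_cases hb : b = a
    · simp [hb]
    · filter_upwards [(coord b).continuous.continuousAt.eventually (lt_mem_nhds (hq.pos b hb))]
        with y hy _ using hy
  rw [range_QI]
  filter_upwards [this] with y hy
  refine propext ⟨fun h => h a, fun h b => ?_⟩
  by_cases hb : b = a
  · rw [hb]; exact h
  · exact (hy b hb).le

theorem IsFacePoint.mem_range {a : Fin d} {q : EuclideanSpace ℝ (Fin d)}
    (hq : IsFacePoint a q) : q ∈ range (QI d) := by
  rw [range_QI]
  intro b
  by_cases hb : b = a
  · rw [hb, hq.zero]
  · exact (hq.pos b hb).le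

theorem IsFacePoint.eventually_interior {a : Fin d} {q : EuclideanSpace ℝ (Fin d)}
    (hq : IsFacePoint a q) : ∀ᶠ y in 𝓝 q, 0 < coord a y → y ∈ interior (range (QI d)) := by
  rw [interior_range_QI]
  have : ∀ᶠ y : EuclideanSpace ℝ (Fin d) in 𝓝 q, ∀ b, b ≠ a → 0 < y b := eventually_all.2 fun b => by
    by_cases hb : b = a
    · simp [hb]
    · filter_upwards [(coord b).continuous.continuousAt.eventually (lt_mem_nhds (hq.pos b hb))]
        with y hy _ using hy
  filter_upwards [this] with y hy ha b
  by_cases hb : b = a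
  · rw [hb]; exact ha
  · exact hy b hb

theorem IsFacePoint.notMem_interior {a : Fin d} {q : EuclideanSpace ℝ (Fin d)} (hq : q a = 0) :
    q ∉ interior (range (QI d)) := by
  rw [interior_range_QI]
  intro h
  exact (h a).ne' hq

variable {M : Type*} [TopologicalSpace M] [ChartedSpace (EuclideanQuadrant d) M]

theorem tendsto_extChartAt_symm {x₀ : M} {q : EuclideanSpace ℝ (Fin d)}
    (hq : q ∈ (extChartAt (QI d) x₀).target) :
    Tendsto (extChartAt (QI d) x₀).symm (𝓝 q) (𝓝 ((extChartAt (QI d) x₀).symm q)) :=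
  continuousAt_extChartAt_symm'' hq

theorem eventually_mem_target {x₀ : M} {q : EuclideanSpace ℝ (Fin d)}
    (hqt : q ∈ (extChartAt (QI d) x₀).target) :
    ∀ᶠ y in 𝓝 q, y ∈ range (QI d) → y ∈ (extChartAt (QI d) x₀).target := by
  have := extChartAt_target_mem_nhdsWithin_of_mem (I := QI d) (x := x₀) hqt
  rwa [← eventually_mem_set, eventually_nhdsWithin_iff] at this

variable [IsManifold (QI d) ∞ M]

theorem contDiffWithinAt_comp_extChartAt_symm {n : WithTop ℕ∞} (hn : n ≤ ∞) {f : M → ℝ} {x₀ : M}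
    {y : EuclideanSpace ℝ (Fin d)} (hy : y ∈ (extChartAt (QI d) x₀).target)
    (hf : ContMDiffAt (QI d) 𝓘(ℝ, ℝ) n f ((extChartAt (QI d) x₀).symm y)) :
    ContDiffWithinAt ℝ n (fun η => f ((extChartAt (QI d) x₀).symm η)) (range (QI d)) y := by
  rw [← contMDiffWithinAt_iff_contDiffWithinAt]
  exact hf.comp_contMDiffWithinAt y
    ((contMDiffWithinAt_extChartAt_symm_range (n := ∞) x₀ hy).of_le hn)

theorem fderivWithin_comp_extChartAt_symm {f : M → ℝ} {x₀ : M} {y : EuclideanSpace ℝ (Fin d)}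
    (hy : y ∈ (extChartAt (QI d) x₀).target)
    (hf : MDifferentiableAt (QI d) 𝓘(ℝ, ℝ) f ((extChartAt (QI d) x₀).symm y))
    (v : EuclideanSpace ℝ (Fin d)) :
    fderivWithin ℝ (fun η => f ((extChartAt (QI d) x₀).symm η)) (range (QI d)) y v =
      (dfun f : OneForm d M) ((extChartAt (QI d) x₀).symm y)
        (mfderivWithin 𝓘(ℝ, EuclideanSpace ℝ (Fin d)) (QI d) (extChartAt (QI d) x₀).symm
          (range (QI d)) y v) := by
  have h1 := mdifferentiableWithinAt_extChartAt_symm (I := QI d) hy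
  rw [← mfderivWithin_eq_fderivWithin]
  have hU : UniqueMDiffWithinAt 𝓘(ℝ, EuclideanSpace ℝ (Fin d)) (range (QI d)) y :=
    (QI d).uniqueMDiffOn _ (extChartAt_target_subset_range x₀ hy)
  exact DFunLike.congr_fun (mfderiv_comp_mfderivWithin y hf h1 hU) v

/-- A nonnegative function that vanishes at a face point, in coordinates. -/
theorem fderivWithin_facePoint {g : M → ℝ} {x₀ : M} {a : Fin d} {q : EuclideanSpace ℝ (Fin d)}
    (hqt : q ∈ (extChartAt (QI d) x₀).target) (hq : IsFacePoint a q)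
    (hg : ContMDiffAt (QI d) 𝓘(ℝ, ℝ) ∞ g ((extChartAt (QI d) x₀).symm q))
    (h0 : g ((extChartAt (QI d) x₀).symm q) = 0)
    (hn : ∀ᶠ y in 𝓝 ((extChartAt (QI d) x₀).symm q), 0 ≤ g y) :
    ∃ k : ℝ, 0 ≤ k ∧ (∀ v : EuclideanSpace ℝ (Fin d), (dfun g : OneForm d M) ((extChartAt (QI d) x₀).symm q)
      (mfderivWithin 𝓘(ℝ, EuclideanSpace ℝ (Fin d)) (QI d) (extChartAt (QI d) x₀).symm
          (range (QI d)) q v) = k * v a) := by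
  have h1 := contDiffWithinAt_comp_extChartAt_symm le_rfl hqt hg
  have h2 := (contDiffWithinAt_congr_set hq.range_eventuallyEq).1 h1
  obtain ⟨k, hk, hk'⟩ := fderivWithin_halfSpace_of_nonneg (ℓ := coord a) hq.zero (coord_basisVec a)
    (h2.differentiableWithinAt (by simp)) h0
    (((tendsto_extChartAt_symm hqt).eventually hn).filter_mono nhdsWithin_le_nhds)
  refine ⟨k, hk, fun v => ?_⟩
  refine (fderivWithin_comp_extChartAt_symm hqt (hg.mdifferentiableAt (by simp)) v).symm.trans ?_
  rw [fderivWithin_congr_set hq.range_eventuallyEq, hk']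
  simp

/-- A face point lies on exactly one face. -/
theorem IsFaceSystem.eq_of_facePoint [T2Space M] {m : ℕ} {H : Fin m → Set M}
    (hH : IsFaceSystem d H) {x₀ : M} {a : Fin d}
    {q : EuclideanSpace ℝ (Fin d)} (hqt : q ∈ (extChartAt (QI d) x₀).target) (hq : IsFacePoint a q)
    {i j : Fin m} (hi : (extChartAt (QI d) x₀).symm q ∈ H i)
    (hj : (extChartAt (QI d) x₀).symm q ∈ H j) : i = j := by
  obtain ⟨g, Y, hg⟩ := hH.exists_functions ((extChartAt (QI d) x₀).symm q)
  have hsurj : ∀ Z : EuclideanSpace ℝ (Fin d), ∃ v : EuclideanSpace ℝ (Fin d),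
      mfderivWithin 𝓘(ℝ, EuclideanSpace ℝ (Fin d)) (QI d) (extChartAt (QI d) x₀).symm
          (range (QI d)) q v = Z := fun Z =>
    (isInvertible_mfderivWithin_extChartAt_symm hqt).surjective Z
  choose V hV using hsurj
  -- At a point of an open face every dg_i is a multiple of the one functional v ↦ v a, whereas the
  -- dual vectors Y make the differentials for distinct faces independent.
  have key : ∀ i, (extChartAt (QI d) x₀).symm q ∈ H i → ∃ k : ℝ, ∀ Z : EuclideanSpace ℝ (Fin d),
      (dfun (g i) : OneForm d M) ((extChartAt (QI d) x₀).symm q) Z = k * V Z a := fun i hi => by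
    obtain ⟨k, -, hk⟩ := fderivWithin_facePoint hqt hq (hg i hi).1.contMDiffAt ((hg i hi).2.1 _ hi)
      (Eventually.of_forall (hg i hi).2.2.1)
    refine ⟨k, fun Z => ?_⟩
    have := hk (V Z)
    rw [hV Z] at this
    exact this
  obtain ⟨k, hk⟩ := key i hi
  obtain ⟨l, hl⟩ := key j hj
  by_contra hij
  have e1 := (hk (Y i)).symm.trans ((hg i hi).2.2.2 i hi)
  have e2 := (hl (Y i)).symm.trans ((hg j hj).2.2.2 i hi)
  have e3 := (hl (Y j)).symm.trans ((hg j hj).2.2.2 j hj)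
  rw [if_pos rfl] at e1 e3
  rw [if_neg (Ne.symm hij)] at e2
  rcases mul_eq_zero.1 e2 with h | h
  · rw [h, zero_mul] at e3; exact zero_ne_one e3
  · rw [h, mul_zero] at e1; exact zero_ne_one e1

variable {X : LiouvilleSector d M} (P : SmoothingProfile X)

/-- In coordinates, the functions `φ₂(φ(R), e^{-s})` are defining functions of the faces. -/
theorem SmoothingProfile.isDefiningFunction [T2Space M] (c : Fin P.n) {x₀ : M} {a : Fin d}
    {q : EuclideanSpace ℝ (Fin d)} (hqt : q ∈ (extChartAt (QI d) x₀).target) (hq : IsFacePoint a q)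
    (hU : (extChartAt (QI d) x₀).symm q ∈ (P.chart c).U) :
    ∃ κ, IsDefiningFunction (coord a) q κ
      (fun y => P.cornerEndExp c ((extChartAt (QI d) x₀).symm y)) := by
  set ψ := extChartAt (QI d) x₀ with hψ
  set C := P.chart c with hC
  have hnU : ∀ᶠ y in 𝓝 q, ψ.symm y ∈ C.U :=
    (tendsto_extChartAt_symm hqt).eventually (C.isOpen.mem_nhds hU)
  -- A point of an open face lies on exactly one H_h, and h belongs to `A`; so R_h vanishes there
  -- and all other R_j are positive.
  obtain ⟨h, hh⟩ := (X.faces.mem_boundary_iff (ψ.symm q)).1 fun hi => by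
    rw [mem_interior_iff_extChartAt (x₀ := x₀) (ψ.map_target hqt)] at hi
    rw [ψ.right_inv hqt] at hi
    exact IsFacePoint.notMem_interior hq.zero hi
  have hA : h ∈ C.A := by
    by_contra hA
    exact (C.disjoint h hA).le_bot ⟨hU, hh⟩
  set i : C.A := ⟨h, hA⟩ with hi
  have hRi : C.R i (ψ.symm q) = 0 := (C.R_eq_zero i _ hU).2 hh
  have hRj : ∀ j, j ≠ i → 0 < C.R j (ψ.symm q) := fun j hj => C.R_pos hU fun hjH =>
    hj (Subtype.ext (X.faces.eq_of_facePoint hqt hq hjH hh))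
  have hRc : ∀ j, ContMDiffAt (QI d) 𝓘(ℝ, ℝ) ∞ (C.R j) (ψ.symm q) := fun j =>
    (C.smooth_R j).contMDiffAt (C.isOpen.mem_nhds hU)
  have hset := hq.range_eventuallyEq
  have hqH : q ∈ halfSpace (coord a) := hq.zero.ge
  have hin : ∀ {n : WithTop ℕ∞} (_ : n ≤ ∞) {f : M → ℝ},
      ContMDiffAt (QI d) 𝓘(ℝ, ℝ) n f (ψ.symm q) →
      ContDiffWithinAt ℝ n (fun η => f (ψ.symm η)) (halfSpace (coord a)) q := fun hn f hf =>
    (contDiffWithinAt_congr_set hset).1 (contDiffWithinAt_comp_extChartAt_symm hn hqt hf)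
  -- the function `R`
  have hR : ContDiffWithinAt ℝ ∞ (fun y j => C.R j (ψ.symm y)) (halfSpace (coord a)) q :=
    contDiffWithinAt_pi.2 fun j => hin le_rfl (hRc j)
  obtain ⟨k, hk, hk'⟩ := fderivWithin_facePoint hqt hq (hRc i) hRi (by
    filter_upwards [C.isOpen.mem_nhds hU] with y hy using C.R_nonneg i y hy)
  have hRder : fderivWithin ℝ (fun y => C.R i (ψ.symm y)) (halfSpace (coord a)) q = k • coord a := by
    ext v
    rw [← fderivWithin_congr_set hset]
    exact (fderivWithin_comp_extChartAt_symm hqt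
      ((hRc i).mdifferentiableAt (by simp)) v).trans (hk' v)
  have hkpos : 0 < k := by
    refine lt_of_le_of_ne hk fun e => C.dfun_R_ne_zero i hU ?_
    ext Z
    obtain ⟨v, hv⟩ := (isInvertible_mfderivWithin_extChartAt_symm hqt).surjective Z
    have := hk' v
    rw [hv, ← e, zero_mul] at this
    exact this
  -- the function `φ(R)`
  obtain ⟨hφc, k₁, hk₁, hφd⟩ := (P.isCornerSmoothing c).fderivWithin_eq (i := i)
    (x := fun j => C.R j (ψ.symm q)) hRi hRj
  have hmaps : ∀ᶠ y in 𝓝[halfSpace (coord a)] q,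
      (fun j => C.R j (ψ.symm y)) ∈ {r : C.A → ℝ | ∀ j, 0 ≤ r j} := by
    filter_upwards [mem_nhdsWithin_of_mem_nhds hnU] with y hy j using C.R_nonneg j _ hy
  have hG : ContDiffWithinAt ℝ ∞ (fun y => P.φ c fun j => C.R j (ψ.symm y))
      (halfSpace (coord a)) q :=
    hφc.comp_of_preimage_mem_nhdsWithin q hR hmaps
  have hGd : HasFDerivWithinAt (fun y => P.φ c fun j => C.R j (ψ.symm y))
      ((k₁ * k) • coord a) (halfSpace (coord a)) q := by
    have h1 : HasFDerivWithinAt (fun y j => C.R j (ψ.symm y)) _ (halfSpace (coord a)) q :=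
      (hR.differentiableWithinAt (by simp)).hasFDerivWithinAt
    have h2 := (hφc.differentiableWithinAt (by simp)).hasFDerivWithinAt
    have h3 := HasFDerivWithinAt.comp_of_tendsto q h2 h1
      (tendsto_nhdsWithin_iff.2 ⟨hR.continuousWithinAt, hmaps⟩)
    refine h3.congr_fderiv ?_
    have hU' := (uniqueDiffOn_halfSpace (coord_basisVec a)).uniqueDiffWithinAt hqH
    have h4 : ∀ v, fderivWithin ℝ (fun y j => C.R j (ψ.symm y)) (halfSpace (coord a)) q v i =
        k * v a := fun v => by
      have := (hasFDerivWithinAt_pi'.1 h1 i).fderivWithin hU'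
      rw [hRder] at this
      have := DFunLike.congr_fun this v
      simpa using this.symm
    ext v
    rw [hφd]
    simp [h4, mul_assoc]
  have hG0 : P.φ c (fun j => C.R j (ψ.symm q)) = 0 :=
    ((P.isCornerSmoothing c).eq_zero _ fun j => C.R_nonneg j _ hU).2 ⟨i, hRi⟩
  -- the function `φ₂(φ(R), e^{-s})`
  have hr : ContDiffWithinAt ℝ ∞ (fun y => Real.exp (-P.rad (ψ.symm y))) (halfSpace (coord a)) q :=
    (hin le_rfl P.isRadial.smooth.contMDiffAt).neg.exp
  have hv : ContDiffWithinAt ℝ ∞ (fun y => ![P.φ c fun j => C.R j (ψ.symm y),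
      Real.exp (-P.rad (ψ.symm y))]) (halfSpace (coord a)) q := by
    refine contDiffWithinAt_pi.2 fun j => ?_
    fin_cases j
    · exact hG
    · exact hr
  obtain ⟨hφ₂c, k₂, hk₂, hφ₂d⟩ := (P.isCornerSmoothing₂ c).fderivWithin_eq (i := 0)
    (x := ![P.φ c fun j => C.R j (ψ.symm q), Real.exp (-P.rad (ψ.symm q))]) hG0 (fun j hj => by
      fin_cases j
      · exact absurd rfl hj
      · exact Real.exp_pos _)
  have hmaps₂ : ∀ᶠ y in 𝓝[halfSpace (coord a)] q,
      ![P.φ c fun j => C.R j (ψ.symm y), Real.exp (-P.rad (ψ.symm y))] ∈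
        {r : Fin 2 → ℝ | ∀ j, 0 ≤ r j} := by
    filter_upwards [hmaps] with y hy j
    fin_cases j
    · exact (P.isCornerSmoothing c).nonneg _ hy
    · exact (Real.exp_pos _).le
  -- The chain rule: k₂ is the derivative of φ₂ in its first variable, k₁ that of φ in R_h, and k
  -- that of R_h in the coordinate y_a. The first two are positive by regularity of corner
  -- smoothings, the last since dR_h ≠ 0.
  refine ⟨k₂ * (k₁ * k), ?_, by positivity, ?_, ?_⟩
  · exact (hφ₂c.comp_of_preimage_mem_nhdsWithin q hv hmaps₂).of_le two_le_infty
  · have h1 := (hv.differentiableWithinAt (by simp)).hasFDerivWithinAt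
    have h2 := (hφ₂c.differentiableWithinAt (by simp)).hasFDerivWithinAt
    have h3 := HasFDerivWithinAt.comp_of_tendsto q h2 h1
      (tendsto_nhdsWithin_iff.2 ⟨hv.continuousWithinAt, hmaps₂⟩)
    have hU' := (uniqueDiffOn_halfSpace (coord_basisVec a)).uniqueDiffWithinAt hqH
    refine (h3.fderivWithin hU').trans ?_
    have h4 := ((hasFDerivWithinAt_pi'.1 h1 0).fderivWithin hU').symm.trans (hGd.fderivWithin hU')
    ext v
    have h5 := DFunLike.congr_fun h4 v
    rw [hφ₂d]
    simp at h5
    simp [h5, mul_assoc]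
  · filter_upwards [hnU, hset.mem_iff, eventually_mem_target hqt] with y hy hy2 hyt hya
    have hyT := hyt (hy2.2 (show 0 ≤ coord a y from hya.ge))
    obtain ⟨h', hh'⟩ := (X.faces.mem_boundary_iff (ψ.symm y)).1 fun hi => by
      rw [mem_interior_iff_extChartAt (x₀ := x₀) (ψ.map_target hyT), ← hψ, ψ.right_inv hyT] at hi
      exact IsFacePoint.notMem_interior hya hi
    have hA' : h' ∈ C.A := by
      by_contra hA'
      exact (C.disjoint h' hA').le_bot ⟨hy, hh'⟩
    have hR0 : C.R ⟨h', hA'⟩ (ψ.symm y) = 0 := (C.R_eq_zero _ _ hy).2 hh'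
    have hφ0 : P.φ c (fun j => C.R j (ψ.symm y)) = 0 :=
      ((P.isCornerSmoothing c).eq_zero _ fun j => C.R_nonneg j _ hy).2 ⟨_, hR0⟩
    refine ((P.isCornerSmoothing₂ c).eq_zero _ fun j => ?_).2 ⟨0, hφ0⟩
    fin_cases j
    · exact (P.isCornerSmoothing c).nonneg _ fun j => C.R_nonneg j _ hy
    · exact (Real.exp_pos _).le

end FacePoints
end Sectorial
end

noncomputable section
namespace Sectorial

/-! ### Complex tangencies and the sign of the Levi form at the boundary. -/

section ComplexProjection

variable {E : Type*} [NormedAddCommGroup E] [NormedSpace ℝ E]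

/-- A projection to the `J`-complex part of the kernel of `ℓ`. -/
def complexProj (ℓ : E →L[ℝ] ℝ) (e : E) (J : E →L[ℝ] E) (v : E) : E :=
  v - (ℓ v * (1 + ℓ (J e) ^ 2)⁻¹) • (e + ℓ (J e) • J e)
    - (ℓ (J v) * (1 + ℓ (J e) ^ 2)⁻¹) • (ℓ (J e) • e - J e)

variable {ℓ : E →L[ℝ] ℝ} {e : E} {J : E →L[ℝ] E}

/-- With μ = ℓ(Je) and J² = -1, the pair (ℓ, ℓ ∘ J) equals (1 + μ², 0) on e + μJe and (0, 1 + μ²) on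
μe - Je. The two corrections thus remove ℓ(v) and ℓ(Jv) independently. -/
theorem map_complexProj (he : ℓ e = 1) (v : E) : ℓ (complexProj ℓ e J v) = 0 := by
  have : (1 + ℓ (J e) ^ 2) ≠ 0 := by positivity
  simp only [complexProj, map_sub, map_smul, map_add, smul_eq_mul, he]
  field_simp
  ring

theorem map_apply_complexProj (he : ℓ e = 1) (hJ : ∀ v, J (J v) = -v) (v : E) :
    ℓ (J (complexProj ℓ e J v)) = 0 := by
  have : (1 + ℓ (J e) ^ 2) ≠ 0 := by positivity
  simp only [complexProj, map_sub, map_smul, map_add, smul_eq_mul, he, hJ, map_neg]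
  field_simp
  ring

theorem complexProj_of_eq_zero {v : E} (h1 : ℓ v = 0) (h2 : ℓ (J v) = 0) :
    complexProj ℓ e J v = v := by
  simp [complexProj, h1, h2]

theorem contDiff_complexProj (ℓ : E →L[ℝ] ℝ) (e : E) {n : WithTop ℕ∞} :
    ContDiff ℝ n fun p : (E →L[ℝ] E) × E => complexProj ℓ e p.1 p.2 := by
  have hJe : ContDiff ℝ n fun p : (E →L[ℝ] E) × E => p.1 e := contDiff_fst.clm_apply contDiff_const
  have hμ : ContDiff ℝ n fun p : (E →L[ℝ] E) × E => ℓ (p.1 e) := ℓ.contDiff.comp hJe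
  have hv : ContDiff ℝ n fun p : (E →L[ℝ] E) × E => ℓ p.2 := ℓ.contDiff.comp contDiff_snd
  have hJv : ContDiff ℝ n fun p : (E →L[ℝ] E) × E => ℓ (p.1 p.2) :=
    ℓ.contDiff.comp (contDiff_fst.clm_apply contDiff_snd)
  have hi : ContDiff ℝ n fun p : (E →L[ℝ] E) × E => (1 + ℓ (p.1 e) ^ 2)⁻¹ :=
    (contDiff_const.add (hμ.pow 2)).inv fun p => by positivity
  exact (contDiff_snd.sub ((hv.mul hi).smul (contDiff_const.add (hμ.smul hJe)))).sub
    ((hJv.mul hi).smul ((hμ.smul contDiff_const).sub hJe))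

theorem tendsto_complexProj {α : Type*} {l : Filter α} {A : α → E →L[ℝ] E} {A₀ : E →L[ℝ] E}
    (h : Tendsto A l (𝓝 A₀)) (ℓ : E →L[ℝ] ℝ) (e v : E) :
    Tendsto (fun t => complexProj ℓ e (A t) v) l (𝓝 (complexProj ℓ e A₀ v)) := by
  have hc : Continuous fun B : E →L[ℝ] E => complexProj ℓ e B v :=
    (contDiff_complexProj ℓ e (n := 0)).continuous.comp (continuous_id.prodMk continuous_const)
  exact (hc.tendsto A₀).comp h

end ComplexProjection

variable {d : ℕ} {M : Type*} [TopologicalSpace M] [ChartedSpace (EuclideanQuadrant d) M]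

theorem EndField.IsSmooth.contDiffWithinAt {J : EndField d M} (hJ : J.IsSmooth) {x₀ : M}
    {q : EuclideanSpace ℝ (Fin d)} (hqt : q ∈ (extChartAt (QI d) x₀).target) :
    ContDiffWithinAt ℝ ∞ (J.inChart x₀) (range (QI d)) q :=
  (hJ x₀ q hqt).mono_of_mem_nhdsWithin (extChartAt_target_mem_nhdsWithin_of_mem hqt)

variable [IsManifold (QI d) ∞ M]

theorem uniqueDiffOn_range_QI : UniqueDiffOn ℝ (range (QI d)) := (QI d).uniqueDiffOn

/-- At the boundary, the Levi form of a sectorial almost complex structure is nonpositive. -/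
theorem IsSectorial.leviVec_nonpos_of_facePoint [T2Space M] {X : LiouvilleSector d M}
    {P : SmoothingProfile X} {J : EndField d M} (hJ : IsSectorial P J) {x₀ : M} {a : Fin d}
    {q : EuclideanSpace ℝ (Fin d)} (hqt : q ∈ (extChartAt (QI d) x₀).target) (hq : IsFacePoint a q)
    (v : EuclideanSpace ℝ (Fin d)) :
    coord a (leviVec (J.inChart x₀) (range (QI d)) q
      (complexProj (coord a) (basisVec a) (J.inChart x₀ q) v)) ≤ 0 := by
  classical
  set ψ := extChartAt (QI d) x₀ with hψ
  set Ĵ := J.inChart x₀ with hĴ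
  set S : Set (EuclideanSpace ℝ (Fin d)) := range (QI d) with hS
  have hx : ψ.symm q ∉ (QI d).interior M := fun hi => by
    rw [mem_interior_iff_extChartAt (x₀ := x₀) (ψ.map_target hqt), ← hψ, ψ.right_inv hqt] at hi
    exact IsFacePoint.notMem_interior hq.zero hi
  have hψc := tendsto_extChartAt_symm hqt
  have hc : ∀ f : M → ℝ, ψ.symm q ∉ tsupport f → ∀ᶠ y in 𝓝 q, f (ψ.symm y) = 0 := fun f hf => by
    filter_upwards [hψc.eventually ((isClosed_tsupport f).isOpen_compl.mem_nhds hf)] with y hy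
    exact image_eq_zero_of_notMem_tsupport hy
  have hχ₀ : ψ.symm q ∉ tsupport P.χ₀ := fun h => hx (P.support_χ₀ h)
  -- Only charts whose cut-off is supported at the boundary point matter near q, and χ₀ vanishes
  -- there. So the end-profile function has the form -∑ χ_c log ρ_c on the open side of the face.
  set s : Finset (Fin P.n) := Finset.univ.filter fun c => ψ.symm q ∈ tsupport (P.χ c) with hs
  have hmem : ∀ c, c ∈ s ↔ ψ.symm q ∈ tsupport (P.χ c) := fun c => by simp [hs]
  have hdef : ∀ c, ∃ κ, c ∈ s → IsDefiningFunction (coord a) q κ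
      (fun y => P.cornerEndExp c (ψ.symm y)) := fun c => by
    by_cases hcs : c ∈ s
    · obtain ⟨κ, hκ⟩ := P.isDefiningFunction c hqt hq (P.support_χ c ((hmem c).1 hcs))
      exact ⟨κ, fun _ => hκ⟩
    · exact ⟨0, fun h => absurd h hcs⟩
  choose κ hκ using hdef
  have hint : ∀ᶠ y in 𝓝 q, 0 < coord a y → y ∈ interior S ∧ y ∈ ψ.target ∧
      ψ.symm y ∈ (QI d).interior M := by
    filter_upwards [hq.eventually_interior, eventually_mem_target hqt] with y hy hy' hya
    have h1 := hy hya
    have h2 := hy' (interior_subset h1)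
    refine ⟨h1, h2, ?_⟩
    rw [mem_interior_iff_extChartAt (x₀ := x₀) (ψ.map_target h2), ← hψ, ψ.right_inv h2]
    exact h1
  obtain ⟨K, hK, hKi, hpsc⟩ := hJ.pseudoconvex
  -- The exceptional compact set lies in the interior, so pseudoconvexity holds arbitrarily close to
  -- every boundary point.
  have hKn : ∀ᶠ y in 𝓝 q, ψ.symm y ∉ K :=
    hψc.eventually (hK.isClosed.isOpen_compl.mem_nhds fun h => hx (hKi h))
  have hray : Tendsto (fun t : ℝ => q + t • basisVec a) (𝓝[>] 0) (𝓝 q) :=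
    tendsto_nhds_of_tendsto_nhdsWithin (tendsto_ray (ℓ := coord a) hq.zero (coord_basisVec a))
  have hpos : ∀ᶠ t : ℝ in 𝓝[>] 0, 0 < coord a (q + t • basisVec a) :=
    eventually_nhdsWithin_of_forall fun t ht => ray_pos hq.zero (coord_basisVec a) ht
  have hrayS : Tendsto (fun t : ℝ => q + t • basisVec a) (𝓝[>] 0) (𝓝[S] q) := by
    refine tendsto_nhdsWithin_iff.2 ⟨hray, ?_⟩
    filter_upwards [hray.eventually hint, hpos] with t ht ht0 using interior_subset (ht ht0).1
  have hJc := hJ.smooth.contDiffWithinAt hqt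
  have hJq : Tendsto (fun t : ℝ => Ĵ (q + t • basisVec a)) (𝓝[>] 0) (𝓝 (Ĵ q)) :=
    hJc.continuousWithinAt.tendsto.comp hrayS
  have hDJ : Tendsto (fun t : ℝ => fderivWithin ℝ Ĵ S (q + t • basisVec a)) (𝓝[>] 0)
      (𝓝 (fderivWithin ℝ Ĵ S q)) :=
    (hJc.fderivWithin_right (m := 0) uniqueDiffOn_range_QI (by simp)
      hq.mem_range).continuousWithinAt.tendsto.comp hrayS
  -- The projection is redone at every point of the ray: both the vector and its image under J must
  -- lie in the kernel of the coordinate at each t, not merely in the limit.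
  have hvt : Tendsto (fun t : ℝ => complexProj (coord a) (basisVec a)
      (Ĵ (q + t • basisVec a)) v) (𝓝[>] 0)
      (𝓝 (complexProj (coord a) (basisVec a) (Ĵ q) v)) :=
    tendsto_complexProj hJq _ _ v
  have hwt := tendsto_clm_apply hJq hvt
  have htgt : ∀ᶠ t : ℝ in 𝓝[>] 0, q + t • basisVec a ∈ ψ.target := by
    filter_upwards [hray.eventually hint, hpos] with t ht ht0 using (ht ht0).2.1
  refine leviVec_nonpos (s := s) (κ := κ) (ρ := fun c y => P.cornerEndExp c (ψ.symm y))
    (χ := fun c y => P.χ c (ψ.symm y)) (f := fun y => P.endProfile (ψ.symm y)) (J := Ĵ) (S := S)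
    (w₀ := Ĵ q (complexProj (coord a) (basisVec a) (Ĵ q) v))
    (v₀ := complexProj (coord a) (basisVec a) (Ĵ q) v)
    hq.zero (coord_basisVec a) hκ ?_ ?_ ?_ hvt ?_ hwt ?_ ?_ ?_ ?_
  · intro c _
    exact (contDiffWithinAt_congr_set hq.range_eventuallyEq).1
      (contDiffWithinAt_comp_extChartAt_symm two_le_infty hqt
        ((P.smooth_χ c).contMDiffAt.of_le two_le_infty))
  · have h1 := P.sum_eq_one (ψ.symm q)
    rw [image_eq_zero_of_notMem_tsupport hχ₀, zero_add] at h1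
    rw [← h1]
    refine Finset.sum_subset (Finset.subset_univ s) fun c _ hcs => ?_
    exact image_eq_zero_of_notMem_tsupport fun h => hcs ((hmem c).2 h)
  · have hU : ∀ᶠ y in 𝓝 q, ∀ c ∈ s, ψ.symm y ∈ (P.chart c).U := by
      refine (Finset.eventually_all s).2 fun c hcs => ?_
      exact hψc.eventually ((P.chart c).isOpen.mem_nhds (P.support_χ c ((hmem c).1 hcs)))
    have hz : ∀ᶠ y in 𝓝 q, ∀ c, c ∉ s → P.χ c (ψ.symm y) = 0 := by
      refine eventually_all.2 fun c => ?_
      by_cases hcs : c ∈ s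
      · exact Eventually.of_forall fun y h => absurd hcs h
      · filter_upwards [hc (P.χ c) fun h => hcs ((hmem c).2 h)] with y hy _ using hy
    filter_upwards [hint, hU, hz, hc P.χ₀ hχ₀] with y hy hyU hyz hy0 hya
    rw [SmoothingProfile.endProfile, hy0, zero_mul, zero_add, ← Finset.sum_neg_distrib]
    rw [← Finset.sum_subset (Finset.subset_univ s) fun c _ hcs => by rw [hyz c hcs, zero_mul]]
    refine Finset.sum_congr rfl fun c hcs => ?_
    rw [P.cornerEndFun_eq c fun i => (P.chart c).R_pos_of_mem_interior (hyU c hcs) (hy hya).2.2 i]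
    ring
  · exact Eventually.of_forall fun t => map_complexProj (coord_basisVec a) _
  · filter_upwards [htgt] with t ht
    exact map_apply_complexProj (coord_basisVec a) (EndField.inChart_square hJ.square ht) v
  · exact Eventually.of_forall fun t => rfl
  · exact (tendsto_clm_apply (tendsto_clm_apply hDJ hwt) hvt).sub
      (tendsto_clm_apply (tendsto_clm_apply hDJ hvt) hwt)
  · filter_upwards [hray.eventually hint, hpos, hray.eventually hKn] with t ht ht0 htK
    obtain ⟨h1, h2, h3⟩ := ht ht0
    obtain ⟨V, hV⟩ := extD_dc_eq_leviForm hJ.toIsTameACS h2 h1 P.contMDiffOn_endProfile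
      (complexProj (coord a) (basisVec a) (Ĵ (q + t • basisVec a)) v)
    have h4 := hpsc _ ⟨h3, htK⟩ V
    exact h4.trans_eq hV

end Sectorial
end

noncomputable section
namespace Sectorial

/-! ### Holomorphic maps touching the boundary. -/

section Bound

variable {E : Type*} [NormedAddCommGroup E] [NormedSpace ℝ E]

theorem leviVec_contDiffWithinAt {J : E → E →L[ℝ] E} {S : Set E} {y₀ : E} (hS : UniqueDiffOn ℝ S)
    (hy₀ : y₀ ∈ S) (hJ : ContDiffWithinAt ℝ ∞ J S y₀) (v₀ : E) :
    ContDiffWithinAt ℝ 1 (fun p : E × E => leviVec J S p.1 p.2) (S ×ˢ univ) (y₀, v₀) := by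
  have hfst : MapsTo (Prod.fst : E × E → E) (S ×ˢ univ) S := fun p hp => hp.1
  have h1 : ContDiffWithinAt ℝ 1 (fun p : E × E => J p.1) (S ×ˢ univ) (y₀, v₀) :=
    (hJ.of_le (by simp)).comp (y₀, v₀) contDiffWithinAt_fst hfst
  have h2 : ContDiffWithinAt ℝ 1 (fun p : E × E => fderivWithin ℝ J S p.1) (S ×ˢ univ) (y₀, v₀) :=
    (hJ.fderivWithin_right (m := 1) hS
      ((one_add_one_eq_two (R := WithTop ℕ∞)).trans_le two_le_infty) hy₀).comp (y₀, v₀) contDiffWithinAt_fst hfst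
  have h3 : ContDiffWithinAt ℝ 1 (fun p : E × E => J p.1 p.2) (S ×ˢ univ) (y₀, v₀) :=
    h1.clm_apply contDiffWithinAt_snd
  exact ((h2.clm_apply h3).clm_apply contDiffWithinAt_snd).sub
    ((h2.clm_apply contDiffWithinAt_snd).clm_apply h3)

/-- If the Levi form of a hyperplane is nonpositive, then nearby the second order defect is bounded
by the distance to the hyperplane and the transverse components of the vector. -/
theorem leviVec_le {J : E → E →L[ℝ] E} {S : Set E} {y₀ v₀ e : E} {ℓ : E →L[ℝ] ℝ} (he : ℓ e = 1)
    (hS : UniqueDiffOn ℝ S) (hconv : Convex ℝ S) (hproj : ∀ y ∈ S, y - ℓ y • e ∈ S)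
    (hy₀ : y₀ ∈ S) (hJ : ContDiffWithinAt ℝ ∞ J S y₀)
    (h0 : ℓ y₀ = 0) (hv : ℓ v₀ = 0) (hJv : ℓ (J y₀ v₀) = 0)
    (hle : ∀ᶠ y in 𝓝[S] y₀, ℓ y = 0 → ∀ v, ℓ (leviVec J S y (complexProj ℓ e (J y) v)) ≤ 0) :
    ∃ C : ℝ, 0 ≤ C ∧ ∀ᶠ p in 𝓝[S ×ˢ univ] (y₀, v₀),
      ℓ (leviVec J S p.1 p.2) ≤ C * (|ℓ p.2| + |ℓ (J p.1 p.2)| + |ℓ p.1|) := by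
  set S' : Set (E × E) := S ×ˢ univ with hS'
  have hfst : MapsTo (Prod.fst : E × E → E) S' S := fun p hp => hp.1
  have hmem : (y₀, v₀) ∈ S' := ⟨hy₀, mem_univ _⟩
  have hJ' : ContDiffWithinAt ℝ 1 (fun p : E × E => J p.1) S' (y₀, v₀) :=
    (hJ.of_le (by simp)).comp (y₀, v₀) contDiffWithinAt_fst hfst
  -- π moves the vector into the complex tangencies at a cost of order |ℓ v| + |ℓ(Jv)|; Q below
  -- moves the base point to the hyperplane at a cost |ℓ y| ‖e‖. The functions g and g ∘ π are C¹
  -- within a convex set, hence locally Lipschitz, and g(π(Q p)) ≤ 0 by hypothesis.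
  set π : E × E → E × E := fun p => (p.1, complexProj ℓ e (J p.1) p.2) with hπ
  have hπ0 : π (y₀, v₀) = (y₀, v₀) := by simp [hπ, complexProj_of_eq_zero hv hJv]
  have hπc : ContDiffWithinAt ℝ 1 π S' (y₀, v₀) :=
    contDiffWithinAt_fst.prodMk ((contDiff_complexProj ℓ e).comp_contDiffWithinAt
      (hJ'.prodMk contDiffWithinAt_snd))
  have hπm : MapsTo π S' S' := fun p hp => ⟨hp.1, mem_univ _⟩
  set Q : E × E → E × E := fun p => (p.1 - ℓ p.1 • e, p.2) with hQ
  have hQ0 : Q (y₀, v₀) = (y₀, v₀) := by simp [hQ, h0]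
  have hQc : Continuous Q :=
    (continuous_fst.sub ((ℓ.continuous.comp continuous_fst).smul continuous_const)).prodMk
      continuous_snd
  have hQm : MapsTo Q S' S' := fun p hp => ⟨hproj _ hp.1, mem_univ _⟩
  set g : E × E → ℝ := fun p => ℓ (leviVec J S p.1 p.2) with hg
  have hgc : ContDiffWithinAt ℝ 1 g S' (y₀, v₀) :=
    ℓ.contDiff.comp_contDiffWithinAt (leviVec_contDiffWithinAt hS hy₀ hJ v₀)
  have hhc : ContDiffWithinAt ℝ 1 (g ∘ π) S' (y₀, v₀) :=
    ContDiffWithinAt.comp (t := S') (y₀, v₀) (by rw [hπ0]; exact hgc) hπc hπm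
  have hc' : Convex ℝ S' := hconv.prod convex_univ
  obtain ⟨K₁, t₁, ht₁, hL₁⟩ := hgc.exists_lipschitzOnWith hc'
  obtain ⟨K₂, t₂, ht₂, hL₂⟩ := hhc.exists_lipschitzOnWith hc'
  have hπt : Tendsto π (𝓝[S'] (y₀, v₀)) (𝓝[S'] (y₀, v₀)) := by
    have := hπc.continuousWithinAt.tendsto_nhdsWithin hπm
    rwa [hπ0] at this
  have hQt : Tendsto Q (𝓝[S'] (y₀, v₀)) (𝓝[S'] (y₀, v₀)) := by
    have := (hQc.continuousWithinAt (s := S') (x := (y₀, v₀))).tendsto_nhdsWithin hQm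
    rwa [hQ0] at this
  set b : E × E → ℝ := fun p => ‖e + ℓ (J p.1 e) • J p.1 e‖ + ‖ℓ (J p.1 e) • e - J p.1 e‖ with hb
  have hbt : ContinuousWithinAt b S' (y₀, v₀) := by
    have h1 : ContinuousWithinAt (fun p : E × E => J p.1 e) S' (y₀, v₀) :=
      hJ'.continuousWithinAt.clm_apply continuousWithinAt_const
    have h2 := ℓ.continuous.continuousAt.comp_continuousWithinAt h1
    exact (continuousWithinAt_const.add (h2.smul h1)).norm.add
      ((h2.smul continuousWithinAt_const).sub h1).norm
  set B := b (y₀, v₀) + 1 with hB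
  have hB0 : 0 ≤ B := by positivity
  have hbB : ∀ᶠ p in 𝓝[S'] (y₀, v₀), b p < B := hbt.eventually (gt_mem_nhds (by linarith))
  have hle' : ∀ᶠ p in 𝓝[S'] (y₀, v₀), ℓ p.1 = 0 → g (π p) ≤ 0 := by
    have ht : Tendsto (Prod.fst : E × E → E) (𝓝[S'] (y₀, v₀)) (𝓝[S] y₀) :=
      (continuous_fst.continuousWithinAt (s := S') (x := (y₀, v₀))).tendsto_nhdsWithin hfst
    filter_upwards [ht.eventually hle] with p hp hp0 using hp hp0 p.2
  refine ⟨K₁ * B + K₂ * ‖e‖, by positivity, ?_⟩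
  filter_upwards [ht₁, hπt ht₁, ht₂, hQt ht₂, hbB, hQt.eventually hle'] with p h1 h2 h3 h4 h5 h6
  have hQp : ℓ (Q p).1 = 0 := by simp [hQ, he]
  have e1 := hL₁.dist_le_mul p h1 (π p) h2
  have e2 := hL₂.dist_le_mul p h3 (Q p) h4
  have e3 := h6 hQp
  have d2 : dist p (Q p) ≤ |ℓ p.1| * ‖e‖ := by
    rw [Prod.dist_eq]
    refine max_le ?_ ?_
    · rw [dist_eq_norm]
      simp [hQ, norm_smul]
    · simp only [hQ, dist_self]
      positivity
  have hc1 : |(1 + ℓ (J p.1 e) ^ 2)⁻¹| ≤ 1 := by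
    rw [abs_of_nonneg (by positivity)]
    exact inv_le_one_of_one_le₀ (by nlinarith [sq_nonneg (ℓ (J p.1 e))])
  have d1 : dist p (π p) ≤ (|ℓ p.2| + |ℓ (J p.1 p.2)|) * B := by
    rw [Prod.dist_eq]
    refine max_le ?_ ?_
    · simp only [hπ, dist_self]
      positivity
    · rw [dist_eq_norm]
      simp only [hπ, complexProj]
      rw [show p.2 - (p.2 - (ℓ p.2 * (1 + ℓ (J p.1 e) ^ 2)⁻¹) • (e + ℓ (J p.1 e) • J p.1 e)
        - (ℓ (J p.1 p.2) * (1 + ℓ (J p.1 e) ^ 2)⁻¹) • (ℓ (J p.1 e) • e - J p.1 e)) =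
        (ℓ p.2 * (1 + ℓ (J p.1 e) ^ 2)⁻¹) • (e + ℓ (J p.1 e) • J p.1 e)
        + (ℓ (J p.1 p.2) * (1 + ℓ (J p.1 e) ^ 2)⁻¹) • (ℓ (J p.1 e) • e - J p.1 e) by abel]
      refine (norm_add_le _ _).trans ?_
      rw [norm_smul, norm_smul, Real.norm_eq_abs, Real.norm_eq_abs, abs_mul, abs_mul, add_mul]
      have k1 : ‖e + ℓ (J p.1 e) • J p.1 e‖ ≤ B :=
        le_trans (by simp only [hb]; linarith [norm_nonneg (ℓ (J p.1 e) • e - J p.1 e)]) h5.le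
      have k2 : ‖ℓ (J p.1 e) • e - J p.1 e‖ ≤ B :=
        le_trans (by simp only [hb]; linarith [norm_nonneg (e + ℓ (J p.1 e) • J p.1 e)]) h5.le
      gcongr
      · exact mul_le_of_le_one_right (abs_nonneg _) hc1
      · exact mul_le_of_le_one_right (abs_nonneg _) hc1
  rw [Real.dist_eq] at e1 e2
  have f1 := (le_abs_self _).trans (e1.trans (mul_le_mul_of_nonneg_left d1 K₁.2))
  have f2 := (le_abs_self _).trans (e2.trans (mul_le_mul_of_nonneg_left d2 K₂.2))
  simp only [Function.comp_apply] at f2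
  have n1 : 0 ≤ (K₁ * B : ℝ) * |ℓ p.1| := by positivity
  have n2 : 0 ≤ (K₂ * ‖e‖ : ℝ) * (|ℓ p.2| + |ℓ (J p.1 p.2)|) := by positivity
  change g p ≤ _
  have m1 : (K₁ : ℝ) * ((|ℓ p.2| + |ℓ (J p.1 p.2)|) * B) =
    K₁ * B * (|ℓ p.2| + |ℓ (J p.1 p.2)|) := by ring
  have m2 : (K₂ : ℝ) * (|ℓ p.1| * ‖e‖) = K₂ * ‖e‖ * |ℓ p.1| := by ring
  have m3 : ((K₁ : ℝ) * B + K₂ * ‖e‖) * (|ℓ p.2| + |ℓ (J p.1 p.2)| + |ℓ p.1|) =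
    K₁ * B * (|ℓ p.2| + |ℓ (J p.1 p.2)|) + K₁ * B * |ℓ p.1| +
    (K₂ * ‖e‖ * (|ℓ p.2| + |ℓ (J p.1 p.2)|) + K₂ * ‖e‖ * |ℓ p.1|) := by ring
  linarith

end Bound

variable {d : ℕ} {M : Type*} [TopologicalSpace M] [ChartedSpace (EuclideanQuadrant d) M]
  [IsManifold (QI d) ∞ M]

/-- Every point with y_a = 0, corners included, is a limit of points of the open face, obtained by
increasing all the other coordinates. The inequality passes to the limit by continuity of `leviVec`
and `complexProj`. -/
theorem IsSectorial.leviVec_nonpos_of_boundary [T2Space M] {X : LiouvilleSector d M}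
    {P : SmoothingProfile X} {J : EndField d M} (hJ : IsSectorial P J) {x₀ : M} {a : Fin d}
    {q : EuclideanSpace ℝ (Fin d)} (hqt : q ∈ (extChartAt (QI d) x₀).target) (hq : coord a q = 0)
    (v : EuclideanSpace ℝ (Fin d)) :
    coord a (leviVec (J.inChart x₀) (range (QI d)) q
      (complexProj (coord a) (basisVec a) (J.inChart x₀ q) v)) ≤ 0 := by
  set S : Set (EuclideanSpace ℝ (Fin d)) := range (QI d) with hS
  have hqS : q ∈ S := extChartAt_target_subset_range x₀ hqt
  have hq0 : ∀ b, 0 ≤ q b := by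
    rw [hS, range_QI] at hqS
    exact hqS
  set e' : EuclideanSpace ℝ (Fin d) := ∑ b ∈ Finset.univ.erase a, basisVec b with he'
  have he'b : ∀ b, e' b = if b = a then 0 else 1 := fun b => by
    rw [he', WithLp.ofLp_sum, Finset.sum_apply]
    by_cases hb : b = a
    · rw [if_pos hb]
      exact Finset.sum_eq_zero fun c hc => by
        simp [basisVec, hb, (Finset.ne_of_mem_erase hc).symm]
    · rw [if_neg hb, Finset.sum_eq_single b]
      · simp
      · intro c _ hc
        simp [basisVec, hc.symm]
      · intro h
        exact absurd (Finset.mem_erase.2 ⟨hb, Finset.mem_univ b⟩) h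
  have hface : ∀ t : ℝ, 0 < t → IsFacePoint a (q + t • e') := fun t ht => by
    refine ⟨?_, fun b hb => ?_⟩
    · have : q a = 0 := hq
      simp [this, he'b]
    · have := hq0 b
      simp only [PiLp.add_apply, PiLp.smul_apply, he'b, if_neg hb, smul_eq_mul]
      linarith
  have hray : Tendsto (fun t : ℝ => q + t • e') (𝓝[>] 0) (𝓝 q) := by
    have : Continuous fun t : ℝ => q + t • e' :=
      continuous_const.add (continuous_id.smul continuous_const)
    have := (this.tendsto 0).mono_left (nhdsWithin_le_nhds (s := Ioi 0))
    simpa using this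
  have hrayS : Tendsto (fun t : ℝ => q + t • e') (𝓝[>] 0) (𝓝[S] q) :=
    tendsto_nhdsWithin_iff.2 ⟨hray, eventually_nhdsWithin_of_forall fun t ht =>
      (hface t ht).mem_range⟩
  have hJc := hJ.smooth.contDiffWithinAt hqt
  have hJq : Tendsto (fun t : ℝ => J.inChart x₀ (q + t • e')) (𝓝[>] 0) (𝓝 (J.inChart x₀ q)) :=
    hJc.continuousWithinAt.tendsto.comp hrayS
  have hvt : Tendsto (fun t : ℝ => complexProj (coord a) (basisVec a)
      (J.inChart x₀ (q + t • e')) v) (𝓝[>] 0)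
      (𝓝 (complexProj (coord a) (basisVec a) (J.inChart x₀ q) v)) :=
    tendsto_complexProj hJq _ _ v
  have hlim := (leviVec_contDiffWithinAt uniqueDiffOn_range_QI hqS hJc
    (complexProj (coord a) (basisVec a) (J.inChart x₀ q) v)).continuousWithinAt.tendsto.comp
      (tendsto_nhdsWithin_iff.2 ⟨hray.prodMk_nhds hvt, by
        filter_upwards [(tendsto_nhdsWithin_iff.1 hrayS).2] with t ht using ⟨ht, mem_univ _⟩⟩)
  refine le_of_tendsto (((coord a).continuous.tendsto _).comp hlim) ?_
  filter_upwards [hray.eventually (eventually_mem_target hqt), self_mem_nhdsWithin] with t ht ht0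
  exact hJ.leviVec_nonpos_of_facePoint (ht (hface t ht0).mem_range) (hface t ht0) v

/-- A holomorphic map that touches the boundary at an interior point of its domain is locally
contained in the boundary. -/
theorem IsSectorial.eventually_boundary [T2Space M] {X : LiouvilleSector d M}
    {P : SmoothingProfile X} {J : EndField d M} (hJ : IsSectorial P J) {u : ℂ → M} {z₀ : ℂ}
    (hu : ContMDiffAt 𝓘(ℝ, ℂ) (QI d) 2 u z₀)
    (hol : ∀ᶠ ζ in 𝓝 z₀, ∀ ξ : ℂ, mfderiv 𝓘(ℝ, ℂ) (QI d) u ζ (Complex.I * ξ : ℂ) =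
      J (u ζ) (mfderiv 𝓘(ℝ, ℂ) (QI d) u ζ ξ))
    (h0 : u z₀ ∉ (QI d).interior M) : ∀ᶠ z in 𝓝 z₀, u z ∉ (QI d).interior M := by
  set x₀ := u z₀ with hx₀
  set ψ := extChartAt (QI d) x₀ with hψ
  set S : Set (EuclideanSpace ℝ (Fin d)) := range (QI d) with hS
  set Ĵ := J.inChart x₀ with hĴ
  set F : ℂ → EuclideanSpace ℝ (Fin d) := fun ζ => ψ (u ζ) with hF
  have hsrc : ∀ᶠ z in 𝓝 z₀, u z ∈ ψ.source :=
    hu.continuousAt.preimage_mem_nhds (extChartAt_source_mem_nhds x₀)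
  have hFt : ∀ᶠ z in 𝓝 z₀, F z ∈ ψ.target := by
    filter_upwards [hsrc] with z hz using ψ.map_source hz
  have hFS : ∀ᶠ z in 𝓝 z₀, F z ∈ S := by
    filter_upwards [hFt] with z hz using extChartAt_target_subset_range x₀ hz
  have hu' := (contMDiffAt_iff_contMDiffAt_nhds (by simp)).1 hu
  have hFc : ∀ᶠ z in 𝓝 z₀, ContDiffAt ℝ 2 F z := by
    filter_upwards [hsrc, hu'] with z h1 h2 using contDiffAt_extChartAt_comp two_le_infty h2 h1
  have hFI : ∀ᶠ z in 𝓝 z₀, fderiv ℝ F z Complex.I = Ĵ (F z) (fderiv ℝ F z 1) := by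
    filter_upwards [hsrc, hu', hol] with z h1 h2 h3
    have h4 := h2.mdifferentiableAt (by simp)
    have h5 := h3 1
    rw [mul_one] at h5
    refine (fderiv_extChartAt_comp h4 h1 Complex.I).trans ?_
    rw [h5]
    exact (J.inChart_apply_fderiv h4 h1 1).symm
  have hF1 : ∀ᶠ z in 𝓝 z₀, fderiv ℝ F z 1 = -Ĵ (F z) (fderiv ℝ F z Complex.I) := by
    filter_upwards [hFI, hFt] with z h1 h2
    rw [h1, EndField.inChart_square hJ.square h2, neg_neg]
  have hFt0 : F z₀ ∈ ψ.target := hFt.self_of_nhds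
  -- One vanishing coordinate is enough; at a corner any of them will do.
  obtain ⟨a, ha⟩ : ∃ a, coord a (F z₀) = 0 := by
    rw [mem_interior_iff_extChartAt (x₀ := x₀) (mem_extChartAt_source x₀), interior_range_QI,
      mem_ofPred_eq] at h0
    push Not at h0
    obtain ⟨a, ha⟩ := h0
    have := hFS.self_of_nhds
    rw [hS, range_QI] at this
    exact ⟨a, le_antisymm ha (this a)⟩
  set w : ℂ → ℝ := fun z => coord a (F z) with hw
  have hw0 : ∀ᶠ z in 𝓝 z₀, 0 ≤ w z := by
    filter_upwards [hFS] with z hz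
    rw [hS, range_QI] at hz
    exact hz a
  have hwd : ∀ᶠ z in 𝓝 z₀, ∀ ξ, fderiv ℝ w z ξ = coord a (fderiv ℝ F z ξ) := by
    filter_upwards [hFc] with z hz ξ
    have := ((coord a).hasFDerivAt.comp z (hz.differentiableAt (by simp)).hasFDerivAt).fderiv
    exact DFunLike.congr_fun this ξ
  -- w has a minimum at z₀, so w_x = w_y = 0 there. By holomorphicity F_x is complex tangent to {y_a
  -- = 0} at z₀, which is the base configuration required by `leviVec_le`.
  have hmin : fderiv ℝ w z₀ = 0 := by
    refine IsLocalMin.fderiv_eq_zero ?_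
    filter_upwards [hw0] with z hz
    rw [hw]
    exact ha.le.trans hz
  have hlap : ∀ᶠ z in 𝓝 z₀, lap w z = coord a (leviVec Ĵ S (F z) (fderiv ℝ F z 1)) := by
    filter_upwards [hFc, hFS.eventually_nhds, hFI.eventually_nhds, hF1.eventually_nhds,
      hwd.eventually_nhds, hFt] with z h1 h2 h3 h4 h5 h6
    rw [← laplace_of_holomorphic ((hJ.smooth.contDiffWithinAt h6).differentiableWithinAt (by simp))
      h1 h2 h3 h4, map_add, lap]
    have key : ∀ ξ : ℂ, fderiv ℝ (fun ζ => fderiv ℝ w ζ ξ) z ξ =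
        coord a (fderiv ℝ (fun ζ => fderiv ℝ F ζ ξ) z ξ) := fun ξ => by
      have e1 : (fun ζ => fderiv ℝ w ζ ξ) =ᶠ[𝓝 z] fun ζ => coord a (fderiv ℝ F ζ ξ) := by
        filter_upwards [h5] with ζ hζ using hζ ξ
      rw [e1.fderiv_eq]
      have e2 : DifferentiableAt ℝ (fun ζ => fderiv ℝ F ζ ξ) z :=
        ((h1.fderiv_right (m := 1) (by norm_num)).differentiableAt (by simp)).clm_apply
          (differentiableAt_const ξ)
      exact DFunLike.congr_fun ((coord a).hasFDerivAt.comp z e2.hasFDerivAt).fderiv ξ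
    rw [key, key]
  have hv0 : coord a (fderiv ℝ F z₀ 1) = 0 := by
    rw [← hwd.self_of_nhds 1, hmin]; rfl
  have hJv0 : coord a (Ĵ (F z₀) (fderiv ℝ F z₀ 1)) = 0 := by
    rw [← hFI.self_of_nhds, ← hwd.self_of_nhds Complex.I, hmin]; rfl
  have hconv : Convex ℝ S := by
    rw [hS, range_QI]
    intro x hx y hy s t hs ht _ i
    exact add_nonneg (mul_nonneg hs (hx i)) (mul_nonneg ht (hy i))
  have hproj : ∀ y ∈ S, y - coord a y • basisVec a ∈ S := by
    rw [hS, range_QI]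
    intro y hy b
    by_cases hb : b = a
    · simp [hb]
    · have := hy b
      simpa [hb] using this
  obtain ⟨C, hC, hbound⟩ := leviVec_le (coord_basisVec a) uniqueDiffOn_range_QI hconv hproj
    hFS.self_of_nhds (hJ.smooth.contDiffWithinAt hFt0) ha hv0 hJv0 (by
      filter_upwards [nhdsWithin_le_nhds (eventually_mem_target hFt0), self_mem_nhdsWithin]
        with y hy hyS hya v
      exact hJ.leviVec_nonpos_of_boundary (hy hyS) hya v)
  have hFcont : Tendsto (fun z => (F z, fderiv ℝ F z 1)) (𝓝 z₀)
      (𝓝[S ×ˢ univ] (F z₀, fderiv ℝ F z₀ 1)) := by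
    refine tendsto_nhdsWithin_iff.2 ⟨?_, by filter_upwards [hFS] with z hz using ⟨hz, mem_univ _⟩⟩
    have h1 := hFc.self_of_nhds
    exact h1.continuousAt.prodMk_nhds
      (tendsto_clm_apply (h1.fderiv_right (m := 1) (by norm_num)).continuousAt tendsto_const_nhds)
  obtain ⟨r, hr, hball⟩ := Metric.eventually_nhds_iff_ball.1
    ((hFcont.eventually hbound).and (hlap.and (hw0.and (hwd.and (hFI.and hFc)))))
  have := strong_minimum_principle (w := w) hr hC
    (fun z hz => ContDiffAt.contDiffWithinAt
      ((coord a).contDiff.comp_contDiffAt z (hball z hz).2.2.2.2.2))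
    (fun z hz => (hball z hz).2.2.1) (fun z hz => by
      -- Since w_x = ℓ(F_x), w_y = ℓ(J F_x) and w = ℓ(F), the bound on `leviVec` is exactly the
      -- differential inequality required.
      obtain ⟨h1, h2, h3, h4, h5, -⟩ := hball z hz
      rw [h2, h4, h4, h5, ← abs_of_nonneg h3]
      exact h1) ha
  filter_upwards [this, hsrc] with z hz hzs hi
  rw [mem_interior_iff_extChartAt (x₀ := x₀) hzs] at hi
  exact IsFacePoint.notMem_interior (a := a) hz hi

end Sectorial
end

noncomputable section
namespace Sectorial

/-! ### The punctured disc, and confinement of polygons to the interior. -/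

section Domain

variable {k : ℕ} {θ : Fin (k + 1) → ℝ}

theorem norm_vertex (θ : Fin (k + 1) → ℝ) (i : Fin (k + 1)) : ‖vertex θ i‖ = 1 :=
  Complex.norm_exp_ofReal_mul_I _

theorem ball_subset_polygonDomain : Metric.ball (0 : ℂ) 1 ⊆ polygonDomain θ := by
  refine fun z hz => ⟨Metric.ball_subset_closedBall hz, ?_⟩
  rintro ⟨i, rfl⟩
  rw [mem_ball_zero_iff, norm_vertex] at hz
  exact lt_irrefl _ hz

theorem polygonDomain_mem_nhds {z : ℂ} (hz : z ∈ Metric.ball (0 : ℂ) 1) : polygonDomain θ ∈ 𝓝 z :=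
  mem_of_superset (Metric.isOpen_ball.mem_nhds hz) ball_subset_polygonDomain

/-- The boundary circle is the union of the marked points and the arcs. -/
theorem mem_range_vertex_or_mem_arc (θ : Fin (k + 1) → ℝ) {z : ℂ} (hz : ‖z‖ = 1) :
    z ∈ range (vertex θ) ∨ ∃ i, z ∈ arc θ i := by
  obtain ⟨α, hα, hα', hzα⟩ : ∃ α, θ 0 ≤ α ∧ α < θ 0 + 2 * Real.pi ∧
      z = Complex.exp (α * Complex.I) := by
    refine ⟨toIcoMod Real.two_pi_pos (θ 0) (Complex.arg z), left_le_toIcoMod _ _ _,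
      toIcoMod_lt_right _ _ _, ?_⟩
    have h1 : Complex.exp (Complex.arg z * Complex.I) = z := by
      have := Complex.norm_mul_exp_arg_mul_I z
      rwa [hz, Complex.ofReal_one, one_mul] at this
    rw [toIcoMod, zsmul_eq_mul]
    push_cast
    rw [sub_mul, Complex.exp_sub, h1, mul_assoc, Complex.exp_int_mul_two_pi_mul_I, div_one]
  -- With the angle normalized to one period starting at θ 0, the point lies at, or on the arc
  -- after, the last marked point whose angle does not exceed α.
  set s : Finset (Fin (k + 1)) := Finset.univ.filter fun i => θ i ≤ α with hs
  have hne : s.Nonempty := ⟨0, by simp [hs, hα]⟩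
  set i := s.max' hne with hi
  have hiα : θ i ≤ α := (Finset.mem_filter.1 (s.max'_mem hne)).2
  have hmax : ∀ j, θ j ≤ α → j ≤ i := fun j hj => s.le_max' j (by simp [hs, hj])
  rcases hiα.eq_or_lt with h | h
  · left
    exact ⟨i, by rw [vertex, h, hzα]⟩
  · right
    refine ⟨i, α, h, ?_, hzα⟩
    rw [nextAngle]
    split_ifs with hl
    · exact hα'
    · by_contra hc
      have h1 := hmax _ (not_lt.1 hc)
      exact absurd h1 (not_le.2 (Fin.lt_add_one_iff.2 (Fin.lt_last_iff_ne_last.2 hl)))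

theorem mem_ball_or_mem_arc {z : ℂ} (hz : z ∈ polygonDomain θ) :
    z ∈ Metric.ball (0 : ℂ) 1 ∨ ∃ i, z ∈ arc θ i := by
  rcases (mem_closedBall_zero_iff.1 hz.1).lt_or_eq with h | h
  · exact Or.inl (mem_ball_zero_iff.2 h)
  · exact Or.inr ((mem_range_vertex_or_mem_arc θ h).resolve_left hz.2)

theorem exists_add_one_eq (i : Fin (k + 1)) : ∃ j : Fin (k + 1), j + 1 = i :=
  ⟨i - 1, sub_add_cancel i 1⟩

theorem neBot_nhdsWithin_ball_vertex (i : Fin (k + 1)) :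
    (𝓝[Metric.ball (0 : ℂ) 1] (vertex θ i)).NeBot := by
  rw [← mem_closure_iff_nhdsWithin_neBot, closure_ball _ one_ne_zero, mem_closedBall_zero_iff,
    norm_vertex]

end Domain

variable {d : ℕ} {M : Type*} [TopologicalSpace M] [ChartedSpace (EuclideanQuadrant d) M]

variable {J : EndField d M} {k : ℕ} {L : Fin (k + 1) → Set M} {p : Fin (k + 1) → M}
  {θ : Fin (k + 1) → ℝ} {u : ℂ → M}

theorem IsPolygon.contMDiffAt (hu : IsPolygon J L p θ u) {z : ℂ}
    (hz : z ∈ Metric.ball (0 : ℂ) 1) : ContMDiffAt 𝓘(ℝ, ℂ) (QI d) 2 u z :=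
  (hu.smooth.contMDiffAt (polygonDomain_mem_nhds hz)).of_le two_le_infty

theorem IsPolygon.eventually_holomorphic (hu : IsPolygon J L p θ u) {z : ℂ}
    (hz : z ∈ Metric.ball (0 : ℂ) 1) : ∀ᶠ ζ in 𝓝 z, ∀ ξ : ℂ,
      mfderiv 𝓘(ℝ, ℂ) (QI d) u ζ (Complex.I * ξ : ℂ) =
        J (u ζ) (mfderiv 𝓘(ℝ, ℂ) (QI d) u ζ ξ) := by
  filter_upwards [Metric.isOpen_ball.mem_nhds hz] with ζ hζ ξ
  have := hu.holomorphic ζ (ball_subset_polygonDomain hζ) ξ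
  rwa [mfderivWithin_of_mem_nhds (polygonDomain_mem_nhds hζ)] at this

theorem IsPolygon.tendsto_ball (hu : IsPolygon J L p θ u) (i : Fin (k + 1)) :
    Tendsto u (𝓝[Metric.ball (0 : ℂ) 1] (vertex θ (i + 1))) (𝓝 (p i)) :=
  (hu.asymptotic i).mono_left (nhdsWithin_mono _ ball_subset_polygonDomain)

variable [IsManifold (QI d) ∞ M]

/-- Holomorphic polygons with boundary in the interior stay in the interior. -/
theorem IsPolygon.mapsTo_interior [T2Space M] {X : LiouvilleSector d M} {P : SmoothingProfile X}
    (hJ : IsSectorial P J) (hL : ∀ i, L i ⊆ (QI d).interior M) (hp : ∀ i, p i ∈ L i)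
    (hu : IsPolygon J L p θ u) : MapsTo u (polygonDomain θ) ((QI d).interior M) := by
  have hopen : IsOpen ((QI d).interior M) := (QI d).isOpen_interior (n := 1) (by simp)
  set B := Metric.ball (0 : ℂ) 1 with hB
  have hball : MapsTo u B ((QI d).interior M) := by
    -- The preimages of the interior and of the boundary are both open in the disc. The former is
    -- nonempty because u tends to an interior point at a puncture, so it is the whole disc.
    have h1 : IsOpen (B ∩ u ⁻¹' (QI d).interior M) := isOpen_iff_mem_nhds.2 fun z hz =>
      inter_mem (Metric.isOpen_ball.mem_nhds hz.1)
        ((hu.contMDiffAt hz.1).continuousAt.preimage_mem_nhds (hopen.mem_nhds hz.2))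
    have h2 : IsOpen (B ∩ u ⁻¹' ((QI d).interior M)ᶜ) := isOpen_iff_mem_nhds.2 fun z hz =>
      inter_mem (Metric.isOpen_ball.mem_nhds hz.1)
        (hJ.eventually_boundary (hu.contMDiffAt hz.1) (hu.eventually_holomorphic hz.1) hz.2)
    have h3 : (B ∩ (B ∩ u ⁻¹' (QI d).interior M)).Nonempty := by
      have := neBot_nhdsWithin_ball_vertex (θ := θ) (0 + 1)
      obtain ⟨z, hz, hz'⟩ := (((hu.tendsto_ball 0).eventually
        (hopen.mem_nhds (hL 0 (hp 0)))).and self_mem_nhdsWithin).exists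
      exact ⟨z, hz', hz', hz⟩
    have h4 := (convex_ball (0 : ℂ) 1).isPreconnected.subset_left_of_subset_union h1 h2
      (disjoint_left.2 fun z hz hz' => hz'.2 hz.2) (fun z hz => by
        by_cases h : u z ∈ (QI d).interior M
        · exact Or.inl ⟨hz, h⟩
        · exact Or.inr ⟨hz, h⟩) h3
    exact fun z hz => (h4 hz).2
  intro z hz
  rcases mem_ball_or_mem_arc hz with h | ⟨i, hi⟩
  · exact hball h
  · exact hL i (hu.boundary i z hi)

end Sectorial
end

noncomputable section
namespace Sectorial

variable {d : ℕ} {M : Type*} [TopologicalSpace M] [ChartedSpace (EuclideanQuadrant d) M]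

/-! ### The metric g_J and the Neumann condition along the Lagrangians. -/

section Metric

variable {X : LiouvilleForm d M} {J : EndField d M} {x : M}

theorem IsTameACS.metric_self (hJ : IsTameACS X J) {v : TangentSpace (QI d) x} (hv : v ≠ 0) :
    0 < metric X J x v v := by
  have := hJ.tame x v hv
  rw [metric]
  linarith

/-- The metric as a bilinear map. -/
def metricLin (X : LiouvilleForm d M) (J : EndField d M) (x : M) :
    EuclideanSpace ℝ (Fin d) →ₗ[ℝ] EuclideanSpace ℝ (Fin d) →ₗ[ℝ] ℝ :=
  let B : EuclideanSpace ℝ (Fin d) →ₗ[ℝ] EuclideanSpace ℝ (Fin d) →ₗ[ℝ] ℝ :=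
    (X.omLin x).compl₂ ((J x).toLinearMap : EuclideanSpace ℝ (Fin d) →ₗ[ℝ] EuclideanSpace ℝ (Fin d))
  (2⁻¹ : ℝ) • (B + B.flip)

theorem metricLin_apply (X : LiouvilleForm d M) (J : EndField d M) (x : M)
    (v w : EuclideanSpace ℝ (Fin d)) : metricLin X J x v w = metric X J x v w := by
  change 2⁻¹ * (X.om x v (J x w) + X.om x w (J x v)) = (X.om x v (J x w) + X.om x w (J x v)) / 2
  ring

theorem IsTameACS.exists_gradient (hJ : IsTameACS X J) (s : M → ℝ) (x : M) :
    ∃ G : TangentSpace (QI d) x, IsGradientAt X J s x G := by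
  have hinj : Function.Injective (metricLin X J x) := by
    refine (injective_iff_map_eq_zero _).2 fun v hv => ?_
    by_contra hv0
    have := hJ.metric_self (x := x) hv0
    rw [← metricLin_apply, hv] at this
    exact lt_irrefl _ this
  have hsurj := (LinearMap.injective_iff_surjective_of_finrank_eq_finrank
    (Subspace.dual_finrank_eq (K := ℝ) (V := EuclideanSpace ℝ (Fin d))).symm).1 hinj
  obtain ⟨G, hG⟩ := hsurj ((dfun s : OneForm d M) x).toLinearMap
  exact ⟨G, fun w => (metricLin_apply X J x G w).symm.trans (DFunLike.congr_fun hG w)⟩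

theorem om_neg_right (X : LiouvilleForm d M) (x : M) (v w : TangentSpace (QI d) x) :
    X.om x v (-w) = -X.om x v w :=
  (X.omLin x v).map_neg w

theorem om_swap (X : LiouvilleForm d M) (x : M) (v w : TangentSpace (QI d) x) :
    X.om x v w = -X.om x w v := by
  simp only [LiouvilleForm.om, extD]
  ring

/-- Neumann condition. -/
theorem dfun_apply_eq_zero_of_gradient_mem (hJ : IsTameACS X J) {s : M → ℝ} {L : Set M}
    (hL : IsExactLagrangian X L) (hx : x ∈ L)
    (hG : ∀ G : TangentSpace (QI d) x, IsGradientAt X J s x G →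
      (metric X J x G G)⁻¹ • G ∈ tangentTo (d := d) L x)
    (hc : ∀ v w : TangentSpace (QI d) x, X.om x (J x v) (J x w) = X.om x v w)
    {v : TangentSpace (QI d) x} (hv : v ∈ tangentTo (d := d) L x) :
    (dfun s : OneForm d M) x (J x v) = 0 := by
  obtain ⟨G, hGs⟩ := hJ.exists_gradient s x
  have hom : X.om x v G = 0 := by
    by_cases h0 : G = 0
    · rw [h0]
      have := om_neg_right X x v 0
      rw [neg_zero] at this
      linarith
    · have hm := hJ.metric_self h0
      have := (tangentTo (d := d) L x).smul_mem (metric X J x G G) (hG G hGs)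
      rw [smul_inv_smul₀ hm.ne'] at this
      exact hL.isotropic x hx v hv G this
  -- ds(Jv) = g_J(G, Jv) = (ω(G, J²v) + ω(Jv, JG))/2 = ω(v, G) by compatibility, and this vanishes
  -- because v and G are both tangent to the Lagrangian.
  rw [← hGs, metric, hJ.square, om_neg_right, hc, om_swap X x G v, hom]
  simp

end Metric


/-! ### Derivatives of polygons along the boundary arcs. -/

section Curves

theorem hasFDerivWithinAt_comp_map {h : M → ℝ} {u : ℂ → M} {S : Set ℂ} {z : ℂ}
    (hh : MDifferentiableAt (QI d) 𝓘(ℝ, ℝ) h (u z))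
    (hu : MDifferentiableWithinAt 𝓘(ℝ, ℂ) (QI d) u S z) :
    ∃ A : ℂ →L[ℝ] ℝ, HasFDerivWithinAt (fun ζ => h (u ζ)) A S z ∧
      ∀ ξ : ℂ, A ξ = (dfun h : OneForm d M) (u z) (mfderivWithin 𝓘(ℝ, ℂ) (QI d) u S z ξ) :=
  ⟨_, (hh.hasMFDerivAt.comp_hasMFDerivWithinAt z hu.hasMFDerivWithinAt).hasFDerivWithinAt,
    fun _ => rfl⟩

variable {J : EndField d M} {k : ℕ} {L : Fin (k + 1) → Set M} {p : Fin (k + 1) → M}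
  {θ : Fin (k + 1) → ℝ} {u : ℂ → M}

theorem arc_subset_sphere {i : Fin (k + 1)} {z : ℂ} (hz : z ∈ arc θ i) : ‖z‖ = 1 := by
  obtain ⟨t, -, -, rfl⟩ := hz
  exact Complex.norm_exp_ofReal_mul_I t

theorem isClosed_range_vertex (θ : Fin (k + 1) → ℝ) : IsClosed (range (vertex θ)) :=
  (finite_range _).isClosed

/-- All angles concerned lie in a common half-open period, so equality of the points forces equality
of the angles; and no θ j lies strictly between consecutive marked angles. -/
theorem IsCyclic.arc_subset_polygonDomain (hθ : IsCyclic θ) (i : Fin (k + 1)) :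
    arc θ i ⊆ polygonDomain θ := by
  refine fun z hz => ⟨mem_closedBall_zero_iff.2 (arc_subset_sphere hz).le, ?_⟩
  rintro ⟨j, hj⟩
  obtain ⟨t, h1, h2, rfl⟩ := hz
  obtain ⟨n, hn⟩ := Complex.exp_eq_exp_iff_exists_int.1 hj
  have hn' : θ j = t + n * (2 * Real.pi) := by
    have h3 : (θ j : ℂ) * Complex.I = (t + n * (2 * Real.pi) : ℝ) * Complex.I := by
      rw [hn]; push_cast; ring
    exact_mod_cast mul_right_cancel₀ Complex.I_ne_zero h3
  have hpi := Real.two_pi_pos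
  have hmono := hθ.strictMono.monotone
  have b1 : θ 0 ≤ θ j := hmono (Fin.zero_le j)
  have b2 : θ j < θ 0 + 2 * Real.pi := (hmono (Fin.le_last j)).trans_lt hθ.lt_two_pi
  have b3 : θ 0 < t := (hmono (Fin.zero_le i)).trans_lt h1
  have b4 : t < θ 0 + 2 * Real.pi := by
    rw [nextAngle] at h2
    split_ifs at h2 with hl
    · exact h2
    · exact h2.trans_le ((hmono (Fin.le_last _)).trans hθ.lt_two_pi.le)
  have n1 : (n : ℝ) < 1 := by
    by_contra! hc
    nlinarith
  have n2 : (-1 : ℝ) < n := by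
    by_contra! hc
    nlinarith
  have n0 : n = 0 := by
    have m1 : n < 1 := by exact_mod_cast n1
    have m2 : -1 < n := by exact_mod_cast n2
    omega
  rw [n0, Int.cast_zero, zero_mul, add_zero] at hn'
  have hij : i < j := hθ.strictMono.lt_iff_lt.1 (h1.trans_eq hn'.symm)
  rw [nextAngle, if_neg (hij.trans_le (Fin.le_last j)).ne] at h2
  rw [← hn'] at h2
  have hji := hθ.strictMono.lt_iff_lt.1 h2
  have hil : i ≠ Fin.last k := (hij.trans_le (Fin.le_last j)).ne
  rw [Fin.lt_def, Fin.val_add_one_of_lt (Fin.lt_last_iff_ne_last.2 hil)] at hji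
  rw [Fin.lt_def] at hij
  omega

/-- The derivative of a polygon along an arc is tangent to the Lagrangian. -/
theorem IsPolygon.mfderivWithin_mem_tangentTo (hu : IsPolygon J L p θ u) {i : Fin (k + 1)} {z : ℂ}
    (hz : z ∈ arc θ i) :
    mfderivWithin 𝓘(ℝ, ℂ) (QI d) u (polygonDomain θ) z (Complex.I * z : ℂ) ∈
      tangentTo (d := d) (L i) (u z) := by
  intro h hh h0
  have hzd := hu.cyclic.arc_subset_polygonDomain i hz
  obtain ⟨A, hA, hA'⟩ := hasFDerivWithinAt_comp_map (u := u) (S := polygonDomain θ) (z := z)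
    (hh.mdifferentiableAt (by simp)) ((hu.smooth z hzd).mdifferentiableWithinAt (by simp))
  rw [← hA']
  obtain ⟨t, h1, h2, rfl⟩ := id hz
  have hγ : HasDerivAt (fun τ : ℝ => Complex.exp (τ * Complex.I))
      (Complex.I * Complex.exp (t * Complex.I)) t := by
    have := ((Complex.ofRealCLM.hasDerivAt (x := t)).mul_const Complex.I).cexp
    simpa [mul_comm] using this
  have harc : ∀ᶠ τ : ℝ in 𝓝 t, Complex.exp (τ * Complex.I) ∈ arc θ i := by
    filter_upwards [Ioo_mem_nhds h1 h2] with τ hτ using ⟨τ, hτ.1, hτ.2, rfl⟩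
  have hc : HasDerivWithinAt (fun τ : ℝ => h (u (Complex.exp (τ * Complex.I)))) _
      {τ : ℝ | Complex.exp (τ * Complex.I) ∈ arc θ i} t :=
    HasFDerivWithinAt.comp_hasDerivWithinAt (f := fun τ : ℝ => Complex.exp (τ * Complex.I)) t hA
      hγ.hasDerivWithinAt (fun τ hτ => hu.cyclic.arc_subset_polygonDomain i hτ)
  have hc' := hc.hasDerivAt harc
  refine hc'.unique ((hasDerivAt_const t (0 : ℝ)).congr_of_eventuallyEq ?_)
  filter_upwards [harc] with τ hτ using h0 _ (hu.boundary i _ hτ)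

end Curves

end Sectorial
end

noncomputable section
namespace Sectorial

/-! ### The maximum principle with Neumann boundary conditions, and the conclusion. -/

variable {d : ℕ} {M : Type*} [TopologicalSpace M] [ChartedSpace (EuclideanQuadrant d) M]
variable {J : EndField d M} {k : ℕ} {L : Fin (k + 1) → Set M} {p : Fin (k + 1) → M}
  {θ : Fin (k + 1) → ℝ} {u : ℂ → M}

/-- A one-sided difference quotient. It turns the linear growth of the Hopf lemma into a bound on a
derivative that exists only within the domain, at a boundary point. -/
theorem le_apply_of_le_ray {w : ℂ → ℝ} {A : ℂ →L[ℝ] ℝ} {S : Set ℂ} {b v : ℂ}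
    {ε : ℝ} (hw : HasFDerivWithinAt w A S b) (h0 : w b = 0)
    (hS : ∀ᶠ t : ℝ in 𝓝[>] 0, b + t • v ∈ S) (hε : ∀ᶠ t : ℝ in 𝓝[>] 0, ε * t ≤ w (b + t • v)) :
    ε ≤ A v := by
  have h1 : HasDerivAt (fun t : ℝ => b + t • v) v 0 := by
    have := ((hasDerivAt_id (0 : ℝ)).smul_const v).const_add b
    rwa [one_smul] at this
  have h2 : HasDerivWithinAt (fun t : ℝ => w (b + t • v)) (A v)
      (Ioi 0 ∩ {t : ℝ | b + t • v ∈ S}) 0 := by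
    refine HasFDerivWithinAt.comp_hasDerivWithinAt (f := fun t : ℝ => b + t • v) (t := S) 0 ?_
      h1.hasDerivWithinAt fun t ht => ht.2
    simpa using hw
  have h3 : HasDerivWithinAt (fun t : ℝ => w (b + t • v)) (A v) (Ioi 0) 0 :=
    h2.mono_of_mem_nhdsWithin (inter_mem self_mem_nhdsWithin hS)
  have h4 : Tendsto (slope (fun t : ℝ => w (b + t • v)) 0) (𝓝[>] 0) (𝓝 (A v)) :=
    (hasDerivWithinAt_iff_tendsto_slope' self_notMem_Ioi).1 h3
  refine ge_of_tendsto h4 ?_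
  filter_upwards [hε, self_mem_nhdsWithin] with t ht ht0
  rw [slope_def_field, zero_smul, add_zero, h0, sub_zero, sub_zero, le_div_iff₀ ht0]
  exact ht

variable [IsManifold (QI d) ∞ M]

/-- The maximum principle with Neumann boundary conditions for holomorphic polygons. -/
theorem IsPolygon.le_of_pseudoconvex {X : LiouvilleForm d M} (hJ : IsTameACS X J)
    (hu : IsPolygon J L p θ u) {s : M → ℝ} {r : ℝ}
    (hs : ContMDiffOn (QI d) 𝓘(ℝ, ℝ) ∞ s ((QI d).interior M))
    (hint : MapsTo u (polygonDomain θ) ((QI d).interior M))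
    (hp : ∀ i, p i ∈ (QI d).interior M) (hpr : ∀ i, s (p i) ≤ r)
    (hpsc : ∀ x ∈ (QI d).interior M, r < s x → ∀ v : TangentSpace (QI d) x,
      0 ≤ -extD (dc J s) x v (J x v))
    (hN : ∀ i, ∀ x ∈ L i, r < s x → ∀ v ∈ tangentTo (d := d) (L i) x,
      (dfun s : OneForm d M) x (J x v) = 0) {z : ℂ} (hz : z ∈ polygonDomain θ) : s (u z) ≤ r := by
  have hopen : IsOpen ((QI d).interior M) := (QI d).isOpen_interior (n := 1) (by simp)
  by_contra! hlt
  set f : ℂ → ℝ := fun ζ => s (u ζ) with hf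
  set S := polygonDomain θ with hS
  have hsmooth : ∀ x ∈ (QI d).interior M, ContMDiffAt (QI d) 𝓘(ℝ, ℝ) ∞ s x := fun x hx =>
    hs.contMDiffAt (hopen.mem_nhds hx)
  have hfc : ContinuousOn f S := fun ζ hζ =>
    (hsmooth _ (hint hζ)).continuousAt.comp_continuousWithinAt (hu.smooth ζ hζ).continuousWithinAt
  have hvert : ∀ i m, r < m → ∀ᶠ ζ in 𝓝[S] (vertex θ i), f ζ < m := fun i m hm => by
    obtain ⟨j, rfl⟩ := exists_add_one_eq i
    exact ((hsmooth _ (hp j)).continuousAt.tendsto.comp (hu.asymptotic j)).eventually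
      (gt_mem_nhds ((hpr j).trans_lt hm))
  -- the maximum
  have hT : IsCompact (S ∩ {ζ | f z ≤ f ζ}) := by
    refine (isCompact_closedBall (0 : ℂ) 1).of_isClosed_subset (isClosed_of_closure_subset
      fun ζ hζ => ?_) fun ζ hζ => hζ.1.1
    have hne : (𝓝[S ∩ {ζ | f z ≤ f ζ}] ζ).NeBot := mem_closure_iff_nhdsWithin_neBot.1 hζ
    have hζ1 : ζ ∈ Metric.closedBall (0 : ℂ) 1 :=
      closure_minimal (fun η hη => hη.1.1) Metric.isClosed_closedBall hζ
    have hζv : ζ ∉ range (vertex θ) := by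
      rintro ⟨i, rfl⟩
      have h3 : ∀ᶠ ζ in 𝓝[S ∩ {ζ | f z ≤ f ζ}] (vertex θ i), f ζ < f z :=
        (hvert i (f z) hlt).filter_mono (nhdsWithin_mono _ inter_subset_left)
      obtain ⟨η, h1, h2⟩ := (h3.and self_mem_nhdsWithin).exists
      exact absurd h2.2 (not_le.2 h1)
    have hζS : ζ ∈ S := ⟨hζ1, hζv⟩
    have hlim : Tendsto f (𝓝[S ∩ {ζ | f z ≤ f ζ}] ζ) (𝓝 (f ζ)) := (hfc ζ hζS).mono inter_subset_left
    exact ⟨hζS, ge_of_tendsto hlim (eventually_nhdsWithin_of_forall fun η hη => hη.2)⟩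
  obtain ⟨b, hb, hmax'⟩ := hT.exists_isMaxOn ⟨z, hz, le_refl (f z)⟩ (hfc.mono inter_subset_left)
  set m := f b with hm
  have hrm : r < m := hlt.trans_le hb.2
  have hmax : ∀ ζ ∈ S, f ζ ≤ m := fun ζ hζ => by
    by_cases h : f z ≤ f ζ
    · exact hmax' ⟨hζ, h⟩
    · exact (not_le.1 h).le.trans hb.2
  set w : ℂ → ℝ := fun ζ => m - f ζ with hw
  have hwS : ∀ ζ ∈ S, 0 ≤ w ζ := fun ζ hζ => sub_nonneg.2 (hmax ζ hζ)
  have hfd : ∀ ζ ∈ Metric.ball (0 : ℂ) 1, ContDiffAt ℝ 2 f ζ := fun ζ hζ => by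
    rw [← contMDiffAt_iff_contDiffAt]
    exact ((hsmooth _ (hint (ball_subset_polygonDomain hζ))).of_le two_le_infty).comp ζ
      (hu.contMDiffAt hζ)
  have hwd : ∀ ζ ∈ Metric.ball (0 : ℂ) 1, ContDiffAt ℝ 2 w ζ := fun ζ hζ =>
    contDiffAt_const.sub (hfd ζ hζ)
  have hwlap : ∀ ζ ∈ Metric.ball (0 : ℂ) 1, r < f ζ → lap w ζ ≤ 0 := fun ζ hζ hr => by
    have h1 : lap w ζ = -lap f ζ := by
      have h2 : ∀ ξ, (fun η => fderiv ℝ w η ξ) = fun η => -fderiv ℝ f η ξ := fun ξ => by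
        funext η
        rw [hw, fderiv_const_sub]
        rfl
      rw [lap, lap, h2, h2, fderiv_fun_neg, fderiv_fun_neg, neg_apply,
        neg_apply, neg_add]
    have hi := hint (ball_subset_polygonDomain hζ)
    rw [h1, lap_comp_holomorphic hJ hs (hu.contMDiffAt hζ) hi (hu.eventually_holomorphic hζ)]
    have := hpsc _ hi hr (mfderiv 𝓘(ℝ, ℂ) (QI d) u ζ (1 : ℂ))
    linarith
  -- the maximum is not attained at an interior point
  have hball : ∀ ζ ∈ Metric.ball (0 : ℂ) 1, f ζ < m := by
    intro ζ₀ hζ₀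
    refine lt_of_le_of_ne (hmax _ (ball_subset_polygonDomain hζ₀)) fun heq => ?_
    -- With C = 0 the strong minimum principle makes {f = m} open in the disc. If it were nonempty
    -- it would be the whole disc, contradicting the limits at the punctures.
    have h1 : IsOpen (Metric.ball (0 : ℂ) 1 ∩ {ζ | f ζ = m}) := isOpen_iff_mem_nhds.2 fun ζ hζ => by
      have h2 : ∀ᶠ η in 𝓝 ζ, η ∈ Metric.ball (0 : ℂ) 1 ∧ r < f η :=
        (Metric.isOpen_ball.eventually_mem hζ.1).and
          ((hfd ζ hζ.1).continuousAt.eventually (lt_mem_nhds (hrm.trans_eq hζ.2.symm)))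
      obtain ⟨ρ, hρ, hρ'⟩ := Metric.eventually_nhds_iff_ball.1 h2
      have h3 := strong_minimum_principle (w := w) hρ le_rfl
        (fun η hη => (hwd η (hρ' η hη).1).contDiffWithinAt)
        (fun η hη => hwS η (ball_subset_polygonDomain (hρ' η hη).1))
        (fun η hη => by
          rw [zero_mul]
          exact hwlap η (hρ' η hη).1 (hρ' η hη).2) (sub_eq_zero.2 hζ.2.symm)
      filter_upwards [h2, h3] with η h4 h5
      exact ⟨h4.1, (sub_eq_zero.1 h5).symm⟩
    have h2 : IsOpen (Metric.ball (0 : ℂ) 1 ∩ {ζ | f ζ < m}) := isOpen_iff_mem_nhds.2 fun ζ hζ =>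
      inter_mem (Metric.isOpen_ball.mem_nhds hζ.1)
        ((hfd ζ hζ.1).continuousAt.eventually (gt_mem_nhds hζ.2))
    have h3 := (convex_ball (0 : ℂ) 1).isPreconnected.subset_left_of_subset_union h1 h2
      (disjoint_left.2 fun ζ h h' => h'.2.ne h.2) (fun ζ h => by
        rcases (hmax ζ (ball_subset_polygonDomain h)).eq_or_lt with h' | h'
        · exact Or.inl ⟨h, h'⟩
        · exact Or.inr ⟨h, h'⟩) ⟨ζ₀, hζ₀, hζ₀, heq⟩
    have := neBot_nhdsWithin_ball_vertex (θ := θ) 0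
    obtain ⟨ζ, h4, h5⟩ := (((hvert 0 m hrm).filter_mono
      (nhdsWithin_mono _ ball_subset_polygonDomain)).and self_mem_nhdsWithin).exists
    exact h4.ne (h3 h5).2
  rcases mem_ball_or_mem_arc hb.1 with h | ⟨i, hi⟩
  · exact lt_irrefl _ (hball b h)
  -- the maximum is attained at a boundary point
  have hb1 : ‖b‖ = 1 := arc_subset_sphere hi
  have hnear : ∀ᶠ η in 𝓝 b, η ∈ Metric.closedBall (0 : ℂ) 1 → η ∈ S ∧ r < f η := by
    have h1 : ∀ᶠ η in 𝓝[S] b, r < f η := (hfc b hb.1).eventually (lt_mem_nhds hrm)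
    filter_upwards [eventually_nhdsWithin_iff.1 h1,
      (isClosed_range_vertex θ).isOpen_compl.mem_nhds hb.1.2] with η h2 h3 h4
    exact ⟨⟨h4, h3⟩, h2 ⟨h4, h3⟩⟩
  obtain ⟨ρ, hρ, hρ'⟩ := Metric.eventually_nhds_iff_ball.1 hnear
  -- The disc of radius σ about (1 - σ)b touches the unit circle from inside at b. The bound 2σ < ρ
  -- keeps it where f > r and away from the marked points; σ ≤ 1/2 makes 1 - σ positive.
  set σ : ℝ := min (1 / 2) (ρ / 3) with hσ
  have hσ0 : 0 < σ := by positivity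
  have hσ1 : σ ≤ 1 / 2 := min_le_left _ _
  have hσρ : 2 * σ < ρ := by
    have : σ ≤ ρ / 3 := min_le_right _ _
    linarith
  set c : ℂ := (1 - σ : ℝ) • b with hc
  have hcb : c - b = (-σ : ℝ) • b := by rw [hc, sub_smul, one_smul, neg_smul]; abel
  have hdist : dist b c = σ := by
    rw [dist_comm, dist_eq_norm, hcb, norm_smul, hb1, mul_one, norm_neg, Real.norm_eq_abs,
      abs_of_pos hσ0]
  have hcn : ‖c‖ = 1 - σ := by
    rw [hc, norm_smul, hb1, mul_one, Real.norm_eq_abs, abs_of_pos (by linarith)]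
  have hcball : ∀ η ∈ Metric.closedBall c σ, η ∈ S ∧ r < f η := fun η hη => by
    refine hρ' η ?_ ?_
    · rw [Metric.mem_ball]
      have h1 := dist_triangle η c b
      rw [dist_comm c b, hdist] at h1
      have h2 : dist η c ≤ σ := hη
      linarith
    · rw [mem_closedBall_zero_iff]
      have h1 := norm_le_norm_add_norm_sub' η c
      rw [hcn, ← dist_eq_norm] at h1
      have h2 : dist η c ≤ σ := hη
      linarith
  have hball' : Metric.ball c σ ⊆ Metric.ball (0 : ℂ) 1 := fun η hη => by
    rw [mem_ball_zero_iff]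
    have h1 := norm_le_norm_add_norm_sub' η c
    rw [hcn, ← dist_eq_norm] at h1
    have h2 : dist η c < σ := hη
    linarith
  obtain ⟨ε, hε, hhopf⟩ := hopf_lemma (w := w) hσ0 le_rfl hdist
    (fun η hη => (hwd η (hball' hη)).contDiffWithinAt)
    (continuousOn_const.sub (hfc.mono fun η hη => (hcball η hη).1))
    (fun η hη => sub_pos.2 (hball η (hball' hη)))
    (fun η hη => hwS η (hcball η hη).1)
    (fun η hη => by
      rw [zero_mul]
      exact hwlap η (hball' hη) (hcball η (Metric.ball_subset_closedBall hη)).2)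
  obtain ⟨A, hA, hA'⟩ := hasFDerivWithinAt_comp_map (u := u) (S := S) (z := b)
    ((hsmooth _ (hint hb.1)).mdifferentiableAt (by simp))
    ((hu.smooth b hb.1).mdifferentiableWithinAt (by simp))
  have hw' : HasFDerivWithinAt w (-A) S b := hA.const_sub m
  -- The inward normal is -b = i(ib) with ib tangent to the circle. Hence du(-b) = J du(ib) with
  -- du(ib) tangent to the Lagrangian, and the Neumann condition applies.
  have hAb : A (-b) = 0 := by
    have h1 := hu.holomorphic b hb.1 (Complex.I * b)
    rw [← mul_assoc, Complex.I_mul_I, neg_one_mul] at h1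
    rw [hA', h1]
    exact hN i _ (hu.boundary i b hi) hrm _ (hu.mfderivWithin_mem_tangentTo hi)
  have hsmall : ∀ᶠ t : ℝ in 𝓝[>] 0, 0 ≤ t ∧ t ≤ 1 / 2 := by
    filter_upwards [Ioc_mem_nhdsGT (show (0 : ℝ) < 1 / 2 by norm_num)] with t ht
      using ⟨ht.1.le, ht.2⟩
  have hfin := le_apply_of_le_ray (v := c - b) hw' (sub_self m) (by
    filter_upwards [hsmall] with t ht
    refine (hcball _ ?_).1
    rw [Metric.mem_closedBall, dist_eq_norm,
      show b + t • (c - b) - c = (1 - t) • (b - c) by module, norm_smul, Real.norm_eq_abs,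
      ← dist_eq_norm b c, hdist, abs_of_nonneg (by linarith [ht.2])]
    exact mul_le_of_le_one_left hσ0.le (by linarith [ht.1])) (by
    filter_upwards [hsmall] with t ht using hhopf t ht.1 ht.2)
  have : (-A) (c - b) = 0 := by
    rw [hcb, neg_apply, map_smul, smul_eq_mul]
    rw [map_neg, neg_eq_zero] at hAb
    rw [hAb, mul_zero, neg_zero]
  linarith

end Sectorial
end
theorem mainTheorem9 {d : ℕ} {M : Type*} [TopologicalSpace M] [T2Space M]
    [SecondCountableTopology M] [ChartedSpace (EuclideanQuadrant d) M]
    [IsManifold (Sectorial.QI d) ∞ M]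
    (X : Sectorial.LiouvilleSector d M) (P : Sectorial.SmoothingProfile X)
    (J : Sectorial.EndField d M) (hJ : Sectorial.IsSectorial P J)
    {k : ℕ} (L : Fin (k + 1) → Set M)
    (hL : ∀ i, Sectorial.IsGradientSectorial P J (L i))
    (hcompat : ∃ K : Set M, IsCompact K ∧ K ⊆ (Sectorial.QI d).interior M ∧
      ∀ i, ∀ x ∈ L i \ K, ∀ v w : TangentSpace (Sectorial.QI d) x,
        X.om x (J x v) (J x w) = X.om x v w)
    (δ : ℝ) (hδ : 0 < δ)
    (hdist : ∀ i, Sectorial.DistGE X.toLiouvilleForm J (L i)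
      ((Sectorial.QI d).boundary M) δ) :
    ∃ r₀ : ℝ, 0 < r₀ ∧
      ∀ p : Fin (k + 1) → M, (∀ i, p i ∈ L i ∩ L (i + 1)) →
      ∀ (θ : Fin (k + 1) → ℝ) (u : ℂ → M), Sectorial.IsPolygon J L p θ u →
        u '' Sectorial.polygonDomain θ ⊆
          {x ∈ (Sectorial.QI d).interior M | P.endProfile x ≤
            max r₀ (Finset.univ.sup' Finset.univ_nonempty (fun i => P.endProfile (p i)))} := by
  obtain ⟨K₁, hK₁, hK₁i, hpsc⟩ := hJ.pseudoconvex
  obtain ⟨K₂, hK₂, hK₂i, hcomp⟩ := hcompat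
  have hbdd : ∀ K : Set M, IsCompact K → K ⊆ (Sectorial.QI d).interior M →
      ∃ B : ℝ, ∀ x ∈ K, P.endProfile x ≤ B := fun K hK hKi => by
    obtain ⟨B, hB⟩ := hK.bddAbove_image (P.contMDiffOn_endProfile.continuousOn.mono hKi)
    exact ⟨B, fun x hx => hB (mem_image_of_mem _ hx)⟩
  obtain ⟨B₁, hB₁⟩ := hbdd K₁ hK₁ hK₁i
  obtain ⟨B₂, hB₂⟩ := hbdd K₂ hK₂ hK₂i
  choose R hR0 hR using fun i => (hL i).invariant
  obtain ⟨r₀, hr₀, h1, h2, h3⟩ : ∃ r₀ : ℝ, 0 < r₀ ∧ B₁ ≤ r₀ ∧ B₂ ≤ r₀ ∧ ∀ i, R i ≤ r₀ := by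
    -- r₀ dominates the end-profile function on both exceptional compact sets and all the thresholds
    -- R i; their sum dominates each because they are positive. Above r₀ pseudoconvexity,
    -- compatibility and tangency of the gradient hold together.
    refine ⟨max 1 (max B₁ (max B₂ (∑ i, R i))), by positivity, by simp, by simp, fun i => ?_⟩
    have := Finset.single_le_sum (f := R) (fun j _ => (hR0 j).le) (Finset.mem_univ i)
    exact this.trans (by simp)
  refine ⟨r₀, hr₀, fun p hp θ u hu => ?_⟩
  set r := max r₀ (Finset.univ.sup' Finset.univ_nonempty fun i => P.endProfile (p i)) with hr
  have hr₀r : r₀ ≤ r := le_max_left _ _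
  have hint := hu.mapsTo_interior hJ (fun i => (hL i).subset_interior) (fun i => (hp i).1)
  rintro _ ⟨z, hz, rfl⟩
  refine ⟨hint hz, hu.le_of_pseudoconvex hJ.toIsTameACS P.contMDiffOn_endProfile hint
    (fun i => (hL i).subset_interior (hp i).1)
    (fun i => le_max_of_le_right (Finset.le_sup' (fun i => P.endProfile (p i)) (Finset.mem_univ i)))
    (fun x hx hrx v => hpsc x ⟨hx, fun hK => ?_⟩ v) (fun i x hx hrx v hv => ?_) hz⟩
  · linarith [hB₁ x hK]
  · refine Sectorial.dfun_apply_eq_zero_of_gradient_mem hJ.toIsTameACS (hL i).toIsExactLagrangian hx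
      (hR i x hx (by linarith [h3 i])) (hcomp i x ⟨hx, fun hK => ?_⟩) hv
    linarith [hB₂ x hK]
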